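/- Consider first-order logic with equality over a countable signature of constant symbols and of predicate symbols of arbitrary finite arities, without non-constant function symbols. For $n \ge 0$, a sentence $\varphi := \exists\vec z\,\forall\vec x_1\exists\vec y_1\ldots\forall\vec x_n\exists\vec y_n.\,\psi$ with quantifier-free $\psi$ (any of the tuples $\vec z,\vec x_k,\vec y_k$ may be empty) belongs to the Separated Fragment (SF) if no atom of $\psi$ contains both a variable from $\vec x_1\cup\ldots\cup\vec x_n$ and a variable from $\vec y_1\cup\ldots\cup\vec y_n$ (variables from $\vec z$ may occur anywhere). Let $\mathrm{len}(\varphi)$ be the number of letters of $\varphi$ when it is written as a string over a fixed finite alphabet, with variables, constant symbols and predicate symbols numbered in binary. Let $2^{\uparrow 0}(m) := m$ and $2^{\uparrow (k+1)}(m) := 2^{2^{\uparrow k}(m)}$. **Theorem.** Let $\varphi := \exists\vec z\,\forall\vec x_1\exists\vec y_1\ldots\forall\vec x_n\exists\vec y_n.\,\psi$ be a sentence in SF with $\psi$ quantifier-free. Satisfiability of $\varphi$ can be decided nondeterministically in time that is at most $n$-fold exponential in $\mathrm{len}(\varphi)$. More precisely, there are a nondeterministic multi-tape Turing machine $M$ and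 a polynomial $p$ with natural number coefficients such that for every $n \ge 0$ and every SF sentence $\varphi$ of the above form, every computation of $M$ on the string $\varphi$ halts after at most $2^{\uparrow n}\bigl(p(\mathrm{len}(\varphi))\bigr)$ steps, and $M$ has an accepting computation on $\varphi$ if and only if $\varphi$ has a model. -/

import Mathlib

/-- The signature: countably many constant symbols, no function symbols of positive arity, and
countably many predicate symbols of each arity.  Equality belongs to the logic. -/
abbrev sig : FirstOrder.Language.{0, 0} where
  Functions := fun k => match k with
    | 0 => ℕ
    | _ + 1 => Empty
  Relations := fun _ => ℕ

/-! ### The Separated Fragment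

Formulas and their semantics are those of `FirstOrder.Language`.  In `sig.BoundedFormula Empty n`
the variables in scope are numbered `0, …, n - 1`, and the next quantifier binds the variable
number `n`; so all quantifiers of a prenex sentence bind distinct variables. -/

/-- The variables that occur in a term. -/
def termVars {n : ℕ} : sig.Term (Empty ⊕ Fin n) → Set ℕ
  | .var (Sum.inr i) => {(i : ℕ)}
  | .func _ ts => ⋃ i, termVars (ts i)

/-- The sets `vars(A)`, for the atoms `A` that occur in a formula. -/
def atomVars : {n : ℕ} → sig.BoundedFormula Empty n → Set (Set ℕ)
  | _, .falsum => ∅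
  | _, .equal t u => {termVars t ∪ termVars u}
  | _, .rel _ ts => {⋃ i, termVars (ts i)}
  | _, .imp φ ψ => atomVars φ ∪ atomVars ψ
  | _, .all φ => atomVars φ

/-- Two sets of variables are separated in a formula if no atom of the formula contains variables
from both of them. -/
def SeparatedIn {n : ℕ} (X Y : Set ℕ) (φ : sig.BoundedFormula Empty n) : Prop :=
  Disjoint X Y ∧ ∀ V ∈ atomVars φ, V ∩ X = ∅ ∨ V ∩ Y = ∅

open scoped Classical in
/-- Bind all `N` variables of a formula, in the order `0, …, N - 1` (variable `0` outermost): the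
variables in `U` universally, the other ones existentially. -/
noncomputable def quantify (U : Set ℕ) : {N : ℕ} → sig.BoundedFormula Empty N → sig.Sentence
  | 0, φ => φ
  | N + 1, φ => quantify U (if N ∈ U then φ.all else φ.ex)

/-- `IsSF n φ`: the sentence `φ` belongs to the Separated Fragment and has the form
`∃z ∀x₁ ∃y₁ … ∀xₙ ∃yₙ. ψ` with `ψ` quantifier-free.  The function `b` assigns to each variable the
number of its quantifier block: `z` is the block `0`, `x_k` is the block `2k - 1`, and `y_k` is the
block `2k`.  Blocks may be empty. -/
def IsSF (n : ℕ) (φ : sig.Sentence) : Prop :=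
  ∃ (N : ℕ) (b : ℕ → ℕ) (ψ : sig.BoundedFormula Empty N),
    Monotone b ∧ (∀ v < N, b v ≤ 2 * n) ∧ ψ.IsQF ∧
    SeparatedIn {v | v < N ∧ Odd (b v)} {v | v < N ∧ Even (b v) ∧ b v ≠ 0} ψ ∧
    φ = quantify {v | Odd (b v)} ψ

/-! ### Sentences as strings -/

/-- The finite alphabet in which formulas are written. -/
inductive Letter : Type
  | bit (b : Bool)
  | var
  | con
  | pred
  | eq
  | fls
  | imp
  | all

/-- The binary representation of a number. -/
def digits (k : ℕ) : List Letter := (Nat.bits k).map Letter.bit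

/-- A variable or a constant symbol is a marker followed by its number in binary. -/
def encodeTerm {n : ℕ} : sig.Term (Empty ⊕ Fin n) → List Letter
  | .var (Sum.inr i) => Letter.var :: digits i
  | .func (l := 0) c _ => Letter.con :: digits c

/-- Formulas are written in prefix notation, with symbols and variables numbered in binary. -/
def encode : {n : ℕ} → sig.BoundedFormula Empty n → List Letter
  | _, .falsum => [Letter.fls]
  | _, .equal t u => Letter.eq :: (encodeTerm t ++ encodeTerm u)
  | _, .rel P ts => Letter.pred :: (digits P ++ (List.ofFn fun i => encodeTerm (ts i)).flatten)
  | _, .imp φ ψ => Letter.imp :: (encode φ ++ encode ψ)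
  | n, .all φ => Letter.all :: Letter.var :: (digits n ++ encode φ)

/-- The length of a formula: the number of letters needed to write it down. -/
def len {n : ℕ} (φ : sig.BoundedFormula Empty n) : ℕ := (encode φ).length

/-! ### Nondeterministic Turing machines -/

/-- A nondeterministic Turing machine with input alphabet `A` and finitely many two-way infinite
tapes.  The blank symbol is `default : Γ`. -/
structure NTM (A : Type) where
  /-- the tapes -/
  K : Type
  [finK : Finite K]
  [decK : DecidableEq K]
  /-- the input tape -/
  input : K
  /-- the tape alphabet -/
  Γ : Type
  [finΓ : Finite Γ]
  [blank : Inhabited Γ]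
  /-- the input letters as tape symbols -/
  letter : A → Γ
  letter_injective : Function.Injective letter
  letter_ne_blank : ∀ a, letter a ≠ default
  /-- the states -/
  Q : Type
  [finQ : Finite Q]
  start : Q
  accept : Q
  /-- the possible moves for a state and the scanned symbols: the next state and, for each tape, the
  symbol written and the direction of the head (`none`: the head stays) -/
  δ : Q → (K → Γ) → Set (Q × (K → Γ × Option Turing.Dir))

namespace NTM

attribute [instance] NTM.finK NTM.decK NTM.finΓ NTM.blank NTM.finQ

variable {A : Type} (M : NTM A)

/-- A configuration: a state and the tape contents with head positions. -/
structure Cfg where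
  state : M.Q
  tape : M.K → Turing.Tape M.Γ

/-- The initial configuration: the input stands on the input tape, with the head on its first
letter; all other tapes are blank. -/
def init (w : List A) : M.Cfg where
  state := M.start
  tape := fun k => if k = M.input then Turing.Tape.mk₁ (w.map M.letter) else Turing.Tape.mk₁ []

/-- Write a symbol and move the head. -/
def act (a : M.Γ × Option Turing.Dir) (T : Turing.Tape M.Γ) : Turing.Tape M.Γ :=
  match a.2 with
  | none => T.write a.1
  | some d => (T.write a.1).move d

/-- A single step of the machine. -/
def Step (c c' : M.Cfg) : Prop :=
  ∃ m ∈ M.δ c.state (fun k => (c.tape k).head),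
    c' = ⟨m.1, fun k => M.act (m.2 k) (c.tape k)⟩

/-- `M.Reach t c c'`: some computation of exactly `t` steps leads from `c` to `c'`. -/
inductive Reach : ℕ → M.Cfg → M.Cfg → Prop
  | refl (c : M.Cfg) : Reach 0 c c
  | tail {t : ℕ} {c c' c'' : M.Cfg} : Reach t c c' → M.Step c' c'' → Reach (t + 1) c c''

/-- Every computation on the input `w` halts after at most `T` steps. -/
def HaltsWithin (w : List A) (T : ℕ) : Prop :=
  ∀ (t : ℕ) (c : M.Cfg), M.Reach t (M.init w) c → t ≤ T

/-- Some computation on the input `w` reaches the accepting state. -/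
def Accepts (w : List A) : Prop :=
  ∃ (t : ℕ) (c : M.Cfg), M.Reach t (M.init w) c ∧ c.state = M.accept

end NTM

/-- The iterated exponential: `tower 0 m = m` and `tower (k + 1) m = 2 ^ tower k m`. -/
def tower : ℕ → ℕ → ℕ
  | 0, m => m
  | k + 1, m => 2 ^ tower k m

/-!
A sentence `∃z ∀x₁ ∃y₁ … ∀xₙ ∃yₙ. ψ` of the Separated Fragment that has a model has one whose size is
at most `n`-fold exponential in the length of the sentence, and a nondeterministic machine can guess
such a model, one value at a time, while it evaluates the sentence for all values of the universal
variables.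

*Small models.*  Fix the values of `z`.  Then the truth value of an atom depends on the universal
variables only or on the existential variables only, and the existential variables contribute to the
truth of `ψ` just the set of those of their atoms that are true.  Define the type of a choice for
`y₁, …, yₙ` to be this set of atoms, and the type of a choice for `y₁, …, y_k` to be the set of the
types to which it can be extended (`typ`).  Choices of the same type are interchangeable, whatever
the values of the universal variables are (`play_of_typ_eq`), so one representative for each type
suffices (`exists_representatives`).  There are `tower (k + 1) M` types for `M` atoms and `k` further
blocks (`card_ty`), and the representatives, the values of `z` and the constants form a small domain
(`exists_small_model`, `isSatisfiable_iff_exists_le`).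

*Checking.*  All objects that the machine has to guess, that is, the interpretation of the constant
and predicate symbols and the Skolem functions for the existential variables, are coded by one
Boolean function on strings.  The machine writes each value that it uses into a log, and aborts when
a new entry clashes with an old one.  A log without clashes is part of the graph of a function
(`clashFree_iff`).  For each assignment to the universal variables the log gets one entry with the
values of all variables, where the value of an existential variable is a value of the function at
what stands before it; hence the value depends on the preceding variables only
(`qsat_of_transcripts`), and conversely the plays of a winning strategy do not clash
(`exists_transcripts`).  Together this is `exists_leavesC_iff`.

*The machine.*  The procedure is written in a small language for programs with stacks, `Prog`, which
is compiled to Turing machines with a tape for each stack (`machine`).  The relation `Impl` describes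
the possible results of a program and bounds the length of all its runs, and `Claims` does the same
relative to the log.  The bound for the domain size is computed from the input in unary: it is an
exponential for each block of universal quantifiers (`impl_rewrite`), so the machine need not know
`n`.  The running time is a power of the domain size whose exponent is linear in the length of the
sentence; the outermost exponential absorbs it (`time_le_tower`), and without universal quantifiers
the exponent is constant.
-/

namespace SF

open Turing

/-! ### Stack programs -/

/-- The tape symbols: the input letters, a marker `ex` for existential quantifiers, two kinds of
data bits (`key` and `val`), pairs of truth values, two separators and a unary digit. -/
inductive Sym : Type
  | bit (b : Bool) | var | con | pred | eq | fls | imp | all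
  | ex | key (b : Bool) | val (b : Bool) | two (a b : Bool) | sep | fin | mark
  deriving DecidableEq, Fintype

/-- The names of the stacks.  The formula is kept in `inp` (the part that is still to be read) and
`inq` (the part already read, reversed).  The stack `rul` holds a number in unary, in the end the
largest domain element `m`.  The values of the universal variables are in `cnt`, and move to `cnq`
when they are read; `tr` collects the values of all variables in the order of the quantifiers, and
`env` has an entry for each variable.  Claims are collected in `log`.  The stack `goal` contains
truth values to be established, `atm` and `atb` hold values of terms, and `alt` holds an entry to be
compared with others.  The stacks `flag` and `lastU` serve as registers, and `siz`, `ruq`, `cur` and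
`scr` as scratch space. -/
inductive Stk : Type
  | inp | inq | siz | rul | ruq | cnt | cnq | tr | env | log | atm | atb | cur | alt | scr
  | goal | flag | lastU
  deriving DecidableEq

instance : Fintype Stk where
  elems := {.inp, .inq, .siz, .rul, .ruq, .cnt, .cnq, .tr, .env, .log, .atm, .atb, .cur, .alt,
    .scr, .goal, .flag, .lastU}
  complete k := by cases k <;> decide

/-- The contents of all stacks; the head of a list is the top of the stack. -/
@[ext] structure Store : Type where
  inp : List Sym := []
  inq : List Sym := []
  siz : List Sym := []
  rul : List Sym := []
  ruq : List Sym := []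
  cnt : List Sym := []
  cnq : List Sym := []
  tr : List Sym := []
  env : List Sym := []
  log : List Sym := []
  atm : List Sym := []
  atb : List Sym := []
  cur : List Sym := []
  alt : List Sym := []
  scr : List Sym := []
  goal : List Sym := []
  flag : List Sym := []
  lastU : List Sym := []

/-- The content of a stack. -/
def Store.get (s : Store) : Stk → List Sym
  | .inp => s.inp | .inq => s.inq | .siz => s.siz | .rul => s.rul | .ruq => s.ruq
  | .cnt => s.cnt | .cnq => s.cnq | .tr => s.tr | .env => s.env | .log => s.log
  | .atm => s.atm | .atb => s.atb | .cur => s.cur | .alt => s.alt | .scr => s.scr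
  | .goal => s.goal | .flag => s.flag | .lastU => s.lastU

/-- The store with given stack contents. -/
def Store.of (f : Stk → List Sym) : Store :=
  ⟨f .inp, f .inq, f .siz, f .rul, f .ruq, f .cnt, f .cnq, f .tr, f .env, f .log, f .atm, f .atb,
    f .cur, f .alt, f .scr, f .goal, f .flag, f .lastU⟩

@[simp] theorem Store.get_of (f : Stk → List Sym) (k : Stk) : (Store.of f).get k = f k := by
  cases k <;> rfl

theorem Store.of_get (s : Store) : Store.of s.get = s := rfl

theorem Store.get_injective {s s' : Store} (h : ∀ k, s.get k = s'.get k) : s = s' := by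
  rw [← Store.of_get s, ← Store.of_get s', funext h]

/-- An operation on a single stack; `put a` replaces the top symbol by `a`. -/
inductive Op : Type
  | keep | pop | push (a : Sym) | put (a : Sym)
  deriving DecidableEq, Fintype

/-- The effect of an operation on a stack. -/
def Op.ap : Op → List Sym → List Sym
  | .keep, l => l
  | .pop, l => l.tail
  | .push a, l => a :: l
  | .put a, l => a :: l.tail

/-- Simultaneous operations on all stacks. -/
def Store.ap (o : Stk → Op) (s : Store) : Store := Store.of fun k => (o k).ap (s.get k)

@[simp] theorem Store.get_ap (o : Stk → Op) (s : Store) (k : Stk) :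
    (s.ap o).get k = (o k).ap (s.get k) := Store.get_of _ k

/-- The top symbols of the stacks. -/
def Store.top (s : Store) (k : Stk) : Option Sym := (s.get k).head?

/-- Nondeterministic programs over the stacks.  Tests and actions depend on the top symbols only;
an action that has no possible outcome aborts the computation. -/
inductive Prog : Type
  | act (f : (Stk → Option Sym) → Set (Stk → Op))
  | seq (p q : Prog)
  | ite (c : (Stk → Option Sym) → Prop) (p q : Prog)
  | loop (c : (Stk → Option Sym) → Prop) (p : Prog)

/-! ### Compilation to Turing machines -/

/-- A control state: the programs that remain to be run, and possibly the second half of a stack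
operation. -/
abbrev Ctl := List Prog × Option (Stk → Op)

/-- The first half of a stack operation on a tape with the scanned symbol `x`. -/
def Op.fst : Op → Option Sym → Option Sym × Option Dir
  | .keep, x => (x, none)
  | .pop, _ => (none, some .right)
  | .push _, x => (x, some .left)
  | .put a, _ => (some a, none)

/-- The second half of a stack operation. -/
def Op.snd : Op → Option Sym → Option Sym × Option Dir
  | .push a, _ => (some a, none)
  | _, x => (x, none)

open scoped Classical in
/-- The transitions of the compiled machine. -/
noncomputable def moves : Ctl → (Stk → Option Sym) → Set (Ctl × (Stk → Option Sym × Option Dir))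
  | (l, some o), h => {((l, none), fun k => (o k).snd (h k))}
  | ([], none), _ => ∅
  | (.act f :: l, none), h => {m | ∃ o ∈ f h, m = ((l, some o), fun k => (o k).fst (h k))}
  | (.seq p q :: l, none), h => {((p :: q :: l, none), fun k => (h k, none))}
  | (.ite c p q :: l, none), h => {(((if c h then p else q) :: l, none), fun k => (h k, none))}
  | (.loop c p :: l, none), h =>
    {((if c h then p :: .loop c p :: l else l, none), fun k => (h k, none))}

/-- The remaining programs that can occur while `p` is run before `l`.  There are finitely many of
them, which makes the set of states of the compiled machine finite. -/
def conts : Prog → List Prog → Set (List Prog)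
  | .act f, l => {.act f :: l}
  | .seq p q, l => {.seq p q :: l} ∪ (conts p (q :: l) ∪ conts q l)
  | .ite c p q, l => {.ite c p q :: l} ∪ (conts p l ∪ conts q l)
  | .loop c p, l => {.loop c p :: l} ∪ conts p (.loop c p :: l)

theorem finite_conts (p : Prog) (l : List Prog) : (conts p l).Finite := by
  induction p generalizing l with
  | act f => simp [conts]
  | seq p q hp hq => simp [conts, hp, hq]
  | ite c p q hp hq => simp [conts, hp, hq]
  | loop c p hp => simp [conts, hp]

theorem self_mem_conts (p : Prog) (l : List Prog) : p :: l ∈ conts p l := by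
  cases p <;> simp [conts]

theorem moves_conts {p : Prog} {l : List Prog} {c : Ctl} {h : Stk → Option Sym} {m}
    (hc : c.1 ∈ insert l (conts p l)) (hm : m ∈ moves c h) (hl : c ≠ (l, none)) :
    m.1.1 ∈ insert l (conts p l) := by
  obtain ⟨cl, co⟩ := c
  cases co with
  | some o =>
    have : m.1.1 = cl := by simp [moves] at hm; simp [hm]
    rwa [this]
  | none =>
    simp only [ne_eq, Prod.mk.injEq, and_true] at hl
    replace hc : cl ∈ conts p l := by simpa [hl] using hc
    induction p generalizing l with
    | act f =>
      simp only [conts, Set.mem_singleton_iff] at hc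
      subst hc
      obtain ⟨o, _, rfl⟩ := hm
      simp
    | seq p q hp hq =>
      simp only [conts, Set.mem_union, Set.mem_singleton_iff] at hc
      rcases hc with rfl | hc | hc
      · simp only [moves, Set.mem_singleton_iff] at hm
        subst hm
        simp [conts, self_mem_conts]
      · by_cases e : cl = q :: l
        · have hc' : cl ∈ conts q l := e ▸ self_mem_conts q l
          rcases hq hl hc' with h | h
          · exact .inl h
          · exact .inr (.inr (.inr h))
        · rcases hp e hc with h | h
          · exact .inr (.inr (.inr (h ▸ self_mem_conts q l)))
          · exact .inr (.inr (.inl h))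
      · rcases hq hl hc with h | h
        · exact .inl h
        · exact .inr (.inr (.inr h))
    | ite c p q hp hq =>
      simp only [conts, Set.mem_union, Set.mem_singleton_iff] at hc
      rcases hc with rfl | hc | hc
      · simp only [moves, Set.mem_singleton_iff] at hm
        subst hm
        by_cases hch : c h <;> simp [conts, self_mem_conts, hch]
      · rcases hp hl hc with h | h
        · exact .inl h
        · exact .inr (.inr (.inl h))
      · rcases hq hl hc with h | h
        · exact .inl h
        · exact .inr (.inr (.inr h))
    | loop c p hp =>
      simp only [conts, Set.mem_union, Set.mem_singleton_iff] at hc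
      have key : cl = .loop c p :: l → m.1.1 ∈ insert l (conts (.loop c p) l) := by
        rintro rfl
        simp only [moves, Set.mem_singleton_iff] at hm
        subst hm
        by_cases hch : c h <;> simp [conts, self_mem_conts, hch]
      by_cases e : cl = .loop c p :: l
      · exact key e
      · rcases hp e (hc.resolve_left e) with h | h
        · exact .inr (.inl h)
        · exact .inr (.inr h)

/-- The input letters as tape symbols. -/
def sym : Letter → Sym
  | .bit b => .bit b | .var => .var | .con => .con | .pred => .pred | .eq => .eq | .fls => .fls
  | .imp => .imp | .all => .all

theorem sym_injective : Function.Injective sym := by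
  intro a b h
  cases a <;> cases b <;> simp_all [sym]

/-- The control states of the machine that runs `p`. -/
abbrev CtlOf (p : Prog) : Type := {c : Ctl // c.1 ∈ insert [] (conts p [])}

instance (p : Prog) : Finite (CtlOf p) := by
  have h : ((insert [] (conts p []) : Set (List Prog)) ×ˢ
      (Set.univ : Set (Option (Stk → Op)))).Finite :=
    ((finite_conts p []).insert _).prod Set.finite_univ
  exact (h.subset fun c hc => ⟨hc, trivial⟩).to_subtype

/-- The Turing machine that runs the program `p`. -/
noncomputable def machine (p : Prog) : NTM Letter where
  K := Stk
  input := .inp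
  Γ := Option Sym
  letter a := some (sym a)
  letter_injective a b h := sym_injective (Option.some.inj h)
  letter_ne_blank a := by simp
  Q := CtlOf p
  start := ⟨([p], none), .inr (self_mem_conts p [])⟩
  accept := ⟨([], none), .inl rfl⟩
  δ q h := {m | (m.1.val, m.2) ∈ moves q.val h}

/-- A configuration, with arbitrary control states. -/
abbrev Conf := Ctl × (Stk → Tape (Option Sym))

/-- Write a symbol and move the head. -/
def tact (a : Option Sym × Option Dir) (T : Tape (Option Sym)) : Tape (Option Sym) :=
  match a.2 with
  | none => T.write a.1
  | some d => (T.write a.1).move d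

/-- A single step of a configuration. -/
def CStep (c c' : Conf) : Prop :=
  ∃ m ∈ moves c.1 (fun k => (c.2 k).head), c' = (m.1, fun k => tact (m.2 k) (c.2 k))

/-- Every computation from the configuration has at most the given number of steps. -/
def HaltsIn : ℕ → Conf → Prop
  | 0, c => ∀ c', ¬ CStep c c'
  | u + 1, c => ∀ c', CStep c c' → HaltsIn u c'

theorem HaltsIn.succ {u : ℕ} {c : Conf} (h : HaltsIn u c) : HaltsIn (u + 1) c := by
  induction u generalizing c with
  | zero => exact fun c' hc => (h c' hc).elim
  | succ u ih => exact fun c' hc => ih (h c' hc)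

theorem HaltsIn.mono {u v : ℕ} {c : Conf} (h : HaltsIn u c) (huv : u ≤ v) : HaltsIn v c := by
  induction huv with
  | refl => exact h
  | step _ ih => exact ih.succ

/-- Some computation from the configuration accepts. -/
def Acc (c : Conf) : Prop := ∃ T, Relation.ReflTransGen CStep c (([], none), T)

/-- The tapes that hold the stacks of a store. -/
def tapes (s : Store) (k : Stk) : Tape (Option Sym) := Tape.mk₁ ((s.get k).map some)

/-- The configuration that runs the programs `l` from the store `s`. -/
def conf (l : List Prog) (s : Store) : Conf := ((l, none), tapes s)

theorem head_tapes (s : Store) (k : Stk) : (tapes s k).head = s.top k := by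
  unfold tapes Store.top
  cases s.get k <;> rfl

/-- Two steps of the machine carry out a stack operation: as the top of the stack is the scanned
symbol, pushing means to move to the left first and to write afterwards. -/
theorem tact_fst_snd (o : Op) (l : List Sym) :
    tact (o.snd (tact (o.fst (Tape.mk₁ (l.map some)).head) (Tape.mk₁ (l.map some))).head)
      (tact (o.fst (Tape.mk₁ (l.map some)).head) (Tape.mk₁ (l.map some))) =
      Tape.mk₁ ((o.ap l).map some) := by
  have e : (ListBlank.mk [(none : Option Sym)]) = ListBlank.mk [] :=
    Quotient.sound' (.inr ⟨1, rfl⟩)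
  cases o with
  | keep => simp [Op.fst, Op.snd, Op.ap, tact]
  | pop =>
    cases l with
    | nil =>
      simp only [Op.fst, Op.snd, Op.ap, tact, Tape.mk₁, Tape.mk₂, Tape.mk', Tape.write, Tape.move,
        List.map_nil, List.tail_nil, ListBlank.tail_mk, ListBlank.head_mk, ListBlank.cons_mk]
      rw [e]
    | cons a l =>
      simp only [Op.fst, Op.snd, Op.ap, tact, Tape.mk₁, Tape.mk₂, Tape.mk', Tape.write, Tape.move,
        List.map_cons, List.tail_cons, ListBlank.tail_mk, ListBlank.head_mk, ListBlank.cons_mk]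
      rw [← e]
  | push a =>
    cases l with
    | nil =>
      simp only [Op.fst, Op.snd, Op.ap, tact, Tape.mk₁, Tape.mk₂, Tape.mk', Tape.write, Tape.move,
        List.map_cons, List.tail_cons, ListBlank.tail_mk, ListBlank.head_mk, ListBlank.cons_mk,
        List.map_nil, List.tail_nil]
      congr 1
    | cons b l =>
      simp [Op.fst, Op.snd, Op.ap, tact, Tape.mk₁, Tape.mk₂, Tape.mk', Tape.write, Tape.move]
  | put a =>
    cases l <;>
    simp [Op.fst, Op.snd, Op.ap, tact, Tape.mk₁, Tape.mk₂, Tape.mk', Tape.write]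

theorem cstep_silent {l l' : List Prog} {s : Store} {c' : Conf}
    (h : moves (l, none) (s.top) = {((l', none), fun k => (s.top k, none))}) :
    CStep (conf l s) c' ↔ c' = conf l' s := by
  have : (fun k => (tapes s k).head) = s.top := funext (head_tapes s)
  simp only [CStep, conf, this, h, Set.mem_singleton_iff, exists_eq_left]
  simp [tact, ← head_tapes]

theorem acc_iff_of_step {c d : Conf} (h : ∀ c', CStep c c' ↔ c' = d) : Acc c ↔ Acc d := by
  constructor
  · rintro ⟨T, hT⟩
    rcases hT.cases_head with e | ⟨c', h1, h2⟩
    · subst e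
      obtain ⟨m, hm, -⟩ := (h d).2 rfl
      simp [moves] at hm
    · rw [h] at h1
      subst h1
      exact ⟨T, h2⟩
  · rintro ⟨T, hT⟩
    exact ⟨T, .head ((h d).2 rfl) hT⟩

theorem haltsIn_succ_of_step {c d : Conf} {u : ℕ} (h : ∀ c', CStep c c' ↔ c' = d)
    (hd : HaltsIn u d) : HaltsIn (u + 1) c := by
  intro c' hc
  rw [h] at hc
  exact hc ▸ hd

/-! ### The behaviour of programs -/

/-- `Impl p s t R`: every run of `p` from the store `s` takes at most `t` steps and does not get
stuck unless by an aborting action, and the stores in which the runs end are exactly those in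
`R`.  (This is expressed by the effect on all continuations.) -/
def Impl (p : Prog) (s : Store) (t : ℕ) (R : Set Store) : Prop :=
  ∀ l : List Prog,
    (∀ u, (∀ s' ∈ R, HaltsIn u (conf l s')) → HaltsIn (t + u) (conf (p :: l) s)) ∧
    (Acc (conf (p :: l) s) ↔ ∃ s' ∈ R, Acc (conf l s'))

theorem Impl.mono {p : Prog} {s : Store} {t t' : ℕ} {R : Set Store} (h : Impl p s t R)
    (ht : t ≤ t') : Impl p s t' R :=
  fun l => ⟨fun u hu => ((h l).1 u hu).mono (by omega), (h l).2⟩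

theorem Impl.congr {p : Prog} {s : Store} {t : ℕ} {R R' : Set Store} (h : Impl p s t R)
    (e : R = R') : Impl p s t R' := e ▸ h

theorem impl_act (f : (Stk → Option Sym) → Set (Stk → Op)) (s : Store) :
    Impl (.act f) s 2 {s' | ∃ o ∈ f s.top, s' = s.ap o} := by
  intro l
  have hs : (fun k => (tapes s k).head) = s.top := funext (head_tapes s)
  let mid (o : Stk → Op) : Conf :=
    ((l, some o), fun k => tact ((o k).fst (s.top k)) (tapes s k))
  have h1 : ∀ c', CStep (conf (.act f :: l) s) c' ↔ ∃ o ∈ f s.top, c' = mid o := by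
    intro c'
    simp only [CStep, conf, hs, moves, Set.mem_ofPred_eq]
    constructor
    · rintro ⟨m, ⟨o, ho, rfl⟩, rfl⟩
      exact ⟨o, ho, rfl⟩
    · rintro ⟨o, ho, rfl⟩
      exact ⟨_, ⟨o, ho, rfl⟩, rfl⟩
  have h2 : ∀ o c', CStep (mid o) c' ↔ c' = conf l (s.ap o) := by
    intro o c'
    simp only [CStep, mid, moves, Set.mem_singleton_iff, exists_eq_left, conf]
    have : (fun k => tact ((o k).snd (tact ((o k).fst (s.top k)) (tapes s k)).head)
        (tact ((o k).fst (s.top k)) (tapes s k))) = tapes (s.ap o) := by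
      funext k
      rw [← head_tapes]
      have := tact_fst_snd (o k) (s.get k)
      simp only [tapes, Store.ap, Store.get_of] at this ⊢
      exact this
    rw [this]
  constructor
  · intro u hu
    rw [show 2 + u = (u + 1) + 1 by omega]
    intro c' hc
    obtain ⟨o, ho, rfl⟩ := (h1 c').1 hc
    exact haltsIn_succ_of_step (h2 o) (hu _ ⟨o, ho, rfl⟩)
  · constructor
    · rintro ⟨T, hT⟩
      rcases hT.cases_head with e | ⟨c', hc, h3⟩
      · simp [conf] at e
      · obtain ⟨o, ho, rfl⟩ := (h1 c').1 hc
        exact ⟨_, ⟨o, ho, rfl⟩, (acc_iff_of_step (h2 o)).1 ⟨T, h3⟩⟩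
    · rintro ⟨s', ⟨o, ho, rfl⟩, hA⟩
      obtain ⟨T, hT⟩ := (acc_iff_of_step (h2 o)).2 hA
      exact ⟨T, .head ((h1 _).2 ⟨o, ho, rfl⟩) hT⟩

theorem impl_of_silent {p : Prog} {s : Store} {t : ℕ} {R : Set Store} {ps : List Prog}
    (h : ∀ l, moves (p :: l, none) s.top = {((ps ++ l, none), fun k => (s.top k, none))})
    (hl : ∀ l : List Prog,
      (∀ u, (∀ s' ∈ R, HaltsIn u (conf l s')) → HaltsIn (t + u) (conf (ps ++ l) s)) ∧
      (Acc (conf (ps ++ l) s) ↔ ∃ s' ∈ R, Acc (conf l s'))) : Impl p s (t + 1) R := by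
  intro l
  have hstep : ∀ c', CStep (conf (p :: l) s) c' ↔ c' = conf (ps ++ l) s :=
    fun c' => cstep_silent (h l)
  refine ⟨fun u hu => ?_, (acc_iff_of_step hstep).trans (hl l).2⟩
  rw [show t + 1 + u = (t + u) + 1 by omega]
  exact haltsIn_succ_of_step hstep ((hl l).1 u hu)

theorem impl_then {ι : Type} {p q : Prog} {s : Store} {t1 t2 : ℕ} {P : ι → Prop} {g : ι → Store}
    {R : ι → Set Store} (hp : Impl p s t1 {s1 | ∃ i, P i ∧ s1 = g i})
    (hq : ∀ i, P i → Impl q (g i) t2 (R i)) (l : List Prog) :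
    (∀ u, (∀ s' ∈ {s' | ∃ i, P i ∧ s' ∈ R i}, HaltsIn u (conf l s')) →
      HaltsIn (t1 + t2 + u) (conf (p :: q :: l) s)) ∧
    (Acc (conf (p :: q :: l) s) ↔ ∃ s' ∈ {s' | ∃ i, P i ∧ s' ∈ R i}, Acc (conf l s')) := by
  constructor
  · intro u hu
    rw [add_assoc]
    refine (hp (q :: l)).1 _ ?_
    rintro _ ⟨i, hi, rfl⟩
    exact (hq i hi l).1 u fun s' h' => hu s' ⟨i, hi, h'⟩
  · rw [(hp (q :: l)).2]
    constructor
    · rintro ⟨_, ⟨i, hi, rfl⟩, hA⟩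
      obtain ⟨s', h', hA'⟩ := (hq i hi l).2.1 hA
      exact ⟨s', ⟨i, hi, h'⟩, hA'⟩
    · rintro ⟨s', ⟨i, hi, h'⟩, hA⟩
      exact ⟨_, ⟨i, hi, rfl⟩, (hq i hi l).2.2 ⟨s', h', hA⟩⟩

theorem impl_seq_indexed {ι : Type} {p q : Prog} {s : Store} {t1 t2 : ℕ} {P : ι → Prop}
    {g : ι → Store} {R : ι → Set Store} (hp : Impl p s t1 {s1 | ∃ i, P i ∧ s1 = g i})
    (hq : ∀ i, P i → Impl q (g i) t2 (R i)) :
    Impl (.seq p q) s (t1 + t2 + 1) {s' | ∃ i, P i ∧ s' ∈ R i} :=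
  impl_of_silent (ps := [p, q]) (fun _ => rfl) (impl_then hp hq)

theorem impl_seq {p q : Prog} {s : Store} {t1 t2 : ℕ} {R1 : Set Store} {R2 : Store → Set Store}
    (hp : Impl p s t1 R1) (hq : ∀ s1 ∈ R1, Impl q s1 t2 (R2 s1)) :
    Impl (.seq p q) s (t1 + t2 + 1) {s' | ∃ s1 ∈ R1, s' ∈ R2 s1} :=
  impl_seq_indexed (g := id) (hp.congr (by simp)) hq

theorem impl_ite_pos {c : (Stk → Option Sym) → Prop} {p q : Prog} {s : Store} {t : ℕ}
    {R : Set Store} (hc : c s.top) (hp : Impl p s t R) : Impl (.ite c p q) s (t + 1) R :=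
  impl_of_silent (ps := [p]) (fun l => by simp [moves, hc]) hp

theorem impl_ite_neg {c : (Stk → Option Sym) → Prop} {p q : Prog} {s : Store} {t : ℕ}
    {R : Set Store} (hc : ¬ c s.top) (hp : Impl q s t R) : Impl (.ite c p q) s (t + 1) R :=
  impl_of_silent (ps := [q]) (fun l => by simp [moves, hc]) hp

theorem impl_loop_done {c : (Stk → Option Sym) → Prop} {p : Prog} {s : Store}
    (hc : ¬ c s.top) : Impl (.loop c p) s 1 {s} := by
  refine impl_of_silent (t := 0) (ps := []) (fun l => by simp [moves, hc]) fun l => ?_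
  simp

theorem impl_loop_indexed {ι : Type} {c : (Stk → Option Sym) → Prop} {p : Prog} {s : Store}
    {t1 t2 : ℕ} {P : ι → Prop} {g : ι → Store} {R : ι → Set Store} (hc : c s.top)
    (hp : Impl p s t1 {s1 | ∃ i, P i ∧ s1 = g i})
    (hq : ∀ i, P i → Impl (.loop c p) (g i) t2 (R i)) :
    Impl (.loop c p) s (t1 + t2 + 1) {s' | ∃ i, P i ∧ s' ∈ R i} :=
  impl_of_silent (ps := [p, .loop c p]) (fun l => by simp [moves, hc]) (impl_then hp hq)

theorem impl_loop_step {c : (Stk → Option Sym) → Prop} {p : Prog} {s : Store} {t1 t2 : ℕ}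
    {R1 : Set Store} {R2 : Store → Set Store} (hc : c s.top) (hp : Impl p s t1 R1)
    (hq : ∀ s1 ∈ R1, Impl (.loop c p) s1 t2 (R2 s1)) :
    Impl (.loop c p) s (t1 + t2 + 1) {s' | ∃ s1 ∈ R1, s' ∈ R2 s1} :=
  impl_loop_indexed (g := id) hc (hp.congr (by simp)) hq

/-! Deterministic steps are a frequent special case. -/

theorem impl_seq_det {p q : Prog} {s s1 : Store} {t1 t2 t : ℕ} {R : Set Store}
    (hp : Impl p s t1 {s1}) (hq : Impl q s1 t2 R) (ht : t1 + t2 + 1 ≤ t) :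
    Impl (.seq p q) s t R :=
  ((impl_seq (R2 := fun _ => R) hp (by simpa using hq)).congr (by simp)).mono ht

theorem impl_loop_det {c : (Stk → Option Sym) → Prop} {p : Prog} {s s1 : Store} {t1 t2 t : ℕ}
    {R : Set Store} (hc : c s.top) (hp : Impl p s t1 {s1}) (hq : Impl (.loop c p) s1 t2 R)
    (ht : t1 + t2 + 1 ≤ t) : Impl (.loop c p) s t R :=
  ((impl_loop_step (R2 := fun _ => R) hc hp (by simpa using hq)).congr (by simp)).mono ht

/-- A deterministic action. -/
def det (f : (Stk → Option Sym) → Stk → Op) : Prog := .act fun h => {f h}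

theorem impl_det {f : (Stk → Option Sym) → Stk → Op} {s s' : Store}
    (h : ∀ k, s'.get k = (f s.top k).ap (s.get k)) : Impl (det f) s 2 {s'} := by
  refine (impl_act _ s).congr ?_
  have : s.ap (f s.top) = s' := Store.get_injective fun k => by rw [h, Store.get_ap]
  simp [this]

theorem impl_det_ap (f : (Stk → Option Sym) → Stk → Op) (s : Store) :
    Impl (det f) s 2 {s.ap (f s.top)} := impl_det fun k => Store.get_ap _ s k

/-! ### Correctness of the compilation -/

/-- Forget that the control state belongs to the machine. -/
def raw {p : Prog} (c : (machine p).Cfg) : Conf := (c.state.val, c.tape)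

theorem raw_step {p : Prog} {c c' : (machine p).Cfg} (h : (machine p).Step c c') :
    CStep (raw c) (raw c') := by
  obtain ⟨m, hm, rfl⟩ := h
  exact ⟨(m.1.val, m.2), hm, rfl⟩

theorem exists_step_of_raw {p : Prog} {c : (machine p).Cfg} {d : Conf} (h : CStep (raw c) d) :
    ∃ c', (machine p).Step c c' ∧ raw c' = d := by
  obtain ⟨m, hm, rfl⟩ := h
  have hne : c.state.val ≠ ([], none) := by
    intro e
    simp [raw, e, moves] at hm
  exact ⟨_, ⟨(⟨m.1, moves_conts c.state.2 hm hne⟩, m.2), hm, rfl⟩, rfl⟩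

theorem haltsIn_of_reach {p : Prog} {c c' : (machine p).Cfg} {t u : ℕ}
    (h : (machine p).Reach t c c') (hu : HaltsIn u (raw c)) :
    ∃ v, u = t + v ∧ HaltsIn v (raw c') := by
  induction h with
  | refl c => exact ⟨u, by omega, hu⟩
  | tail _ hs ih =>
    obtain ⟨v, rfl, hv⟩ := ih hu
    cases v with
    | zero => exact (hv _ (raw_step hs)).elim
    | succ v => exact ⟨v, by omega, hv _ (raw_step hs)⟩

theorem raw_reach {p : Prog} {c c' : (machine p).Cfg} {t : ℕ} (h : (machine p).Reach t c c') :
    Relation.ReflTransGen CStep (raw c) (raw c') := by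
  induction h with
  | refl c => exact .refl
  | tail _ hs ih => exact ih.tail (raw_step hs)

theorem exists_reach_of_raw {p : Prog} {c : (machine p).Cfg} {d : Conf}
    (h : Relation.ReflTransGen CStep (raw c) d) :
    ∃ t c', (machine p).Reach t c c' ∧ raw c' = d := by
  induction h with
  | refl => exact ⟨0, c, .refl c, rfl⟩
  | tail _ hs ih =>
    obtain ⟨t, c1, h1, rfl⟩ := ih
    obtain ⟨c2, h2, rfl⟩ := exists_step_of_raw hs
    exact ⟨t + 1, c2, .tail h1 h2, rfl⟩

theorem raw_init (p : Prog) (w : List Letter) :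
    raw ((machine p).init w) = conf [p] { inp := w.map sym } := by
  refine Prod.ext rfl (funext fun k => ?_)
  change (if k = Stk.inp then Tape.mk₁ (w.map fun a => some (sym a)) else Tape.mk₁ []) = _
  cases k <;> simp [tapes, Store.get, Function.comp_def, conf]

/-- The machine for `p` halts within the time of `p`, and it accepts if and only if some run of `p`
ends regularly. -/
theorem machine_correct {p : Prog} {w : List Letter} {t : ℕ} {R : Set Store}
    (h : Impl p { inp := w.map sym } t R) :
    (machine p).HaltsWithin w t ∧ ((machine p).Accepts w ↔ R.Nonempty) := by
  have hnil : ∀ s : Store, HaltsIn 0 (conf [] s) := by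
    rintro s c' ⟨m, hm, -⟩
    simp [conf, moves] at hm
  constructor
  · intro t' c hc
    have h0 := (h []).1 0 fun s' _ => hnil s'
    rw [← raw_init] at h0
    obtain ⟨v, hv, -⟩ := haltsIn_of_reach hc h0
    omega
  · have h1 : (machine p).Accepts w ↔ Acc (conf [p] { inp := w.map sym }) := by
      rw [← raw_init]
      constructor
      · rintro ⟨t', c, hc, e⟩
        refine ⟨c.tape, ?_⟩
        have := raw_reach hc
        rwa [show raw c = (([], none), c.tape) from
          Prod.ext (congrArg Subtype.val e) rfl] at this
      · rintro ⟨T, hT⟩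
        obtain ⟨t', c', hc, e⟩ := exists_reach_of_raw hT
        exact ⟨t', c', hc, Subtype.ext (congrArg Prod.fst e)⟩
    rw [h1, (h []).2]
    constructor
    · rintro ⟨s', hs, -⟩
      exact ⟨s', hs⟩
    · rintro ⟨s', hs⟩
      exact ⟨s', hs, _, .refl⟩

/-! ### Moving symbols between stacks -/

/-- Remove symbols with the property `c` from the stack `src`; each symbol `a` is copied as `f a` to
every stack `k` with `g k = some f`. -/
def xfer (src : Stk) (c : Sym → Prop) (g : Stk → Option (Sym → Sym)) : Prog :=
  .loop (fun h => ∃ a, h src = some a ∧ c a) (det fun h k =>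
    if k = src then .pop else
      match g k with
      | none => .keep
      | some f => .push (f ((h src).getD .mark)))

theorem impl_xfer {src : Stk} {c : Sym → Prop} {g : Stk → Option (Sym → Sym)} {s s' : Store}
    (xs r : List Sym) (hs : s.get src = xs ++ r) (hx : ∀ x ∈ xs, c x) (hr : ∀ x ∈ r.head?, ¬ c x)
    (h' : ∀ k, s'.get k = if k = src then r else
      match g k with
      | none => s.get k
      | some f => (xs.map f).reverse ++ s.get k) :
    Impl (xfer src c g) s (3 * xs.length + 1) {s'} := by
  induction xs generalizing s with
  | nil =>
    have : s' = s := by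
      refine Store.get_injective fun k => ?_
      rw [h' k]
      by_cases hk : k = src
      · subst hk; simpa using hs.symm
      · cases hg : g k <;> simp [hk]
    rw [this]
    refine impl_loop_done ?_
    rintro ⟨a, ha, hc⟩
    rw [Store.top, hs] at ha
    exact hr a ha hc
  | cons x xs ih =>
    have htop : s.top src = some x := by simp [Store.top, hs]
    refine impl_loop_det (t2 := 3 * xs.length + 1) ⟨x, htop, hx x (by simp)⟩ (impl_det_ap _ _) ?_
      (by simp; omega)
    refine ih ?_ (fun y hy => hx y (by simp [hy])) fun k => ?_
    · simp [Store.ap, Op.ap, hs]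
    · rw [h' k]
      by_cases hk : k = src
      · simp [hk]
      · cases hg : g k <;> simp [hk, Store.ap, hg, Op.ap, htop]

/-- Move the content of a stack to another stack, in reverse order. -/
def mv (src dst : Stk) : Prog :=
  xfer src (fun _ => True) fun k => if k = dst then some id else none

theorem impl_mv {src dst : Stk} {s s' : Store} (n : ℕ) (hn : (s.get src).length = n)
    (h' : ∀ k, s'.get k = if k = src then [] else
      if k = dst then (s.get src).reverse ++ s.get k else s.get k) :
    Impl (mv src dst) s (3 * n + 1) {s'} := by
  subst hn
  refine impl_xfer (s.get src) [] (by simp) (by simp) (by simp) fun k => ?_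
  rw [h' k]
  by_cases h1 : k = src
  · simp [h1]
  · by_cases h2 : k = dst <;> simp [h1, h2]

/-- Remove all symbols with the property `c` from the top of a stack. -/
def drop (src : Stk) (c : Sym → Prop) : Prog := xfer src c fun _ => none

/-- The test whether a stack is not empty. -/
def nonempty (k : Stk) (h : Stk → Option Sym) : Prop := h k ≠ none

/-- Do nothing. -/
def skip : Prog := det fun _ _ => .keep

theorem impl_skip (s : Store) : Impl skip s 2 {s} := impl_det fun _ => rfl

/-! ### Unary arithmetic -/

/-- Double the number in the stack `rul`. -/
def dbl : Prog :=
  .seq (xfer .rul (fun _ => True) fun k => if k = .ruq ∨ k = .scr then some id else none)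
    (.seq (mv .ruq .rul) (mv .scr .rul))

theorem impl_dbl {s : Store} (n : ℕ) (h1 : s.rul = .replicate n .mark) (h2 : s.ruq = [])
    (h3 : s.scr = []) :
    Impl dbl s (9 * n + 5) {{ s with rul := .replicate (2 * n) .mark }} := by
  refine impl_seq_det (s1 := { s with rul := [], ruq := s.rul, scr := s.rul })
    (impl_xfer s.rul [] (by simp [Store.get]) (by simp) (by simp) ?_)
    (impl_seq_det (s1 := { s with ruq := [], scr := s.rul })
      (impl_mv n (by simp [Store.get, h1]) ?_)
      (impl_mv n (by simp [Store.get, h1]) ?_) le_rfl) (by simp [h1]; omega)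
  · intro k; cases k <;> simp [Store.get, h1, h2, h3]
  · intro k; cases k <;> simp [Store.get, h1]
  · intro k; cases k <;> simp [Store.get, h1, h2, h3, two_mul]

/-- Replace the number `n` in the stack `rul` by `2 ^ n`. -/
def exp : Prog :=
  .seq (mv .rul .siz) (.seq (det fun _ k => if k = .rul then .push .mark else .keep)
    (.loop (nonempty .siz) (.seq (det fun _ k => if k = .siz then .pop else .keep) dbl)))

theorem impl_exp_loop {s : Store} (n r : ℕ) (h0 : s.siz = .replicate n .mark)
    (h1 : s.rul = .replicate r .mark) (h2 : s.ruq = []) (h3 : s.scr = []) :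
    Impl (.loop (nonempty .siz) (.seq (det fun _ k => if k = .siz then .pop else .keep) dbl)) s
      (9 * r * (2 ^ n - 1) + 10 * n + 1)
      {{ s with siz := [], rul := .replicate (r * 2 ^ n) .mark }} := by
  induction n generalizing s r with
  | zero =>
    refine ((impl_loop_done (s := s) ?_).congr ?_).mono (by omega)
    · simp [nonempty, Store.top, Store.get, h0]
    · congr 1; ext1 <;> simp [h0, h1]
  | succ n ih =>
    refine impl_loop_det (t1 := 9 * r + 8)
      (s1 := { s with siz := .replicate n .mark, rul := .replicate (2 * r) .mark }) ?_
      (impl_seq_det (s1 := { s with siz := .replicate n .mark }) (impl_det ?_)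
        ((impl_dbl r (by exact h1) (by exact h2) (by exact h3)).congr ?_) (by omega))
      ((ih (2 * r) (by rfl) (by rfl) (by exact h2) (by exact h3)).congr ?_) ?_
    · simp [nonempty, Store.top, Store.get, h0, List.replicate_succ]
    · intro k; cases k <;> simp [Store.get, Op.ap, h0]
    · rfl
    · simp; ring_nf
    · obtain ⟨c, hc⟩ := Nat.exists_eq_add_of_le' (Nat.one_le_two_pow (n := n))
      rw [pow_succ, hc, Nat.add_sub_cancel, show (c + 1) * 2 - 1 = 2 * c + 1 by omega]
      nlinarith

theorem impl_exp {s : Store} (n : ℕ) (h0 : s.siz = []) (h1 : s.rul = .replicate n .mark)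
    (h2 : s.ruq = []) (h3 : s.scr = []) :
    Impl exp s (30 * 2 ^ n) {{ s with rul := .replicate (2 ^ n) .mark }} := by
  have hn : n + 1 ≤ 2 ^ n := Nat.lt_two_pow_self
  refine impl_seq_det (s1 := { s with rul := [], siz := .replicate n .mark })
    (impl_mv n (by simp [Store.get, h1]) ?_)
    (impl_seq_det (s1 := { s with rul := .replicate 1 .mark, siz := .replicate n .mark })
      (impl_det ?_) ((impl_exp_loop n 1 (by rfl) (by rfl) (by exact h2) (by exact h3)).congr ?_)
        le_rfl) (by omega)
  · intro k; cases k <;> simp [Store.get, h0, h1]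
  · intro k; cases k <;> simp [Store.get, Op.ap]
  · simp [h0]

/-- Replace the number in the stack `rul` by an arbitrary number that is not larger. -/
def guessSize : Prog :=
  .seq (mv .rul .siz) (.loop (nonempty .siz)
    (.act fun _ => {o | ∃ b : Bool, o = fun k =>
      if k = .siz then .pop else if k = .rul ∧ b then .push .mark else .keep}))

theorem impl_guessSize {s : Store} (n : ℕ) (h0 : s.siz = []) (h1 : s.rul = .replicate n .mark) :
    Impl guessSize s (6 * n + 3) {s' | ∃ m ≤ n, s' = { s with rul := .replicate m .mark }} := by
  have key : ∀ (n r : ℕ) (s : Store), s.siz = .replicate n .mark → s.rul = .replicate r .mark →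
      Impl (.loop (nonempty .siz)
        (.act fun _ => {o | ∃ b : Bool, o = fun k =>
          if k = .siz then .pop else if k = .rul ∧ b then .push .mark else .keep})) s (3 * n + 1)
        {s' | ∃ m ≤ n, s' = { s with siz := [], rul := .replicate (r + m) .mark }} := by
    intro n
    induction n with
    | zero =>
      intro r s h0 h1
      refine (impl_loop_done (s := s) (by simp [nonempty, Store.top, Store.get, h0])).congr ?_
      ext s'
      simp only [Set.mem_singleton_iff, Nat.le_zero, Set.mem_ofPred_eq, exists_eq_left, add_zero]
      rw [← h1, show ({ s with siz := [] } : Store) = s by ext1 <;> simp [h0]]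
    | succ n ih =>
      intro r s h0 h1
      refine ((impl_loop_step (t1 := 2) (t2 := 3 * n + 1) (R2 := fun s1 => {s' | ∃ m ≤ n, s' =
        { s1 with siz := [], rul := .replicate (s1.rul.length + m) .mark }}) ?_
        (impl_act _ s) ?_).congr ?_).mono (by omega)
      · simp [nonempty, Store.top, Store.get, h0, List.replicate_succ]
      · rintro s1 ⟨o, ⟨b, rfl⟩, rfl⟩
        refine ih _ _ ?_ ?_
        · simp [Store.ap, Op.ap, Store.of, Store.get, h0, List.replicate_succ]
        · cases b <;> simp [Store.ap, Op.ap, Store.of, Store.get, h1, List.replicate_succ]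
      · ext s'
        simp only [Set.mem_ofPred_eq]
        constructor
        · rintro ⟨_, ⟨_, ⟨b, rfl⟩, rfl⟩, m, hm, rfl⟩
          cases b
          · exact ⟨m, by omega, by simp [Store.ap, Op.ap, Store.of, Store.get, h1]⟩
          · exact ⟨m + 1, by omega, by
              simp [Store.ap, Op.ap, Store.of, Store.get, h1]; omega⟩
        · rintro ⟨m, hm, rfl⟩
          by_cases h : m = 0
          · exact ⟨_, ⟨_, ⟨false, rfl⟩, rfl⟩, m, by omega, by
              simp [Store.ap, Op.ap, Store.of, Store.get, h1]⟩
          · exact ⟨_, ⟨_, ⟨true, rfl⟩, rfl⟩, m - 1, by omega, by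
              simp [Store.ap, Op.ap, Store.of, Store.get, h1]; omega⟩
  refine impl_seq_det (s1 := { s with rul := [], siz := .replicate n .mark })
    (impl_mv n (by simp [Store.get, h1]) ?_) ((key n 0 _ rfl rfl).congr ?_) (by omega)
  · intro k; cases k <;> simp [Store.get, h0, h1]
  · simp [h0]

/-! ### The log -/

/-- Two entries clash if they differ for the first time in a data bit of the kind `val`.  Hence an
entry is a list of claims about a function on strings: each `val` bit is the value of the function
at what stands before it, and entries clash if they claim different values for the same
argument. -/
def Clash (e e' : List Sym) : Prop :=
  ∃ p a b r r', a ≠ b ∧ e = p ++ .val a :: r ∧ e' = p ++ .val b :: r'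

/-- A list of entries as the content of a stack. -/
def encL (es : List (List Sym)) : List Sym := es.flatMap fun e => e ++ [.fin]

@[simp] theorem encL_nil : encL [] = [] := rfl

@[simp] theorem encL_cons (e : List Sym) (es : List (List Sym)) :
    encL (e :: es) = e ++ .fin :: encL es := by simp [encL]

@[simp] theorem encL_append (es es' : List (List Sym)) : encL (es ++ es') = encL es ++ encL es' :=
    by
  simp [encL]

/-- Compare the entry in the stack `alt` with all entries in the stack `g`, and abort if they
clash. -/
def check (g : Stk) : Prog :=
  -- The common prefix with an entry is removed; then the scanned symbols decide about a clash.
  .seq (.loop (nonempty g)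
    (.seq (.loop (fun h => h g = h .alt ∧ h .alt ≠ none) (det fun h k =>
        if k = g ∨ k = .alt then .pop
        else if k = .scr ∨ k = .cur then .push ((h .alt).getD .mark) else .keep))
      (.seq (.act fun h => {o | (¬ ∃ a b, h g = some (.val a) ∧ h .alt = some (.val b)) ∧
          o = fun _ => .keep})
        (.seq (mv .cur .alt)
          (.seq (xfer g (· ≠ .fin) fun k => if k = .scr then some id else none)
            (det fun _ k => if k = g then .pop else if k = .scr then .push .fin else .keep))))))
    (mv .scr g)

theorem exists_first_difference (e e' : List Sym) :
    ∃ p x y, e = p ++ x ∧ e' = p ++ y ∧ (x.head? ≠ y.head? ∨ y = []) := by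
  induction e generalizing e' with
  | nil => exact ⟨[], [], e', by simp, by simp, by cases e' <;> simp⟩
  | cons a e ih =>
    cases e' with
    | nil => exact ⟨[], a :: e, [], by simp, by simp, by simp⟩
    | cons b e' =>
      by_cases h : a = b
      · subst h
        obtain ⟨p, x, y, rfl, rfl, h⟩ := ih e'
        exact ⟨a :: p, x, y, by simp, by simp, h⟩
      · exact ⟨[], a :: e, b :: e', by simp, by simp, by simp [h]⟩

theorem clash_append_left {p e e' : List Sym} : Clash (p ++ e) (p ++ e') ↔ Clash e e' := by
  constructor
  · rintro ⟨q, a, b, r, r', hab, h1, h2⟩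
    induction p generalizing q with
    | nil => exact ⟨q, a, b, r, r', hab, by simpa using h1, by simpa using h2⟩
    | cons x p ih =>
      cases q with
      | nil =>
        simp only [List.cons_append, List.nil_append, List.cons.injEq] at h1 h2
        exact (hab (by simpa using h1.1.symm.trans h2.1)).elim
      | cons z q =>
        simp only [List.cons_append, List.cons.injEq] at h1 h2
        exact ih q h1.2 h2.2
  · rintro ⟨q, a, b, r, r', hab, rfl, rfl⟩
    exact ⟨p ++ q, a, b, r, r', hab, by simp, by simp⟩

theorem clash_iff_of_head {x y : List Sym} (h : x.head? ≠ y.head? ∨ y = []) :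
    Clash x y ↔ ∃ a b, x.head? = some (.val a) ∧ y.head? = some (.val b) := by
  constructor
  · rintro ⟨p, a, b, r, r', hab, rfl, rfl⟩
    cases p with
    | nil => exact ⟨a, b, rfl, rfl⟩
    | cons z p => simp at h
  · rintro ⟨a, b, hx, hy⟩
    cases x <;> cases y <;> simp_all
    exact ⟨[], a, b, _, _, h, rfl, rfl⟩

/-- A store during the comparison of entries. -/
def Store.cmp (s : Store) (g : Stk) (gv cur alt scr : List Sym) : Store :=
  .of (Function.update { s with cur := cur, alt := alt, scr := scr }.get g gv)

theorem Store.get_cmp (s : Store) {g : Stk} (gv cur alt scr : List Sym) (k : Stk) :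
    (s.cmp g gv cur alt scr).get k = if k = g then gv else
      if k = .cur then cur else if k = .alt then alt else if k = .scr then scr else s.get k := by
  rw [cmp, get_of, Function.update_apply]
  congr 1
  cases k <;> rfl

theorem impl_cmp_loop {s : Store} {g : Stk} (hg : g = .env ∨ g = .log) (p x y cur scr : List Sym)
    (h : x.head? ≠ y.head? ∨ y = []) :
    Impl (.loop (fun h => h g = h .alt ∧ h .alt ≠ none) (det fun h k =>
        if k = g ∨ k = .alt then .pop
        else if k = .scr ∨ k = .cur then .push ((h .alt).getD .mark) else .keep))
      (s.cmp g (p ++ x) cur (p ++ y) scr) (3 * p.length + 1)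
      {s.cmp g x (p.reverse ++ cur) y (p.reverse ++ scr)} := by
  have hga : Stk.alt ≠ g := by rcases hg with rfl | rfl <;> simp
  induction p generalizing cur scr with
  | nil =>
    refine impl_loop_done ?_
    simp only [Store.top, Store.get_cmp, hga]
    rintro ⟨h1, h2⟩
    simp at h1 h2
    tauto
  | cons a p ih =>
    refine impl_loop_det (t2 := 3 * p.length + 1) ?_ (impl_det_ap _ _) ?_ (by simp; omega)
    · simp [Store.top, Store.get_cmp, hga]
    · convert ih (a :: cur) (a :: scr) using 1
      · refine Store.get_injective fun k => ?_
        rcases hg with rfl | rfl <;> cases k <;> simp [Store.get_cmp, Store.ap, Op.ap, Store.top]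
      · simp

/-- The runs of `check` are those where the entry clashes with no entry of the list `es`. -/
theorem impl_check {s : Store} {g : Stk} (hg : g = .env ∨ g = .log) (es : List (List Sym))
    (hs : s.get g = encL es) (hes : ∀ e ∈ es, .fin ∉ e) (he : .fin ∉ s.alt)
    (hcur : s.cur = []) (hscr : s.scr = []) :
    Impl (check g) s (40 * (encL es).length + 40) {s' | s' = s ∧ ∀ e ∈ es, ¬ Clash e s.alt} := by
  have hga : Stk.alt ≠ g := by rcases hg with rfl | rfl <;> simp
  have hgc : Stk.cur ≠ g := by rcases hg with rfl | rfl <;> simp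
  have hgs : Stk.scr ≠ g := by rcases hg with rfl | rfl <;> simp
  have key : ∀ (es : List (List Sym)) (scr : List Sym), (∀ e ∈ es, .fin ∉ e) →
      Impl (.loop (nonempty g) (.seq (.loop (fun h => h g = h .alt ∧ h .alt ≠ none) (det fun h k =>
        if k = g ∨ k = .alt then .pop
        else if k = .scr ∨ k = .cur then .push ((h .alt).getD .mark) else .keep))
      (.seq (.act fun h => {o | (¬ ∃ a b, h g = some (.val a) ∧ h .alt = some (.val b)) ∧
          o = fun _ => .keep})
        (.seq (mv .cur .alt)
          (.seq (xfer g (· ≠ .fin) fun k => if k = .scr then some id else none)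
            (det fun _ k => if k = g then .pop else if k = .scr then .push .fin else .keep))))))
        (s.cmp g (encL es) [] s.alt scr) (25 * (encL es).length + 1)
        {s' | s' = s.cmp g [] [] s.alt ((encL es).reverse ++ scr) ∧
          ∀ e ∈ es, ¬ Clash e s.alt} := by
    intro es
    induction es with
    | nil =>
      intro scr _
      refine (impl_loop_done ?_).congr (by simp)
      simp [nonempty, Store.top, Store.get_cmp]
    | cons e es ih =>
      intro scr hes
      obtain ⟨p, x, y, rfl, hy, hxy⟩ := exists_first_difference e s.alt
      have hfy : .fin ∉ y := fun h => he (by simp [hy, h])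
      have hx : ∀ a ∈ x, a ≠ Sym.fin := by
        rintro a ha rfl
        exact hes (p ++ x) (by simp) (by simp [ha])
      set x' := x ++ .fin :: encL es with hx'
      have hxy' : x'.head? ≠ y.head? ∨ y = [] := by
        cases x with
        | nil =>
          cases y with
          | nil => simp
          | cons b y =>
            left
            simp only [hx', List.nil_append, List.head?_cons]
            simp at hfy ⊢
            tauto
        | cons a x => simpa [hx'] using hxy
      have hcl : Clash (p ++ x) s.alt ↔ ∃ a b, x'.head? = some (.val a) ∧
          y.head? = some (.val b) := by
        rw [hy, clash_append_left, clash_iff_of_head hxy]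
        cases x with
        | nil => simp [hx']
        | cons a x => simp [hx']
      have hall : ∀ a ∈ (encL ((p ++ x) :: es)), True := by simp
      refine ((impl_loop_step (t1 := 12 * p.length + 6 * x.length + 15)
        (R1 := {s' | s' = s.cmp g (encL es) [] s.alt ((p ++ x ++ [Sym.fin]).reverse ++ scr) ∧
          ¬ Clash (p ++ x) s.alt})
        (R2 := fun _ => {s' | s' = s.cmp g [] [] s.alt ((encL ((p ++ x) :: es)).reverse ++ scr) ∧
          ∀ e ∈ es, ¬ Clash e s.alt}) ?_ ?_ ?_).congr ?_).mono
          (t := 12 * p.length + 6 * x.length + 15 + (25 * (encL es).length + 1) + 1) ?_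
      · simp only [nonempty, Store.top, Store.get_cmp]
        cases p <;> cases x <;> simp
      · rw [show encL ((p ++ x) :: es) = p ++ x' by simp [hx']]
        nth_rewrite 1 [hy]
        refine impl_seq_det (impl_cmp_loop hg p x' y [] scr hxy')
          (t2 := 9 * p.length + 6 * x.length + 13)
          ?_ (by omega)
        refine ((impl_seq (t2 := 9 * p.length + 6 * x.length + 10)
          (R2 := fun _ => {s.cmp g (encL es) [] s.alt ((p ++ x ++ [Sym.fin]).reverse ++ scr)})
          (impl_act _ _) ?_).congr ?_).mono (by omega)
        · rintro s1 ⟨o, ⟨-, rfl⟩, rfl⟩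
          refine impl_seq_det (s1 := s.cmp g x' [] s.alt (p.reverse ++ scr))
            (impl_mv p.length ?_ ?_) (impl_seq_det
              (s1 := s.cmp g (.fin :: encL es) [] s.alt ((p ++ x).reverse ++ scr))
              (impl_xfer x (.fin :: encL es) ?_ hx ?_ ?_) (impl_det ?_) le_rfl) (by omega)
          · simp [Store.ap, Op.ap, Store.get_cmp, hgc]
          · intro k
            rcases hg with rfl | rfl <;> cases k <;>
              simp [Store.ap, Op.ap, Store.get_cmp, hy]
          · simp [Store.get_cmp, hx']
          · simp
          · intro k
            rcases hg with rfl | rfl <;> cases k <;>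
              simp [Store.get_cmp]
          · intro k
            rcases hg with rfl | rfl <;> cases k <;> simp [Store.get_cmp, Op.ap]
        · ext s'
          simp only [Set.mem_ofPred_eq, Set.mem_singleton_iff, hcl]
          simp only [Store.top, Store.get_cmp, hga]
          constructor
          · rintro ⟨s1, ⟨o, ⟨h1, -⟩, -⟩, h2⟩
            exact ⟨h2, by simpa using h1⟩
          · rintro ⟨h2, h1⟩
            exact ⟨_, ⟨_, ⟨by simpa using h1, rfl⟩, rfl⟩, h2⟩
      · rintro s1 ⟨rfl, -⟩
        refine (ih _ fun e he => hes e (by simp [he])).congr ?_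
        simp
      · ext s'
        simp only [Set.mem_ofPred_eq, List.forall_mem_cons]
        constructor
        · rintro ⟨s1, ⟨rfl, h1⟩, rfl, h2⟩
          exact ⟨rfl, h1, h2⟩
        · rintro ⟨rfl, h1, h2⟩
          exact ⟨_, ⟨rfl, h1⟩, rfl, h2⟩
      · simp; omega
  have hs0 : s = s.cmp g (encL es) [] s.alt [] := by
    refine Store.get_injective fun k => ?_
    rw [Store.get_cmp]
    split_ifs with h1 h2 h3 h4
    · rw [h1, hs]
    · rw [h2]; exact hcur
    · rw [h3]; rfl
    · rw [h4]; exact hscr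
    · rfl
  have h1 := key es [] hes
  rw [← hs0] at h1
  refine ((impl_seq (t2 := 3 * (encL es).length + 1) (R2 := fun _ => {s}) h1 ?_).congr ?_).mono
    (by omega)
  · rintro s1 ⟨rfl, -⟩
    refine impl_mv _ (by simp [Store.get_cmp, hgs]) fun k => ?_
    conv_lhs => rw [hs0]
    simp only [Store.get_cmp, hgs, List.append_nil, if_true, if_false, reduceCtorEq]
    by_cases hk : k = g
    · subst hk; simp [hgs.symm]
    · simp [hk]
      by_cases hk' : k = .scr <;> simp [hk']
  · ext s'
    simp only [Set.mem_ofPred_eq, Set.mem_singleton_iff]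
    constructor
    · rintro ⟨s1, ⟨-, h⟩, h2⟩; exact ⟨h2, h⟩
    · rintro ⟨h2, h⟩; exact ⟨_, ⟨rfl, h⟩, h2⟩

/-- Move the entry in the stack `alt` to the stack `g`. -/
def app (g : Stk) : Prog :=
  .seq (det fun _ k => if k = g then .push .fin else .keep) (.seq (mv .alt .cur) (mv .cur g))

theorem impl_app {s s' : Store} {g : Stk} (hg : g = .env ∨ g = .log) (hcur : s.cur = [])
    (h' : ∀ k, s'.get k = if k = g then s.alt ++ .fin :: s.get k else if k = .alt then []
      else s.get k) : Impl (app g) s (6 * s.alt.length + 6) {s'} := by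
  refine impl_seq_det (s1 := s.cmp g (.fin :: s.get g) [] s.alt s.scr) (impl_det ?_)
    (impl_seq_det (s1 := s.cmp g (.fin :: s.get g) s.alt.reverse [] s.scr)
      (impl_mv s.alt.length ?_ ?_) (impl_mv s.alt.length ?_ ?_) le_rfl) (by omega)
  · intro k
    simp only [Store.get_cmp]
    rcases hg with rfl | rfl <;> cases k <;> simp [Op.ap, Store.get, hcur]
  · rcases hg with rfl | rfl <;> simp [Store.get_cmp]
  · intro k
    rcases hg with rfl | rfl <;> cases k <;> simp [Store.get_cmp]
  · rcases hg with rfl | rfl <;> simp [Store.get_cmp]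
  · intro k
    simp only [h', Store.get_cmp]
    rcases hg with rfl | rfl <;> cases k <;> simp [Store.get, hcur]

/-! ### Programs with a log of claims -/

/-- A list of entries without separators, no two of which clash. -/
def ClashFree (es : List (List Sym)) : Prop :=
  (∀ e ∈ es, Sym.fin ∉ e) ∧ es.Pairwise fun e e' => ¬ Clash e' e

theorem clashFree_append_right {es es' : List (List Sym)} (h : ClashFree (es ++ es')) :
    ClashFree es' :=
  ⟨fun e he => h.1 e (by simp [he]), (List.pairwise_append.1 h.2).2.1⟩

theorem clashFree_nil : ClashFree [] := ⟨by simp, .nil⟩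

/-- Lists of new log entries together with the other stacks. -/
abbrev Outcomes : Type := Set (List (List Sym) × Store)

/-- `Claims B p s t w X`: from the store `s` with an arbitrary clash-free log, the program `p` runs
for at most `t` steps, and a pair `(es, s')` in `X` stands for the runs that add the entries `es`,
of total length at most `w`, to the log and end with the store `s'`; exactly the runs where
the log remains clash-free are possible.  The bound `B` limits the size of the log. -/
def Claims (B : ℕ) (p : Prog) (s : Store) (t w : ℕ) (X : Outcomes) : Prop :=
  (∀ x ∈ X, (encL x.1).length ≤ w) ∧
    ∀ es, ClashFree es → (encL es).length + w ≤ B → Impl p { s with log := encL es } t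
      {s' | ∃ x, (x ∈ X ∧ ClashFree (x.1 ++ es)) ∧
        s' = { x.2 with log := encL (x.1 ++ es) }}

variable {B : ℕ} {p q : Prog} {s s1 : Store} {t t' t1 t2 w w' w1 w2 : ℕ}
  {X X' : Outcomes} {c : (Stk → Option Sym) → Prop}

theorem Claims.mono (h : Claims B p s t w X) (ht : t ≤ t') (hw : w ≤ w') :
    Claims B p s t' w' X :=
  ⟨fun x hx => (h.1 x hx).trans hw, fun es hes hB => (h.2 es hes (by omega)).mono ht⟩

theorem Claims.congr (h : Claims B p s t w X) (e : X = X') : Claims B p s t w X' := e ▸ h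

theorem claims_of_impl {ι : Type} {P : ι → Prop} {g : ι → Store}
    (h : ∀ l, Impl p { s with log := l } t {s' | ∃ i, P i ∧ s' = { g i with log := l }}) :
    Claims B p s t 0 {x | ∃ i, P i ∧ x = ([], g i)} := by
  refine ⟨by rintro _ ⟨i, -, rfl⟩; simp, fun es hes _ => (h _).congr ?_⟩
  ext s'
  constructor
  · rintro ⟨i, hi, rfl⟩
    exact ⟨_, ⟨⟨i, hi, rfl⟩, hes⟩, rfl⟩
  · rintro ⟨_, ⟨⟨i, hi, rfl⟩, -⟩, rfl⟩
    exact ⟨i, hi, rfl⟩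

/-- Composition with respect to the log; the hypothesis `hr` is the rule for a sequence or a
loop. -/
theorem claims_then {ι : Type} {P : ι → Prop} {e : ι → List (List Sym)} {g : ι → Store}
    {Y : ι → Outcomes} {r : Prog}
    (hp : Claims B p s t1 w1 {x | ∃ i, P i ∧ x = (e i, g i)})
    (hq : ∀ i, P i → Claims B q (g i) t2 w2 (Y i))
    (hr : ∀ (es : List (List Sym)) (P' : ι → Prop) (g' : ι → Store) (R : ι → Set Store),
      Impl p { s with log := encL es } t1 {s1 | ∃ i, P' i ∧ s1 = g' i} →
      (∀ i, P' i → Impl q (g' i) t2 (R i)) →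
      Impl r { s with log := encL es } (t1 + t2 + 1) {s' | ∃ i, P' i ∧ s' ∈ R i}) :
    Claims B r s (t1 + t2 + 1) (w1 + w2)
      {x | ∃ i, P i ∧ ∃ y ∈ Y i, x = (y.1 ++ e i, y.2)} := by
  constructor
  · rintro _ ⟨i, hi, y, hy, rfl⟩
    have h1 : (encL (e i)).length ≤ w1 := hp.1 _ ⟨i, hi, rfl⟩
    have h2 := (hq i hi).1 y hy
    simp only [encL_append, List.length_append]
    omega
  · intro es hes hB
    refine (hr es (fun i => P i ∧ ClashFree (e i ++ es))
      (fun i => { g i with log := encL (e i ++ es) })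
      (fun i => {s' | ∃ y, (y ∈ Y i ∧ ClashFree (y.1 ++ (e i ++ es))) ∧
        s' = { y.2 with log := encL (y.1 ++ (e i ++ es)) }})
      ((hp.2 es hes (by omega)).congr ?_) ?_).congr ?_
    · ext s'
      constructor
      · rintro ⟨_, ⟨⟨i, hi, rfl⟩, h⟩, rfl⟩
        exact ⟨i, ⟨hi, h⟩, rfl⟩
      · rintro ⟨i, ⟨hi, h⟩, rfl⟩
        exact ⟨_, ⟨⟨i, hi, rfl⟩, h⟩, rfl⟩
    · rintro i ⟨hi, h⟩
      have h1 : (encL (e i)).length ≤ w1 := hp.1 _ ⟨i, hi, rfl⟩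
      exact (hq i hi).2 _ h (by simp only [encL_append, List.length_append]; omega)
    · ext s'
      constructor
      · rintro ⟨i, ⟨hi, -⟩, y, ⟨hy, h⟩, rfl⟩
        exact ⟨_, ⟨⟨i, hi, y, hy, rfl⟩, by simpa using h⟩, by simp⟩
      · rintro ⟨_, ⟨⟨i, hi, y, hy, rfl⟩, h⟩, rfl⟩
        rw [List.append_assoc] at h
        exact ⟨i, ⟨hi, clashFree_append_right h⟩, y, ⟨hy, h⟩, by simp⟩

theorem claims_seq {ι : Type} {P : ι → Prop} {e : ι → List (List Sym)} {g : ι → Store}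
    {Y : ι → Outcomes} (hp : Claims B p s t1 w1 {x | ∃ i, P i ∧ x = (e i, g i)})
    (hq : ∀ i, P i → Claims B q (g i) t2 w2 (Y i)) :
    Claims B (.seq p q) s (t1 + t2 + 1) (w1 + w2)
      {x | ∃ i, P i ∧ ∃ y ∈ Y i, x = (y.1 ++ e i, y.2)} :=
  claims_then hp hq fun _ _ _ _ h1 h2 => impl_seq_indexed h1 h2

theorem claims_loop {ι : Type} {P : ι → Prop} {e : ι → List (List Sym)} {g : ι → Store}
    {Y : ι → Outcomes} (hc : ∀ l, c { s with log := l }.top)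
    (hp : Claims B p s t1 w1 {x | ∃ i, P i ∧ x = (e i, g i)})
    (hq : ∀ i, P i → Claims B (.loop c p) (g i) t2 w2 (Y i)) :
    Claims B (.loop c p) s (t1 + t2 + 1) (w1 + w2)
      {x | ∃ i, P i ∧ ∃ y ∈ Y i, x = (y.1 ++ e i, y.2)} :=
  claims_then hp hq fun es _ _ _ h1 h2 => impl_loop_indexed (hc (encL es)) h1 h2

theorem claims_loop_done (hc : ∀ l, ¬ c { s with log := l }.top) :
    Claims B (.loop c p) s 1 0 {([], s)} :=
  ((claims_of_impl (ι := Unit) (P := fun _ => True) (g := fun _ => s)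
    fun l => (impl_loop_done (hc l)).congr (by simp))).congr (by ext; simp)

theorem claims_ite_pos (hc : ∀ l, c { s with log := l }.top) (hp : Claims B p s t w X) :
    Claims B (.ite c p q) s (t + 1) w X :=
  ⟨hp.1, fun es hes hB => impl_ite_pos (hc _) (hp.2 es hes hB)⟩

theorem claims_ite_neg (hc : ∀ l, ¬ c { s with log := l }.top) (hq : Claims B q s t w X) :
    Claims B (.ite c p q) s (t + 1) w X :=
  ⟨hq.1, fun es hes hB => impl_ite_neg (hc _) (hq.2 es hes hB)⟩

/-- A deterministic first step that does not touch the log. -/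
theorem claims_seq_det (hp : ∀ l, Impl p { s with log := l } t1 {{ s1 with log := l }})
    (hq : Claims B q s1 t2 w X) (ht : t1 + t2 + 1 ≤ t) : Claims B (.seq p q) s t w X :=
  ⟨hq.1, fun es hes hB => impl_seq_det (hp _) (hq.2 es hes hB) ht⟩

theorem claims_det (hp : ∀ l, Impl p { s with log := l } t {{ s1 with log := l }}) :
    Claims B p s t 0 {([], s1)} :=
  (claims_of_impl (ι := Unit) (P := fun _ => True) (g := fun _ => s1)
    fun l => (hp l).congr (by simp)).congr (by ext; simp)

/-- Enter the entry in the stack `alt` into the log. -/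
def claim : Prog := .seq (check .log) (app .log)

theorem claims_claim (hcur : s.cur = []) (hscr : s.scr = []) (he : Sym.fin ∉ s.alt) :
    Claims B claim s (50 * B + 50) (s.alt.length + 1) {([s.alt], { s with alt := [] })} := by
  refine ⟨by simp, fun es hes hB => ?_⟩
  refine ((impl_seq (R2 := fun _ => {{ s with log := s.alt ++ .fin :: encL es, alt := [] }})
    (impl_check (.inr rfl) es rfl hes.1 (by exact he) (by exact hcur) (by exact hscr)) ?_).congr
    ?_).mono (t := 40 * (encL es).length + 40 + (6 * s.alt.length + 6) + 1) (by omega)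
  · rintro s1 ⟨rfl, -⟩
    exact impl_app (.inr rfl) hcur (by intro k; cases k <;> simp [Store.get])
  · ext s'
    simp only [Set.mem_ofPred_eq, Set.mem_singleton_iff]
    constructor
    · rintro ⟨s1, ⟨rfl, h⟩, rfl⟩
      exact ⟨_, ⟨rfl, by simpa using ⟨he, hes.1⟩, List.pairwise_cons.2 ⟨h, hes.2⟩⟩, by simp⟩
    · rintro ⟨_, ⟨rfl, h⟩, rfl⟩
      exact ⟨_, ⟨rfl, (List.pairwise_cons.1 h.2).1⟩, by simp⟩

/-! ### Quantifier-free formulas -/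

/-- Terms: variables and constant symbols. -/
inductive Tm : Type
  | var (i : ℕ)
  | con (c : ℕ)

/-- Quantifier-free formulas. -/
inductive Mat : Type
  | fls
  | eq (t u : Tm)
  | rel (P : ℕ) (ts : List Tm)
  | imp (φ ψ : Mat)

/-- The binary digits of a number. -/
def dg (k : ℕ) : List Sym := (Nat.bits k).map .bit

/-- A term as a string. -/
def encT : Tm → List Sym
  | .var i => .var :: dg i
  | .con c => .con :: dg c

/-- A formula as a string. -/
def encM : Mat → List Sym
  | .fls => [.fls]
  | .eq t u => .eq :: (encT t ++ encT u)
  | .rel P ts => .pred :: (dg P ++ ts.flatMap encT)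
  | .imp φ ψ => .imp :: (encM φ ++ encM ψ)

/-- The digits of the domain element `j` in unary, for the domain `{0, …, m}`. -/
def un (m j : ℕ) : List Bool := .replicate j true ++ .replicate (m - j) false

theorem length_un {m j : ℕ} (h : j ≤ m) : (un m j).length = m := by simp [un, h]

/-- The log entry for the value of a variable. -/
def varE (m i j : ℕ) : List Sym := .var :: (dg i ++ (un m j).map .val)

/-- The log entry for the value of a constant symbol. -/
def conE (m c j : ℕ) : List Sym := .con :: (dg c ++ (un m j).map .val)

/-- The log entry for the truth value of a ground atom.  The arguments are keys, so only the truth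
values for the same predicate symbol and arguments can clash. -/
def predE (m P : ℕ) (js : List ℕ) (g : Bool) : List Sym :=
  .pred :: (dg P ++ (js.flatMap fun j => .sep :: (un m j).map .key) ++ [.val g])

/-- The possible values of a term, with the claims needed. -/
def termC (m : ℕ) (a : ℕ → ℕ) : Tm → Set (ℕ × List (List Sym))
  | .var i => {(a i, [])}
  | .con c => {x | x.1 ≤ m ∧ x.2 = [conE m c x.1]}

/-- The possible values of a list of terms, with the claims needed. -/
def termsC (m : ℕ) (a : ℕ → ℕ) : List Tm → Set (List ℕ × List (List Sym))
  | [] => {([], [])}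
  | t :: ts => {x | ∃ y ∈ termC m a t, ∃ z ∈ termsC m a ts, x = (y.1 :: z.1, z.2 ++ y.2)}

/-- The lists of claims from which the formula can be seen to have the given truth value. -/
def matC (m : ℕ) (a : ℕ → ℕ) : Mat → Bool → Set (List (List Sym))
  | .fls, g => {es | g = false ∧ es = []}
  | .eq t u, g => {es | ∃ y ∈ termC m a t, ∃ z ∈ termC m a u, (g = true ↔ y.1 = z.1) ∧
      es = z.2 ++ y.2}
  | .rel P ts, g => {es | ∃ y ∈ termsC m a ts, es = predE m P y.1 g :: y.2}
  | .imp φ ψ, g => {es | ∃ x y : Bool, (!x || y) = g ∧ ∃ es1 ∈ matC m a φ x,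
      ∃ es2 ∈ matC m a ψ y, es = es2 ++ es1}

/-! ### Guessing domain elements -/

/-- Guess a domain element in unary, where no `true` follows a `false`; its digits `b` are pushed as
`val b` to the stack `cur` and as `f b` to the stack `g`. -/
def guess (g : Stk) (f : Bool → Sym) : Prog :=
  .seq (.loop (nonempty .rul) (.act fun h => {o | ∃ b : Bool,
      (h .cur = some (.val false) → b = false) ∧ o = fun k =>
        if k = .rul then .pop else if k = .ruq then .push .mark
        else if k = .cur then .push (.val b) else if k = g then .push (f b) else .keep}))
    (mv .ruq .rul)

/-- A store during the guess of a domain element. -/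
def Store.gs (s : Store) (g : Stk) (gv cur rul ruq : List Sym) : Store :=
  .of (Function.update { s with cur := cur, rul := rul, ruq := ruq }.get g gv)

theorem Store.get_gs (s : Store) {g : Stk} (gv cur rul ruq : List Sym) (k : Stk) :
    (s.gs g gv cur rul ruq).get k = if k = g then gv else
      if k = .cur then cur else if k = .rul then rul else if k = .ruq then ruq else s.get k := by
  rw [gs, get_of, Function.update_apply]
  congr 1
  cases k <;> rfl

theorem impl_guess_loop {s : Store} {g : Stk} (hg : g = .tr ∨ g = .atm) (f : Bool → Sym)
    (n : ℕ) (gv cv rq : List Sym) (hcv : cv.head? ≠ some (.val false)) :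
    Impl (.loop (nonempty .rul) (.act fun h => {o | ∃ b : Bool,
      (h .cur = some (.val false) → b = false) ∧ o = fun k =>
        if k = .rul then .pop else if k = .ruq then .push .mark
        else if k = .cur then .push (.val b) else if k = g then .push (f b) else .keep}))
      (s.gs g gv cv (.replicate n .mark) rq) (3 * n + 1)
      {s' | ∃ j, j ≤ n ∧ s' = s.gs g (((un n j).map f).reverse ++ gv)
        (((un n j).map .val).reverse ++ cv) [] (.replicate n .mark ++ rq)} := by
  have hgc : Stk.cur ≠ g := by rcases hg with rfl | rfl <;> simp
  have hgr : Stk.rul ≠ g := by rcases hg with rfl | rfl <;> simp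
  -- the effect of a single digit
  have step : ∀ (n : ℕ) (gv cv rq : List Sym) (b : Bool),
      (s.gs g gv cv (.replicate (n + 1) .mark) rq).ap (fun k =>
        if k = .rul then .pop else if k = .ruq then .push .mark
        else if k = .cur then .push (.val b) else if k = g then .push (f b) else .keep) =
      s.gs g (f b :: gv) (.val b :: cv) (.replicate n .mark) (.mark :: rq) := by
    intro n gv cv rq b
    refine Store.get_injective fun k => ?_
    rcases hg with rfl | rfl <;> cases k <;> simp [Store.get_gs, Op.ap]
  -- after the digit `false` only `false` is possible
  have tail : ∀ (n : ℕ) (gv cv rq : List Sym), cv.head? = some (.val false) →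
      Impl (.loop (nonempty .rul) (.act fun h => {o | ∃ b : Bool,
        (h .cur = some (.val false) → b = false) ∧ o = fun k =>
        if k = .rul then .pop else if k = .ruq then .push .mark
        else if k = .cur then .push (.val b) else if k = g then .push (f b) else .keep}))
      (s.gs g gv cv (.replicate n .mark) rq) (3 * n + 1)
      {s.gs g (.replicate n (f false) ++ gv) (.replicate n (.val false) ++ cv) []
        (.replicate n .mark ++ rq)} := by
    intro n
    induction n with
    | zero =>
      intro gv cv rq _
      exact (impl_loop_done (by simp [nonempty, Store.top, Store.get_gs, hgr])).congr (by simp)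
    | succ n ih =>
      intro gv cv rq h
      refine impl_loop_det (t1 := 2) (t2 := 3 * n + 1) ?_ ((impl_act _ _).congr ?_)
        ((ih (f false :: gv) (.val false :: cv) (.mark :: rq) rfl).congr ?_) (by omega)
      · simp [nonempty, Store.top, Store.get_gs, hgr, List.replicate_succ]
      · ext s'
        simp only [Set.mem_ofPred_eq, Set.mem_singleton_iff]
        constructor
        · rintro ⟨_, ⟨b, hb, rfl⟩, rfl⟩
          rw [hb (by simpa [Store.top, Store.get_gs, hgc] using h), step]
        · rintro rfl
          exact ⟨_, ⟨false, by simp, rfl⟩, (step _ _ _ _ _).symm⟩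
      · simp only [List.replicate_succ', List.append_assoc, List.cons_append, List.nil_append]
  induction n generalizing gv cv rq with
  | zero =>
    refine (impl_loop_done (by simp [nonempty, Store.top, Store.get_gs, hgr])).congr ?_
    ext s'
    simp [un]
  | succ n ih =>
    refine ((impl_loop_indexed (ι := Bool) (t1 := 2) (t2 := 3 * n + 1) (P := fun _ => True)
      (g := fun b => s.gs g (f b :: gv) (.val b :: cv) (.replicate n .mark) (.mark :: rq))
      (R := fun b => {s' | ∃ j, (j ≤ n ∧ (b = false → j = 0)) ∧
        s' = s.gs g (((b :: un n j).map f).reverse ++ gv)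
          (((b :: un n j).map .val).reverse ++ cv) [] (.replicate (n + 1) .mark ++ rq)})
      ?_ ((impl_act _ _).congr ?_) ?_).congr ?_).mono (by omega)
    · simp [nonempty, Store.top, Store.get_gs, hgr, List.replicate_succ]
    · ext s'
      simp only [Set.mem_ofPred_eq, true_and]
      constructor
      · rintro ⟨_, ⟨b, -, rfl⟩, rfl⟩
        exact ⟨b, step _ _ _ _ _⟩
      · rintro ⟨b, rfl⟩
        exact ⟨_, ⟨b, fun h => (hcv (by simpa [Store.top, Store.get_gs, hgc] using h)).elim, rfl⟩,
          (step _ _ _ _ _).symm⟩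
    · rintro b -
      cases b with
      | false =>
        refine (tail n _ (.val false :: cv) (.mark :: rq) rfl).congr ?_
        ext s'
        simp only [Set.mem_singleton_iff, Set.mem_ofPred_eq, forall_const]
        constructor
        · rintro rfl
          refine ⟨0, by simp, ?_⟩
          simp [un, List.replicate_succ']
        · rintro ⟨j, ⟨-, rfl⟩, rfl⟩
          simp [un, List.replicate_succ']
      | true =>
        refine (ih (f true :: gv) (.val true :: cv) (.mark :: rq) (by simp)).congr ?_
        ext s'
        simp [List.replicate_succ']
    · ext s'
      simp only [Set.mem_ofPred_eq, true_and]
      constructor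
      · rintro ⟨b, j, ⟨hj, hb⟩, rfl⟩
        cases b with
        | false =>
          obtain rfl := hb rfl
          exact ⟨0, by omega, by simp [un, List.replicate_succ]⟩
        | true => exact ⟨j + 1, by omega, by simp [un, List.replicate_succ]⟩
      · rintro ⟨j, hj, rfl⟩
        cases j with
        | zero => exact ⟨false, 0, by simp, by simp [un, List.replicate_succ]⟩
        | succ j => exact ⟨true, j, by simp; omega, by simp [un, List.replicate_succ]⟩

theorem impl_guess {s : Store} {g : Stk} (hg : g = .tr ∨ g = .atm) (f : Bool → Sym) (m : ℕ)
    (hr : s.rul = .replicate m .mark) (hq : s.ruq = []) (hcv : s.cur.head? ≠ some (.val false))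
    (r : ℕ → Store) (hr' : ∀ j k, (r j).get k =
      if k = g then ((un m j).map f).reverse ++ s.get k
      else if k = .cur then ((un m j).map .val).reverse ++ s.get k else s.get k) :
    Impl (guess g f) s (6 * m + 3) {s' | ∃ j, j ≤ m ∧ s' = r j} := by
  have hgr : Stk.ruq ≠ g := by rcases hg with rfl | rfl <;> simp
  have hs : s = s.gs g (s.get g) s.cur (.replicate m .mark) [] := by
    refine Store.get_injective fun k => ?_
    rw [Store.get_gs]
    split_ifs with h1 h2 h3 h4
    · rw [h1]
    · rw [h2]; rfl
    · rw [h3]; exact hr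
    · rw [h4]; exact hq
    · rfl
  have h1 := impl_guess_loop (s := s) hg f m (s.get g) s.cur [] hcv
  rw [← hs] at h1
  refine ((impl_seq_indexed (R := fun j => {r j}) h1 fun j hj =>
    impl_mv m (by simp [Store.get_gs, hgr]) ?_).mono (by omega)).congr (by simp)
  intro k
  rw [hr']
  rcases hg with rfl | rfl <;> cases k <;> simp [Store.get_gs] <;> simp [Store.get, hr, hq]

/-! ### Terms -/

/-- The symbol is a binary digit. -/
def isBit (x : Sym) : Prop := ∃ b, x = .bit b

theorem isBit_of_mem_dg {k : ℕ} {x : Sym} (h : x ∈ dg k) : isBit x := by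
  simp only [dg, List.mem_map] at h
  obtain ⟨b, -, rfl⟩ := h
  exact ⟨b, rfl⟩

theorem dg_injective : Function.Injective dg := by
  intro a b h
  have h1 : a.bits = b.bits := List.map_injective_iff.2 (fun x y h => by simpa using h) h
  apply (Nat.digits_inj_iff (b := 2)).1
  rw [Nat.digits_two_eq_bits, Nat.digits_two_eq_bits, h1]

theorem un_injective {m j j' : ℕ} (h : un m j = un m j') : j = j' := by
  have := congrArg (List.count true) h
  simpa [un, List.count_replicate] using this

/-- Entries that consist of a key without `val` bits and a value of `val` bits only clash if they
have the same key and different values. -/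
theorem clash_keyed {p q : List Sym} {v v' : List Bool} (hp : ∀ b, Sym.val b ∉ p)
    (hq : ∀ b, Sym.val b ∉ q) (hv : v.length = v'.length) :
    Clash (p ++ v.map .val) (q ++ v'.map .val) ↔ p = q ∧ v ≠ v' := by
  constructor
  · intro h
    have hpq : p = q := by
      obtain ⟨z, a, b, r, r', hab, h1, h2⟩ := h
      rcases List.append_eq_append_iff.1 h1 with ⟨z1, rfl, h3⟩ | ⟨z1, rfl, h3⟩
      · rcases List.append_eq_append_iff.1 h2 with ⟨z2, h4, h5⟩ | ⟨z2, rfl, h5⟩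
        · rcases List.append_eq_append_iff.1 h4 with ⟨w, rfl, h6⟩ | ⟨w, rfl, h6⟩
          · cases w with
            | nil => simp
            | cons c w =>
              have : c ∈ v.map Sym.val := by rw [h3, h6]; simp
              simp only [List.mem_map] at this
              obtain ⟨b', -, rfl⟩ := this
              exact (hq b' (by simp)).elim
          · cases w with
            | nil => simp
            | cons c w =>
              have : c ∈ v'.map Sym.val := by rw [h5, h6]; simp
              simp only [List.mem_map] at this
              obtain ⟨b', -, rfl⟩ := this
              exact (hp b' (by simp)).elim
        · cases z2 with
          | nil =>
            cases z1 with
            | nil => simp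
            | cons c z1 =>
              have : c ∈ v.map Sym.val := by rw [h3]; simp
              simp only [List.mem_map] at this
              obtain ⟨b', -, rfl⟩ := this
              exact (hq b' (by simp)).elim
          | cons c z2 =>
            simp only [List.cons_append, List.cons.injEq] at h5
            exact (hq b (by simp [h5.1])).elim
      · cases z1 with
        | nil =>
          simp only [List.append_nil] at h2 ⊢
          rcases List.append_eq_append_iff.1 h2 with ⟨z2, h4, h5⟩ | ⟨z2, rfl, h5⟩
          · cases z2 with
            | nil => simpa using h4
            | cons c z2 =>
              have : c ∈ v'.map Sym.val := by rw [h5]; simp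
              simp only [List.mem_map] at this
              obtain ⟨b', -, rfl⟩ := this
              exact (hp b' (by simp [h4])).elim
          · cases z2 with
            | nil => simp
            | cons c z2 =>
              simp only [List.cons_append, List.cons.injEq] at h5
              exact (hq b (by simp [h5.1])).elim
        | cons c z1 =>
          simp only [List.cons_append, List.cons.injEq] at h3
          exact (hp a (by simp [h3.1])).elim
    subst hpq
    refine ⟨rfl, ?_⟩
    rintro rfl
    obtain ⟨z, a, b, r, r', hab, h1, h2⟩ := h
    rw [h1] at h2
    simp at h2
    exact hab h2.1
  · rintro ⟨rfl, h⟩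
    rw [clash_append_left]
    induction v generalizing v' with
    | nil => cases v' <;> simp_all
    | cons x v ih =>
      cases v' with
      | nil => simp at hv
      | cons y v' =>
        by_cases hxy : x = y
        · subst hxy
          have := ih (v' := v') (by simpa using hv) (by simpa using h)
          exact (clash_append_left (p := [.val x])).2 this
        · exact ⟨[], x, y, _, _, hxy, rfl, rfl⟩

theorem val_notMem_dg {k : ℕ} (b : Bool) : Sym.val b ∉ dg k := by simp [dg]

theorem clash_varE {m i i' j j' : ℕ} (hj : j ≤ m) (hj' : j' ≤ m) :
    Clash (varE m i j) (varE m i' j') ↔ i = i' ∧ j ≠ j' := by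
  have := clash_keyed (p := .var :: dg i) (q := .var :: dg i') (v := un m j) (v' := un m j')
    (by simp [val_notMem_dg]) (by simp [val_notMem_dg]) (by simp [length_un, hj, hj'])
  rw [varE, varE, ← List.cons_append, ← List.cons_append, this]
  simp only [List.cons.injEq, true_and, dg_injective.eq_iff]
  exact and_congr_right fun _ => not_congr ⟨un_injective, fun h => h ▸ rfl⟩

/-- Read a term and guess its value: the stack `alt` gets the entry that claims this value, and the
value is added to the atom in the stack `atm`. -/
def guessTerm : Prog :=
  .seq (det fun h k => if k = .inp then .pop
      else if k = .inq ∨ k = .cur then .push ((h .inp).getD .mark)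
      else if k = .atm then .push .sep else .keep)
    (.seq (xfer .inp isBit fun k => if k = .inq ∨ k = .cur then some id else none)
      (.seq (guess .atm .key) (mv .cur .alt)))

/-- The condition that the variables below `N` have the values `a`. -/
structure Ready (m N : ℕ) (a : ℕ → ℕ) (E : List (List Sym)) (s : Store) : Prop where
  rul : s.rul = .replicate m .mark
  ruq : s.ruq = []
  cur : s.cur = []
  alt : s.alt = []
  scr : s.scr = []
  env : s.env = encL E
  le : ∀ i < N, a i ≤ m
  sound : ∀ e ∈ E, ∃ i < N, e = varE m i (a i)
  complete : ∀ i < N, varE m i (a i) ∈ E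

theorem impl_guessTerm {s : Store} {m N : ℕ} {a : ℕ → ℕ} {E : List (List Sym)}
    (hs : Ready m N a E s) (x : Sym) (i : ℕ) (hx : x ≠ .val false) (r : List Sym)
    (hi : s.inp = x :: (dg i ++ r)) (hr : ∀ y ∈ r.head?, ¬ isBit y) :
    Impl guessTerm s (6 * (dg i).length + 9 * m + 15) {s' | ∃ j, j ≤ m ∧ s' = { s with
      inp := r, inq := (x :: dg i).reverse ++ s.inq,
      atm := ((un m j).map .key).reverse ++ .sep :: s.atm,
      alt := x :: (dg i ++ (un m j).map .val) }} := by
  refine impl_seq_det (s1 := { s with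
    inp := dg i ++ r, inq := x :: s.inq, cur := [x], atm := .sep :: s.atm }) (impl_det ?_)
    (impl_seq_det (s1 := { s with
      inp := r, inq := (x :: dg i).reverse ++ s.inq, cur := (x :: dg i).reverse,
      atm := .sep :: s.atm }) (impl_xfer (dg i) r (by simp [Store.get])
        (fun y hy => isBit_of_mem_dg hy) hr ?_)
      ((impl_seq_indexed (R := fun j => {{ s with
        inp := r, inq := (x :: dg i).reverse ++ s.inq,
        atm := ((un m j).map .key).reverse ++ .sep :: s.atm,
        alt := x :: (dg i ++ (un m j).map .val) }}) (impl_guess (.inr rfl) .key m (by exact hs.rul)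
          (by exact hs.ruq) ?_
        (fun j => { s with
          inp := r, inq := (x :: dg i).reverse ++ s.inq,
          atm := ((un m j).map .key).reverse ++ .sep :: s.atm,
          cur := ((un m j).map .val).reverse ++ (x :: dg i).reverse }) ?_)
        fun j hj => impl_mv ((dg i).length + 1 + m) ?_ ?_).congr ?_) le_rfl) ?_
  · intro k; cases k <;> simp [Store.get, Op.ap, Store.top, hi, hs.cur]
  · intro k; cases k <;> simp [Store.get]
  · simp only [List.reverse_cons]
    rw [← List.map_id (dg i)]
    rcases h : (dg i).reverse with _ | ⟨y, l⟩
    · simpa [h] using hx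
    · have : y ∈ dg i := by rw [← List.mem_reverse, h]; simp
      obtain ⟨b, rfl⟩ := isBit_of_mem_dg this
      simp [h]
  · intro j k; cases k <;> simp [Store.get]
  · simp [Store.get, length_un hj]; omega
  · intro k; cases k <;> simp [Store.get, hs.cur, hs.alt]
  · ext s'; simp
  · omega

/-- Read a term; for a variable, its value is looked up in the stack `env`. -/
def term : Prog :=
  .ite (fun h => h .inp = some .var)
    (.seq guessTerm (.seq (check .env) (drop .alt fun _ => True)))
    (.seq guessTerm claim)

/-- The store after a term was read. -/
def Store.afterTerm (s : Store) (m : ℕ) (t : Tm) (r : List Sym) (j : ℕ) : Store :=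
  { s with inp := r, inq := (encT t).reverse ++ s.inq,
           atm := ((un m j).map .key).reverse ++ .sep :: s.atm }

/-- The variable of a term, if any, is below `N`. -/
def Tm.Below (N : ℕ) : Tm → Prop
  | .var i => i < N
  | .con _ => True

theorem fin_notMem_varE {m i j : ℕ} : Sym.fin ∉ varE m i j := by simp [varE, dg]

theorem fin_notMem_conE {m i j : ℕ} : Sym.fin ∉ conE m i j := by simp [conE, dg]

theorem claims_term {B : ℕ} {s : Store} {m N : ℕ} {a : ℕ → ℕ} {E : List (List Sym)}
    (hs : Ready m N a E s) (t : Tm) (ht : t.Below N) (r : List Sym) (hi : s.inp = encT t ++ r)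
    (hr : ∀ y ∈ r.head?, ¬ isBit y) (hm : m ≤ B) (hE : (encL E).length ≤ B)
    (hB : (encT t).length ≤ B) :
    Claims B term s (100 * (B + 1)) ((encT t).length + m + 1)
      {x | ∃ y ∈ termC m a t, x = (y.2, s.afterTerm m t r y.1)} := by
  cases t with
  | var i =>
    simp only [encT, List.length_cons] at hB
    refine ((claims_ite_pos ?_ ((claims_of_impl (ι := Unit) (P := fun _ => True)
      (g := fun _ => s.afterTerm m (.var i) r (a i))
      (t := 6 * (dg i).length + 9 * m + 15 + (40 * (encL E).length + 40 +
        (3 * ((dg i).length + 1 + m) + 1) + 1) + 1) fun l => ?_)))).mono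
      (by omega) (Nat.zero_le _) |>.congr ?_
    · intro l; simp [Store.top, Store.get, hi, encT]
    · refine (impl_seq_indexed (R := fun j => {s' | (i = i ∧ j = a i) ∧
        s' = { s.afterTerm m (.var i) r (a i) with log := l }})
        (impl_guessTerm (s := { s with log := l }) (N := N) (a := a) (E := E)
          ⟨hs.1, hs.2, hs.3, hs.4, hs.5, hs.6, hs.7, hs.8, hs.9⟩ .var i (by simp) r hi hr)
        fun j hj => ?_).congr ?_
      · refine (impl_seq (R2 := fun _ => {{ s.afterTerm m (.var i) r j with log := l }})
          (impl_check (.inl rfl) E (by exact hs.env) ?_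
            (by exact fin_notMem_varE (m := m) (i := i) (j := j))
            (by exact hs.cur) (by exact hs.scr)) ?_).congr ?_
        · rintro e he
          obtain ⟨i', -, rfl⟩ := hs.sound e he
          exact fin_notMem_varE
        · rintro s1 ⟨rfl, -⟩
          refine (impl_xfer (varE m i j) [] ?_ (by simp) (by simp) ?_).mono ?_
          · simp [Store.get, varE]
          · intro k; cases k <;> simp [Store.get, Store.afterTerm, hs.alt, encT]
          · simp [varE, length_un hj]
        · ext s'
          simp only [Set.mem_ofPred_eq, Set.mem_singleton_iff, true_and]
          constructor
          · rintro ⟨s1, ⟨rfl, h⟩, rfl⟩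
            have := h _ (hs.complete i ht)
            rw [show (.var :: (dg i ++ (un m j).map .val) : List Sym) = varE m i j from rfl,
              clash_varE (hs.le i ht) hj] at this
            have hja : j = a i := by simpa [eq_comm] using this
            exact ⟨hja, by rw [hja]⟩
          · rintro ⟨rfl, rfl⟩
            refine ⟨_, ⟨rfl, fun e he => ?_⟩, rfl⟩
            obtain ⟨i', hi', rfl⟩ := hs.sound e he
            rw [show (.var :: (dg i ++ (un m (a i)).map .val) : List Sym) = varE m i (a i) from rfl,
              clash_varE (hs.le i' hi') hj]
            rintro ⟨rfl, h⟩
            exact h rfl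
      · ext s'
        simp only [Set.mem_ofPred_eq, true_and, exists_const]
        constructor
        · rintro ⟨j, -, -, h⟩; exact h
        · intro h; exact ⟨a i, hs.le i ht, rfl, h⟩
    · ext x; simp [termC]
  | con c =>
    simp only [encT, List.length_cons] at hB
    refine ((claims_ite_neg ?_ (claims_seq (Y := fun j =>
      {([conE m c j], s.afterTerm m (.con c) r j)})
      (w2 := (encT (.con c)).length + m + 1) (t2 := 50 * B + 50)
      (claims_of_impl (ι := ℕ) (P := fun j => j ≤ m) (g := fun j => { s with
        inp := r, inq := (.con :: dg c).reverse ++ s.inq,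
        atm := ((un m j).map .key).reverse ++ .sep :: s.atm,
        alt := .con :: (dg c ++ (un m j).map .val) })
        fun l => impl_guessTerm (s := { s with log := l }) (N := N) (a := a) (E := E)
          ⟨hs.1, hs.2, hs.3, hs.4, hs.5, hs.6, hs.7, hs.8, hs.9⟩ .con c (by simp) r hi hr)
        ?_)).mono (by omega) (by omega)).congr ?_
    · intro l; simp [Store.top, Store.get, hi, encT]
    · rintro j hj
      refine ((claims_claim (by exact hs.cur) (by exact hs.scr)
        (by exact fin_notMem_conE (m := m) (i := c) (j := j))).mono le_rfl
        (by simp [encT, length_un hj])).congr ?_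
      simp [conE, Store.afterTerm, hs.alt, encT]
    · ext x
      constructor
      · rintro ⟨j, hj, x2, rfl, rfl⟩
        exact ⟨(j, [conE m c j]), ⟨hj, rfl⟩, by simp⟩
      · rintro ⟨⟨j, es⟩, ⟨hj, he⟩, rfl⟩
        obtain rfl : es = [conE m c j] := he
        exact ⟨j, hj, _, rfl, by simp⟩

/-! ### Evaluation of quantifier-free formulas -/

/-- Read a list of terms. -/
def terms : Prog := .loop (fun h => h .inp = some .var ∨ h .inp = some .con) term

/-- The symbol is neither a digit nor the beginning of a term. -/
def Stops (r : List Sym) : Prop := ∀ y ∈ r.head?, ¬ isBit y ∧ y ≠ .var ∧ y ≠ .con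

theorem stops_encM (φ : Mat) (r : List Sym) : Stops (encM φ ++ r) := by
  cases φ <;> simp [Stops, encM, isBit]

theorem notBit_encT (t : Tm) (r : List Sym) : ∀ y ∈ (encT t ++ r).head?, ¬ isBit y := by
  cases t <;> simp [encT, isBit]

theorem notBit_terms (ts : List Tm) {r : List Sym} (hr : Stops r) :
    ∀ y ∈ (ts.flatMap encT ++ r).head?, ¬ isBit y := by
  cases ts with
  | nil => exact fun y hy => (hr y hy).1
  | cons t ts => rw [List.flatMap_cons, List.append_assoc]; exact notBit_encT t _

theorem Ready.of_eq {m N : ℕ} {a : ℕ → ℕ} {E : List (List Sym)} {s s' : Store}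
    (h : Ready m N a E s) (h1 : s'.rul = s.rul) (h2 : s'.ruq = s.ruq) (h3 : s'.cur = s.cur)
    (h4 : s'.alt = s.alt) (h5 : s'.scr = s.scr) (h6 : s'.env = s.env) : Ready m N a E s' :=
  ⟨h1.trans h.rul, h2.trans h.ruq, h3.trans h.cur, h4.trans h.alt, h5.trans h.scr,
    h6.trans h.env, h.le, h.sound, h.complete⟩

/-- The store after a list of terms was read. -/
def Store.afterTerms (s : Store) (m : ℕ) (ts : List Tm) (r : List Sym) (js : List ℕ) : Store :=
  { s with inp := r, inq := (ts.flatMap encT).reverse ++ s.inq,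
           atm := (js.flatMap fun j => .sep :: (un m j).map .key).reverse ++ s.atm }

theorem length_le_flatMap_encT (ts : List Tm) : ts.length ≤ (ts.flatMap encT).length := by
  induction ts with
  | nil => simp
  | cons t ts ih =>
    have : 1 ≤ (encT t).length := by cases t <;> simp [encT]
    rw [List.flatMap_cons, List.length_append, List.length_cons]
    omega

theorem claims_terms {B : ℕ} {s : Store} {m N : ℕ} {a : ℕ → ℕ} {E : List (List Sym)}
    (hs : Ready m N a E s) (ts : List Tm) (hts : ∀ t ∈ ts, t.Below N) (r : List Sym)
    (hi : s.inp = ts.flatMap encT ++ r) (hr : Stops r) (hm : m ≤ B) (hE : (encL E).length ≤ B)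
    (hB : (ts.flatMap encT).length ≤ B) :
    Claims B terms s (ts.length * (100 * (B + 1) + 1) + 1)
      ((ts.flatMap encT).length + ts.length * (m + 1))
      {x | ∃ y ∈ termsC m a ts, x = (y.2, s.afterTerms m ts r y.1)} := by
  induction ts generalizing s with
  | nil =>
    refine ((claims_loop_done fun l => ?_).mono (by simp) (Nat.zero_le _)).congr ?_
    · simp only [Store.top, Store.get, hi, List.flatMap_nil, List.nil_append]
      rintro (h | h)
      · exact (hr _ h).2.1 rfl
      · exact (hr _ h).2.2 rfl
    · ext x
      simp only [List.flatMap_nil, List.nil_append] at hi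
      simp [termsC, Store.afterTerms, ← hi]
  | cons t ts ih =>
    rw [List.flatMap_cons, List.append_assoc] at hi
    rw [List.flatMap_cons, List.length_append] at hB
    refine ((claims_loop (P := fun y => y ∈ termC m a t)
      (Y := fun y => {x | ∃ z ∈ termsC m a ts, x = (z.2,
        (s.afterTerm m t (ts.flatMap encT ++ r) y.1).afterTerms m ts r z.1)}) (fun l => ?_)
      (claims_term hs t (hts t (by simp)) _ hi (notBit_terms ts hr) hm hE (by omega))
      fun y hy => ih (hs.of_eq rfl rfl rfl rfl rfl rfl) (fun t' ht' => hts t' (by simp [ht']))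
        rfl (by omega)).mono ?_ ?_).congr ?_
    · cases t <;> simp [Store.top, Store.get, hi, encT]
    · simp only [List.length_cons]; rw [add_one_mul]; omega
    · simp only [List.length_cons, List.flatMap_cons, List.length_append]
      rw [add_one_mul]; omega
    · ext x
      simp only [termsC, Set.mem_ofPred_eq]
      constructor
      · rintro ⟨y, hy, _, ⟨z, hz, rfl⟩, rfl⟩
        exact ⟨_, ⟨y, hy, z, hz, rfl⟩, by simp [Store.afterTerms, Store.afterTerm]⟩
      · rintro ⟨_, ⟨y, hy, z, hz, rfl⟩, rfl⟩
        exact ⟨y, hy, _, ⟨z, hz, rfl⟩, by simp [Store.afterTerms, Store.afterTerm]⟩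

/-- The truth value that a goal symbol stands for. -/
def tv : Sym → Bool
  | .val b => b
  | .two _ b => b
  | _ => false

/-- The truth value of the current goal. -/
def truth (h : Stk → Option Sym) : Bool := tv ((h .goal).getD .mark)

/-- The first component of a pair of truth values. -/
def fstTruth : Sym → Bool
  | .two a _ => a
  | _ => false

/-- Reduce the goal for an implication to goals for its parts.  A pair of truth values takes the
place of the goal for the implication, and remains as the goal for the second part. -/
def impP : Prog :=
  .seq (.act fun h => {o | ∃ x y : Bool, (!x || y) = truth h ∧ o = fun k =>
      if k = .inp then .pop else if k = .inq then .push .imp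
      else if k = .goal then .put (.two x y) else .keep})
    (det fun h k => if k = .goal then .push (.val (fstTruth ((h .goal).getD .mark))) else .keep)

/-- Falsity is a goal only with the truth value `false`. -/
def flsP : Prog :=
  .act fun h => {o | truth h = false ∧ o = fun k =>
    if k = .inp ∨ k = .goal then .pop else if k = .inq then .push .fls else .keep}

/-- Compare the contents of two stacks and empty them. -/
def compare : Prog :=
  .loop (nonempty .atm) (det fun h k => if k = .atm ∨ k = .atb then .pop
    else if k = .scr ∧ h .atm ≠ h .atb then .put .mark else .keep)

/-- Check an equation. -/
def eqP : Prog :=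
  .seq (det fun _ k => if k = .inp then .pop else if k = .inq then .push .eq else .keep)
    (.seq term (.seq (mv .atm .alt) (.seq (mv .alt .atb) (.seq term (.seq compare
      (.act fun h => {o | (truth h = true ↔ h .scr = none) ∧ o = fun k =>
        if k = .scr ∨ k = .goal then .pop else .keep}))))))

/-- Claim the truth value of an atom. -/
def predP : Prog :=
  .seq (det fun _ k => if k = .inp then .pop
      else if k = .inq ∨ k = .atm then .push .pred else .keep)
    (.seq (xfer .inp isBit fun k => if k = .inq ∨ k = .atm then some id else none)
      (.seq terms (.seq (det fun h k => if k = .goal then .pop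
          else if k = .atm then .push (.val (truth h)) else .keep)
        (.seq (mv .atm .alt) claim))))

/-- Show for all formulas on the input that they have the truth values given by the goals. -/
def matrix : Prog :=
  .loop (nonempty .goal) (.ite (fun h => h .inp = some .imp) impP
    (.ite (fun h => h .inp = some .fls) flsP (.ite (fun h => h .inp = some .eq) eqP predP)))

/-- The store after the first formula was read. -/
def Store.afterMat (s : Store) (φ : Mat) (r gs : List Sym) : Store :=
  { s with inp := r, inq := (encM φ).reverse ++ s.inq, goal := gs }

theorem impl_impP {s : Store} (φ ψ : Mat) (g : Sym) (r gs : List Sym)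
    (hi : s.inp = encM (.imp φ ψ) ++ r) (hg : s.goal = g :: gs) :
    Impl impP s 5 {s' | ∃ x : Bool × Bool, (!x.1 || x.2) = tv g ∧ s' = { s with
      inp := encM φ ++ (encM ψ ++ r), inq := .imp :: s.inq,
      goal := .val x.1 :: .two x.1 x.2 :: gs }} := by
  refine ((impl_seq_indexed (ι := Bool × Bool) (P := fun x => (!x.1 || x.2) = tv g)
    (g := fun x => { s with
      inp := encM φ ++ (encM ψ ++ r), inq := .imp :: s.inq, goal := .two x.1 x.2 :: gs })
    (R := fun x => {{ s with
      inp := encM φ ++ (encM ψ ++ r), inq := .imp :: s.inq,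
      goal := .val x.1 :: .two x.1 x.2 :: gs }})
    ((impl_act _ _).congr ?_) fun x _ => impl_det ?_)).congr ?_
  · have hst : ∀ x y : Bool, s.ap (fun k =>
        if k = .inp then .pop else if k = .inq then .push .imp
        else if k = .goal then .put (.two x y) else .keep) = { s with
        inp := encM φ ++ (encM ψ ++ r), inq := .imp :: s.inq, goal := .two x y :: gs } := by
      intro x y
      refine Store.get_injective fun k => ?_
      cases k <;> simp only [Store.get_ap] <;> simp [Op.ap, Store.get, hi, hg, encM]
    have ht : truth s.top = tv g := by simp [truth, Store.top, Store.get, hg]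
    ext s'
    simp only [Set.mem_ofPred_eq, ht]
    constructor
    · rintro ⟨_, ⟨x, y, h, rfl⟩, rfl⟩
      exact ⟨(x, y), h, hst x y⟩
    · rintro ⟨⟨x, y⟩, h, rfl⟩
      exact ⟨_, ⟨x, y, h, rfl⟩, (hst x y).symm⟩
  · intro k; cases k <;> simp [Op.ap, Store.get, Store.top, fstTruth]
  · ext s'; simp

theorem impl_flsP {s : Store} (g : Sym) (r gs : List Sym)
    (hi : s.inp = .fls :: r) (hg : s.goal = g :: gs) :
    Impl flsP s 2 {s' | ∃ _ : Unit, tv g = false ∧ s' = s.afterMat .fls r gs} := by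
  refine (impl_act _ _).congr ?_
  have hst : s.ap (fun k =>
      if k = .inp ∨ k = .goal then .pop else if k = .inq then .push .fls else .keep) =
      s.afterMat .fls r gs := by
    refine Store.get_injective fun k => ?_
    cases k <;> simp only [Store.get_ap] <;> simp [Op.ap, Store.get, hi, hg, encM, Store.afterMat]
  have ht : truth s.top = tv g := by simp [truth, Store.top, Store.get, hg]
  ext s'
  simp [ht, hst]

theorem impl_compare {s : Store} (xs ys : List Sym) (h : xs.length = ys.length)
    (hx : s.atm = xs) (hy : s.atb = ys) (hz : s.scr = [] ∨ s.scr = [.mark]) (s' : Store)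
    (h' : ∀ k, s'.get k = if k = .atm ∨ k = .atb then [] else
      if k = .scr ∧ xs ≠ ys then [.mark] else s.get k) :
    Impl compare s (3 * xs.length + 1) {s'} := by
  induction xs generalizing s ys with
  | nil =>
    obtain rfl : ys = [] := by simpa using h.symm
    have : s' = s := by
      refine Store.get_injective fun k => ?_
      rw [h' k]
      cases k <;> simp [Store.get, hx, hy]
    subst this
    exact impl_loop_done (by simp [nonempty, Store.top, Store.get, hx])
  | cons x xs ih =>
    cases ys with
    | nil => simp at h
    | cons y ys =>
      refine impl_loop_det (t2 := 3 * xs.length + 1) ?_ (impl_det (s' := { s with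
        atm := xs, atb := ys, scr := if x = y then s.scr else [.mark] }) ?_)
        (ih ys (by simpa using h) rfl rfl ?_ ?_) (by simp; omega)
      · simp [nonempty, Store.top, Store.get, hx]
      · intro k
        by_cases hxy : x = y <;> cases k <;> simp [Op.ap, Store.get, Store.top, hx, hy, hxy]
        rcases hz with hz | hz <;> simp [hz]
      · by_cases hxy : x = y <;> simp [hxy, hz]
      · intro k
        rw [h']
        by_cases hxy : x = y <;> cases k <;> simp [Store.get, hxy]

theorem claims_eqP {B : ℕ} {s : Store} {m N : ℕ} {a : ℕ → ℕ} {E : List (List Sym)}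
    (hs : Ready m N a E s) (ha : s.atm = []) (hb : s.atb = []) (t u : Tm) (ht : t.Below N)
    (hu : u.Below N) (g : Sym) (r gs : List Sym) (hi : s.inp = encM (.eq t u) ++ r)
    (hr : Stops r) (hg : s.goal = g :: gs) (hm : m ≤ B) (hE : (encL E).length ≤ B)
    (hB : (encM (.eq t u)).length ≤ B) :
    Claims B eqP s (250 * (B + 1)) ((encT t).length + (encT u).length + 2 * (m + 1))
      {x | ∃ es ∈ matC m a (.eq t u) (tv g), x = (es, s.afterMat (.eq t u) r gs)} := by
  simp only [encM, List.length_cons, List.length_append] at hB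
  simp only [encM, List.cons_append, List.append_assoc] at hi
  -- the stores after the two terms
  let s1 : Store := { s with inp := encT t ++ (encT u ++ r), inq := .eq :: s.inq }
  let s2 (j : ℕ) : Store := { s with
    inp := encT u ++ r, inq := (encT t).reverse ++ .eq :: s.inq,
    atb := ((un m j).map .key).reverse ++ [.sep] }
  have hs2 : ∀ j, Ready m N a E (s2 j) := fun j => hs.of_eq rfl rfl rfl rfl rfl rfl
  refine ((claims_seq_det (s1 := s1) (t1 := 2) (fun l => impl_det ?_)
    (claims_seq (Y := fun y : ℕ × List (List Sym) => {x | ∃ z,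
      (z ∈ termC m a u ∧ (tv g = true ↔ y.1 = z.1)) ∧
      x = (z.2, s.afterMat (.eq t u) r gs)})
      (claims_term (s := s1) (hs.of_eq rfl rfl rfl rfl rfl rfl) t ht _ rfl (notBit_encT u r) hm hE
        (by omega))
      fun y hy => ?_) le_rfl).mono (t := 2 + (100 * (B + 1) + (120 * (B + 1)) + 1) + 1)
      (w := ((encT t).length + m + 1) + ((encT u).length + m + 1)) (by omega) (by omega)).congr ?_
  · intro k; cases k <;> simp [Op.ap, Store.get, hi, s1]
  · have hy1 : y.1 ≤ m := by
      cases t with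
      | var i => obtain rfl : y = (a i, []) := hy; exact hs.le i ht
      | con c => exact hy.1
    refine (claims_seq_det (s1 := { s2 y.1 with atb := [], alt := .sep :: (un m y.1).map .key })
      (t1 := 3 * (m + 1) + 1) (fun l => impl_mv (m + 1) ?_ ?_)
      (claims_seq_det (s1 := s2 y.1) (t1 := 3 * (m + 1) + 1) (fun l => impl_mv (m + 1) ?_ ?_)
        (claims_seq (Y := fun z : ℕ × List (List Sym) =>
          {x | ∃ _ : Unit, (tv g = true ↔ y.1 = z.1) ∧
          x = ([], s.afterMat (.eq t u) r gs)})
          (claims_term (hs2 y.1) u hu r rfl (fun y hy => (hr y hy).1) hm hE (by omega))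
          (w2 := 0) (t2 := 3 * (m + 1) + 4) fun z hz => ?_)
        (t := 3 * (m + 1) + 1 + (100 * (B + 1) + (3 * (m + 1) + 4) + 1) + 1) le_rfl)
      (by omega)).congr ?_
    · simp [Store.get, Store.afterTerm, s1, ha, length_un hy1]
    · intro k; cases k <;> simp [Store.get, Store.afterTerm, s1, s2, ha, hb, hs.alt]
    · simp [Store.get, length_un hy1]
    · intro k; cases k <;> simp [Store.get, s2, ha, hs.alt]
    · have hz1 : z.1 ≤ m := by
        cases u with
        | var i => obtain rfl : z = (a i, []) := hz; exact hs.le i hu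
        | con c => exact hz.1
      have hinj : ((un m z.1).map Sym.key).reverse ++ [.sep] =
          ((un m y.1).map Sym.key).reverse ++ [.sep] ↔ y.1 = z.1 := by
        constructor
        · intro h
          have h1 : (un m z.1).map Sym.key = (un m y.1).map Sym.key := by
            simpa using List.append_cancel_right h
          exact (un_injective (List.map_injective_iff.2 (fun x y h => by simpa using h) h1)).symm
        · intro h; rw [h]
      refine claims_of_impl fun l => ?_
      by_cases hyz : y.1 = z.1
      · refine (impl_seq_det (s1 := { s.afterMat (.eq t u) r (g :: gs) with log := l })
          (impl_compare _ (((un m y.1).map .key).reverse ++ [.sep]) ?_ (by rfl) (by rfl)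
            (.inl (by exact hs.scr)) _ ?_)
          ((impl_act _ _).congr ?_) (t := 3 * (m + 1) + 1 + 2 + 1) ?_)
        · simp [Store.afterTerm, s2, length_un, hy1, hz1, ha]
        · intro k
          cases k <;> simp [Store.get, Store.afterTerm, Store.afterMat, s2, ha, hb, hyz, encM, hg]
        · ext s'
          simp only [Set.mem_ofPred_eq, hyz, iff_true]
          have ht : truth (Store.top { s.afterMat (.eq t u) r (g :: gs) with log := l }) = tv g :=
            by
            simp [truth, Store.top, Store.get, Store.afterMat]
          have hsc : (Store.top { s.afterMat (.eq t u) r (g :: gs) with log := l }) .scr = none :=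
            by
            simp [Store.top, Store.get, Store.afterMat, hs.scr]
          have hst : (Store.ap (fun k => if k = .scr ∨ k = .goal then .pop else .keep)
              { s.afterMat (.eq t u) r (g :: gs) with log := l }) =
              { s.afterMat (.eq t u) r gs with log := l } := by
            refine Store.get_injective fun k => ?_
            cases k <;> simp only [Store.get_ap] <;>
              simp [Op.ap, Store.get, Store.afterMat, hs.scr]
          rw [ht, hsc]
          simp [hst]
        · simp [Store.afterTerm, s2, length_un, hz1, ha]
      · refine (impl_seq_det (s1 := { s.afterMat (.eq t u) r (g :: gs) with
            log := l, scr := [.mark] })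
          (impl_compare _ (((un m y.1).map .key).reverse ++ [.sep]) ?_ (by rfl) (by rfl)
            (.inl (by exact hs.scr)) _ ?_)
          ((impl_act _ _).congr ?_) (t := 3 * (m + 1) + 1 + 2 + 1) ?_)
        · simp [Store.afterTerm, s2, length_un, hy1, hz1, ha]
        · have hyz' : ((un m z.1).map Sym.key).reverse ++ .sep :: s.atm ≠
              ((un m y.1).map Sym.key).reverse ++ [.sep] := by
            rw [ha]; exact fun h => hyz (hinj.1 h)
          intro k
          cases k <;> simp [Store.get, Store.afterTerm, Store.afterMat, s2, ha, hb, encM, hg]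
          rw [ha] at hyz'
          exact fun h => (by simpa using hyz' : ¬ _) h |>.elim
        · ext s'
          simp only [Set.mem_ofPred_eq, hyz, iff_false]
          have ht : truth (Store.top { s.afterMat (.eq t u) r (g :: gs) with
              log := l, scr := [.mark] }) = tv g := by
            simp [truth, Store.top, Store.get, Store.afterMat]
          have hsc : (Store.top { s.afterMat (.eq t u) r (g :: gs) with
              log := l, scr := [.mark] }) .scr = some .mark := by
            simp [Store.top, Store.get]
          have hst : (Store.ap (fun k => if k = .scr ∨ k = .goal then .pop else .keep)
              { s.afterMat (.eq t u) r (g :: gs) with log := l, scr := [.mark] }) =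
              { s.afterMat (.eq t u) r gs with log := l } := by
            refine Store.get_injective fun k => ?_
            cases k <;> simp only [Store.get_ap] <;>
              simp [Op.ap, Store.get, Store.afterMat, hs.scr]
          rw [ht, hsc]
          simp [hst]
        · simp [Store.afterTerm, s2, length_un, hz1, ha]
    · ext x
      simp [and_assoc]
  · ext x
    simp only [matC, Set.mem_ofPred_eq]
    constructor
    · rintro ⟨y, hy, _, ⟨z, ⟨hz, h⟩, rfl⟩, rfl⟩
      exact ⟨_, ⟨y, hy, z, hz, h, rfl⟩, rfl⟩
    · rintro ⟨_, ⟨y, hy, z, hz, h, rfl⟩, rfl⟩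
      exact ⟨y, hy, _, ⟨z, ⟨hz, h⟩, rfl⟩, rfl⟩

theorem length_le_of_mem_termsC {m : ℕ} {a : ℕ → ℕ} {ts : List Tm}
    {x : List ℕ × List (List Sym)} {N : ℕ} (ha : ∀ i < N, a i ≤ m) (hts : ∀ t ∈ ts, t.Below N)
    (hx : x ∈ termsC m a ts) : x.1.length = ts.length ∧ ∀ j ∈ x.1, j ≤ m := by
  induction ts generalizing x with
  | nil => obtain rfl : x = ([], []) := hx; simp
  | cons t ts ih =>
    obtain ⟨y, hy, z, hz, rfl⟩ := hx
    have := ih (fun t' ht' => hts t' (by simp [ht'])) hz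
    have hy1 : y.1 ≤ m := by
      cases t with
      | var i => obtain rfl : y = (a i, []) := hy; exact ha i (hts (.var i) (by simp))
      | con c => exact hy.1
    simp [this, hy1]
    exact this.2

theorem length_atom {m : ℕ} {js : List ℕ} (h : ∀ j ∈ js, j ≤ m) :
    (js.flatMap fun j => Sym.sep :: (un m j).map Sym.key).length = js.length * (m + 1) := by
  induction js with
  | nil => simp
  | cons j js ih =>
    have := ih fun j' hj' => h j' (by simp [hj'])
    rw [List.flatMap_cons, List.length_append, this, List.length_cons, List.length_map,
      length_un (h j (by simp)), List.length_cons, add_one_mul]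
    omega

theorem fin_notMem_predE {m P : ℕ} {js : List ℕ} {g : Bool} : Sym.fin ∉ predE m P js g := by
  simp [predE, dg]

theorem claims_predP {B : ℕ} {s : Store} {m N : ℕ} {a : ℕ → ℕ} {E : List (List Sym)}
    (hs : Ready m N a E s) (ha : s.atm = []) (P : ℕ) (ts : List Tm) (hts : ∀ t ∈ ts, t.Below N)
    (g : Sym) (r gs : List Sym) (hi : s.inp = encM (.rel P ts) ++ r)
    (hr : Stops r) (hg : s.goal = g :: gs) (hm : m ≤ B) (hE : (encL E).length ≤ B)
    (hB : (encM (.rel P ts)).length ≤ B) :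
    Claims B predP s ((encM (.rel P ts)).length * (250 * (B + 1)))
      ((encM (.rel P ts)).length * (2 * m + 4))
      {x | ∃ es ∈ matC m a (.rel P ts) (tv g), x = (es, s.afterMat (.rel P ts) r gs)} := by
  have hl := length_le_flatMap_encT ts
  simp only [encM, List.length_cons, List.length_append] at hB ⊢
  simp only [encM, List.cons_append, List.append_assoc] at hi
  set k := (ts.flatMap encT).length with hk
  let s1 : Store := { s with
    inp := ts.flatMap encT ++ r, inq := (.pred :: dg P).reverse ++ s.inq,
    atm := (.pred :: dg P).reverse }
  let s2 (y : List ℕ × List (List Sym)) : Store := { s.afterMat (.rel P ts) r gs with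
    alt := predE m P y.1 (tv g) }
  refine ((claims_seq_det (s1 := { s with
      inp := dg P ++ (ts.flatMap encT ++ r), inq := .pred :: s.inq, atm := [.pred] })
    (fun l => impl_det ?_) (claims_seq_det (s1 := s1) (t1 := 3 * (dg P).length + 1)
    (fun l => impl_xfer (dg P) (ts.flatMap encT ++ r) ?_ (fun x hx => isBit_of_mem_dg hx)
      (notBit_terms ts hr) ?_)
    (claims_seq (Y := fun y : List ℕ × List (List Sym) =>
        {([predE m P y.1 (tv g)], s.afterMat (.rel P ts) r gs)})
      (claims_terms (s := s1) (hs.of_eq rfl rfl rfl rfl rfl rfl) ts hts r rfl hr hm hE (by omega))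
      (w2 := (dg P).length + ts.length * (m + 1) + 3)
      (t2 := 2 + (3 * ((dg P).length + ts.length * (m + 1) + 2) + 1 + (50 * B + 50) + 1) + 1)
      fun y hy => claims_seq_det (s1 := { s.afterMat (.rel P ts) r gs with
          atm := (predE m P y.1 (tv g)).reverse })
        (fun l => impl_det ?_) (claims_seq_det (s1 := s2 y)
          (fun l => impl_mv ((dg P).length + ts.length * (m + 1) + 2) ?_ ?_)
          (((claims_claim (by exact hs.cur) (by exact hs.scr)
            (by exact fin_notMem_predE)).mono le_rfl ?_).congr ?_) le_rfl) le_rfl)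
      le_rfl) le_rfl).mono ?_ ?_).congr ?_
  · intro k; cases k <;> simp [Op.ap, Store.get, hi, ha]
  · simp [Store.get]
  · intro k; cases k <;> simp [Store.get, s1]
  · intro k; cases k <;> simp [Store.get, Store.top, Op.ap, Store.afterMat, Store.afterTerms, s1,
      predE, encM, hg, truth]
  · have := length_le_of_mem_termsC hs.le hts hy
    simp only [Store.get, List.length_reverse, predE, List.length_cons, List.length_append,
      length_atom this.2, this.1, List.length_nil]
  · intro k; cases k <;> simp [Store.get, s2, hs.alt, Store.afterMat, ha]
  · have := length_le_of_mem_termsC hs.le hts hy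
    simp only [s2, predE, List.length_cons, List.length_append,
      length_atom this.2, this.1, List.length_nil]
    omega
  · simp [s2, Store.afterMat, hs.alt]
  · have h1 : ts.length * (100 * (B + 1) + 1) ≤ k * (100 * (B + 1) + 1) :=
      Nat.mul_le_mul_right _ hl
    have h2 : ts.length * (m + 1) ≤ k * (B + 1) := Nat.mul_le_mul hl (by omega)
    nlinarith
  · have h2 : ts.length * (m + 1) ≤ k * (m + 1) := Nat.mul_le_mul_right _ hl
    nlinarith
  · ext x
    simp only [matC, Set.mem_ofPred_eq]
    constructor
    · rintro ⟨y, hy, _, rfl, rfl⟩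
      exact ⟨_, ⟨y, hy, rfl⟩, rfl⟩
    · rintro ⟨_, ⟨y, hy, rfl⟩, rfl⟩
      exact ⟨y, hy, _, rfl, rfl⟩

/-- The variables of a formula are below `N`. -/
def Mat.Below (N : ℕ) : Mat → Prop
  | .fls => True
  | .eq t u => t.Below N ∧ u.Below N
  | .rel _ ts => ∀ t ∈ ts, t.Below N
  | .imp φ ψ => φ.Below N ∧ ψ.Below N

/-- The lists of claims for a list of formulas with goals. -/
def listC (m : ℕ) (a : ℕ → ℕ) : List (Mat × Sym) → Set (List (List Sym))
  | [] => {[]}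
  | f :: fs => {es | ∃ e1 ∈ matC m a f.1 (tv f.2), ∃ e2 ∈ listC m a fs, es = e2 ++ e1}

/-- The letters of a list of formulas. -/
def encF (fs : List (Mat × Sym)) : List Sym := fs.flatMap fun f => encM f.1

theorem stops_encF (fs : List (Mat × Sym)) {r : List Sym} (hr : Stops r) :
    Stops (encF fs ++ r) := by
  cases fs with
  | nil => exact hr
  | cons f fs => rw [encF, List.flatMap_cons, List.append_assoc]; exact stops_encM _ _

/-- The store after a list of formulas was read. -/
def Store.afterList (s : Store) (fs : List (Mat × Sym)) (r : List Sym) : Store :=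
  { s with inp := r, inq := (encF fs).reverse ++ s.inq, goal := [] }

/-- The runs of `matrix` correspond to the lists of claims for the formulas on the input. -/
theorem claims_matrix {B : ℕ} {m N : ℕ} {a : ℕ → ℕ} {E : List (List Sym)} {r : List Sym}
    (hr : Stops r) (hm : m ≤ B) (hE : (encL E).length ≤ B) (n : ℕ) :
    ∀ (s : Store) (fs : List (Mat × Sym)), Ready m N a E s → s.atm = [] → s.atb = [] →
      (∀ f ∈ fs, f.1.Below N) → s.inp = encF fs ++ r → s.goal = fs.map Prod.snd →
      (encF fs).length = n → n ≤ B →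
      Claims B matrix s (n * (300 * (B + 1)) + 1) (n * (2 * m + 6))
        {x | ∃ es ∈ listC m a fs, x = (es, s.afterList fs r)} := by
  induction n using Nat.strong_induction_on with
  | _ n ih =>
    intro s fs hs ha hb hN hi hg hn hB
    cases fs with
    | nil =>
      refine ((claims_loop_done fun l => ?_).mono (by omega) (Nat.zero_le _)).congr ?_
      · simp [nonempty, Store.top, Store.get, hg]
      · ext x
        have hi : s.inp = r := hi
        have hg : s.goal = [] := hg
        have h : s.afterList [] r = s := by
          refine Store.get_injective fun k => ?_
          cases k <;> simp [Store.get, Store.afterList, encF, hi, hg]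
        simp [listC, h]
    | cons f fs =>
      obtain ⟨φ, g⟩ := f
      have hc : ∀ l, nonempty .goal { s with log := l }.top := fun l => by
        simp [nonempty, Store.top, Store.get, hg]
      have hφ : φ.Below N := hN _ (List.mem_cons_self ..)
      have hN' : ∀ f ∈ fs, f.1.Below N := fun f hf => hN f (List.mem_cons_of_mem _ hf)
      rw [encF, List.flatMap_cons, List.length_append] at hn
      rw [encF, List.flatMap_cons, List.append_assoc] at hi
      change s.inp = encM φ ++ (encF fs ++ r) at hi
      change (encM φ).length + (encF fs).length = n at hn
      rw [List.map_cons] at hg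
      -- a formula that is not an implication is dealt with in a single round
      have atom : 1 ≤ (encM φ).length →
          (Claims B (.ite (fun h => h .inp = some .imp) impP
            (.ite (fun h => h .inp = some .fls) flsP (.ite (fun h => h .inp = some .eq) eqP predP)))
              s
            ((encM φ).length * (300 * (B + 1)) - 2) ((encM φ).length * (2 * m + 6))
            {x | ∃ es ∈ matC m a φ (tv g), x = (es, s.afterMat φ (encF fs ++ r) (fs.map Prod.snd))})
              →
          Claims B matrix s (n * (300 * (B + 1)) + 1) (n * (2 * m + 6))
            {x | ∃ es ∈ listC m a ((φ, g) :: fs), x = (es, s.afterList ((φ, g) :: fs) r)} := by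
        intro h1 hp
        refine ((claims_loop hc hp fun es hes =>
          ih (encF fs).length (by omega) (s.afterMat φ (encF fs ++ r) (fs.map Prod.snd)) fs
            (hs.of_eq rfl rfl rfl rfl rfl rfl) ha hb hN' rfl rfl rfl (by omega)).mono ?_ ?_).congr
              ?_
        · have : 300 ≤ (encM φ).length * (300 * (B + 1)) :=
            (by omega : 300 ≤ 1 * (300 * (B + 1))).trans (Nat.mul_le_mul_right _ h1)
          rw [← hn, add_mul]
          omega
        · rw [← hn, add_mul]
        · ext x
          constructor
          · rintro ⟨e1, h1, _, ⟨e2, h2, rfl⟩, rfl⟩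
            exact ⟨_, ⟨e1, h1, e2, h2, rfl⟩, by simp [Store.afterList, Store.afterMat, encF]⟩
          · rintro ⟨_, ⟨e1, h1, e2, h2, rfl⟩, rfl⟩
            exact ⟨e1, h1, _, ⟨e2, h2, rfl⟩, by simp [Store.afterList, Store.afterMat, encF]⟩
      cases φ with
      | fls =>
        refine atom (by simp [encM]) (((claims_ite_neg (fun l => ?_) (claims_ite_pos (fun l => ?_)
          (claims_of_impl (ι := Unit) (P := fun _ => tv g = false)
            (g := fun _ => s.afterMat .fls (encF fs ++ r) (fs.map Prod.snd)) fun l =>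
              impl_flsP (s := { s with log := l }) g _ _ hi hg))).mono ?_ (Nat.zero_le _)).congr ?_)
        · simp [Store.top, Store.get, hi, encM]
        · simp [Store.top, Store.get, hi, encM]
        · simp [encM]; omega
        · ext x
          simp [matC, and_assoc]
      | eq t u =>
        refine atom (by simp [encM]) ((claims_ite_neg (fun l => ?_) (claims_ite_neg (fun l => ?_)
          (claims_ite_pos (fun l => ?_) (claims_eqP hs ha hb t u hφ.1 hφ.2 g _ _ hi
            (stops_encF fs hr) hg hm hE (by omega))))).mono ?_ ?_)
        · simp [Store.top, Store.get, hi, encM]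
        · simp [Store.top, Store.get, hi, encM]
        · simp [Store.top, Store.get, hi, encM]
        · have h1 : 1 ≤ (encM (.eq t u)).length := by simp [encM]
          exact le_trans (b := 1 * (300 * (B + 1)) - 2) (by omega)
            (Nat.sub_le_sub_right (Nat.mul_le_mul_right _ h1) 2)
        · simp only [encM, List.length_cons, List.length_append]
          nlinarith
      | rel P ts =>
        refine atom (by simp [encM]) ((claims_ite_neg (fun l => ?_) (claims_ite_neg (fun l => ?_)
          (claims_ite_neg (fun l => ?_) (claims_predP hs ha P ts hφ g _ _ hi
            (stops_encF fs hr) hg hm hE (by omega))))).mono ?_ ?_)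
        · simp [Store.top, Store.get, hi, encM]
        · simp [Store.top, Store.get, hi, encM]
        · simp [Store.top, Store.get, hi, encM]
        · have : 1 ≤ (encM (.rel P ts)).length := by simp [encM]
          have := Nat.mul_le_mul_right (50 * (B + 1)) this
          have e : (encM (.rel P ts)).length * (300 * (B + 1)) =
            (encM (.rel P ts)).length * (250 * (B + 1)) + (encM (.rel P ts)).length * (50 * (B + 1))
              := by
            ring
          omega
        · exact Nat.mul_le_mul_left _ (by omega)
      | imp φ ψ =>
        have hl : (encM (.imp φ ψ)).length = (encM φ).length + (encM ψ).length + 1 := by simp [encM]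
        refine ((claims_loop hc (claims_ite_pos (fun l => ?_) (claims_of_impl
          (ι := Bool × Bool) (P := fun x => (!x.1 || x.2) = tv g) (g := fun x => { s with
            inp := encM φ ++ (encM ψ ++ (encF fs ++ r)), inq := .imp :: s.inq,
            goal := .val x.1 :: .two x.1 x.2 :: fs.map Prod.snd }) fun l =>
          impl_impP (s := { s with log := l }) φ ψ g _ _ hi hg)) fun x _ =>
          ih (n - 1) (by omega) _ ((φ, .val x.1) :: (ψ, .two x.1 x.2) :: fs) ?_ ?_ ?_ ?_ ?_ ?_ ?_
            (by omega)).mono ?_ ?_).congr ?_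
        · simp [Store.top, Store.get, hi, encM]
        · exact hs.of_eq rfl rfl rfl rfl rfl rfl
        · exact ha
        · exact hb
        · simpa using ⟨hφ.1, hφ.2, fun a b h => hN' (a, b) h⟩
        · simp [encF]
        · rfl
        · simp only [encF, List.flatMap_cons, List.length_append] at hn ⊢
          omega
        · obtain ⟨k, rfl⟩ : ∃ k, n = k + 1 := ⟨n - 1, by omega⟩
          rw [add_one_mul, Nat.add_sub_cancel]
          omega
        · rw [Nat.zero_add]
          exact Nat.mul_le_mul_right _ (by omega)
        · ext x
          constructor
          · rintro ⟨y, hy, _, ⟨_, ⟨e1, h1, _, ⟨e2, h2, e3, h3, rfl⟩, rfl⟩, rfl⟩, rfl⟩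
            exact ⟨_, ⟨_, ⟨y.1, y.2, hy, e1, h1, e2, h2, rfl⟩, e3, h3, rfl⟩,
              by simp [Store.afterList, encF, encM]⟩
          · rintro ⟨_, ⟨_, ⟨y1, y2, hy, e1, h1, e2, h2, rfl⟩, e3, h3, rfl⟩, rfl⟩
            exact ⟨(y1, y2), hy, _, ⟨_, ⟨e1, h1, _, ⟨e2, h2, e3, h3, rfl⟩, rfl⟩, rfl⟩,
              by simp [Store.afterList, encF, encM]⟩

/-! ### The quantifier prefix -/

/-- The letter for a quantifier; `true` stands for the universal quantifier. -/
def qL (q : Bool) : Sym := if q then .all else .ex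

/-- The quantifier prefix `qs` for the variables `k, k + 1, …`. -/
def encQ : ℕ → List Bool → List Sym
  | _, [] => []
  | k, q :: qs => qL q :: .var :: (dg k ++ encQ (k + 1) qs)

/-- The log entry for the values of the quantified variables: the values of universal variables
are keys. -/
def tran (m : ℕ) : List Bool → List ℕ → List Sym
  | q :: qs, j :: js => (un m j).map (if q then .key else .val) ++ tran m qs js
  | _, _ => []

/-- The entries for the values of the variables `k, k + 1, …`. -/
def envE (m : ℕ) : ℕ → List ℕ → List (List Sym)
  | _, [] => []
  | k, j :: js => varE m k j :: envE m (k + 1) js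

/-- The values of all variables that are possible if the universal variables have the values
`vs`. -/
def vals (m : ℕ) : List Bool → List ℕ → Set (List ℕ)
  | [], _ => {[]}
  | true :: qs, vs => {js | ∃ js' ∈ vals m qs vs.tail, js = vs.headD 0 :: js'}
  | false :: qs, vs => {js | ∃ j ≤ m, ∃ js' ∈ vals m qs vs, js = j :: js'}

/-- The stack `l` contains the digits of the numbers `vs`; digits `false` may be missing. -/
def Chunks (m : ℕ) : List Sym → List ℕ → Prop
  | l, [] => l = []
  | l, v :: vs => ∃ n l', v + n ≤ m ∧
      l = (List.replicate v true ++ List.replicate n false).map .key ++ .sep :: l' ∧ Chunks m l' vs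

/-- The digits of the numbers `vs`. -/
def encCnt (m : ℕ) (vs : List ℕ) : List Sym := vs.flatMap fun v => (un m v).map .key ++ [.sep]

/-- The next value of a universal variable, read from the stack `cnt`. -/
def value : Prog :=
  .seq (.loop (nonempty .rul) (det fun h k =>
    if k = .rul then .pop else if k = .ruq then .push .mark
    else if k = .cnt then if h .cnt = some .sep then .keep else .pop
    else if k = .tr ∨ k = .cnq then .push (.key (h .cnt = some (.key true)))
    else if k = .cur then .push (.val (h .cnt = some (.key true))) else .keep))
  (.seq (mv .ruq .rul)
    (det fun _ k => if k = .cnt then .pop else if k = .cnq then .push .sep else .keep))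

theorem impl_value_loop (bs : List Bool) (n : ℕ) (l : List Sym) (h : bs.length ≤ n) :
    ∀ s : Store, s.rul = .replicate n .mark → s.cnt = bs.map .key ++ .sep :: l →
    Impl (.loop (nonempty .rul) (det fun h k =>
      if k = .rul then .pop else if k = .ruq then .push .mark
      else if k = .cnt then if h .cnt = some .sep then .keep else .pop
      else if k = .tr ∨ k = .cnq then .push (.key (h .cnt = some (.key true)))
      else if k = .cur then .push (.val (h .cnt = some (.key true))) else .keep)) s (3 * n + 1)
      {{ s with
        rul := [], ruq := .replicate n .mark ++ s.ruq, cnt := .sep :: l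
        tr := ((bs ++ .replicate (n - bs.length) false).map .key).reverse ++ s.tr
        cnq := ((bs ++ .replicate (n - bs.length) false).map .key).reverse ++ s.cnq
        cur := ((bs ++ .replicate (n - bs.length) false).map .val).reverse ++ s.cur }} := by
  induction n generalizing bs with
  | zero =>
    intro s h1 h2
    obtain rfl : bs = [] := by simpa using h
    refine (impl_loop_done (by simp [nonempty, Store.top, Store.get, h1])).congr ?_
    congr 1
    refine Store.get_injective fun k => ?_
    cases k <;> simp [Store.get, h1, h2]
  | succ n ih =>
    intro s h1 h2
    refine impl_loop_det (t2 := 3 * n + 1) ?_ (impl_det_ap _ _)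
      ((ih bs.tail (by simp; omega) _ ?_ ?_).congr ?_) (by omega)
    · simp [nonempty, Store.top, Store.get, h1, List.replicate_succ]
    · simp [Store.ap, Store.of, Op.ap, Store.get, h1, List.replicate_succ]
    · cases bs <;> simp [Store.ap, Store.of, Op.ap, Store.get, Store.top, h2]
    · have e : ∀ (x : Sym) (n : ℕ) (l : List Sym),
          List.replicate n x ++ x :: l = x :: (List.replicate n x ++ l) := fun x n l => by
        rw [← List.singleton_append, ← List.append_assoc, ← List.replicate_succ',
          List.replicate_succ, List.cons_append]
      congr 1
      refine Store.get_injective fun k => ?_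
      cases bs with
      | nil => cases k <;> simp [Store.ap, Store.of, Op.ap, Store.get, Store.top, h2,
          List.replicate_succ, e]
      | cons b bs => cases k <;> simp [Store.ap, Store.of, Op.ap, Store.get, Store.top, h2,
          List.replicate_succ, e]

theorem impl_value {s : Store} {m v n : ℕ} {l : List Sym} (h : v + n ≤ m)
    (hr : s.rul = .replicate m .mark) (hq : s.ruq = [])
    (hc : s.cnt = (List.replicate v true ++ List.replicate n false).map .key ++ .sep :: l) :
    Impl value s (6 * m + 6) {{ s with
        cnt := l
        tr := ((un m v).map .key).reverse ++ s.tr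
        cnq := .sep :: (((un m v).map .key).reverse ++ s.cnq)
        cur := ((un m v).map .val).reverse ++ s.cur }} := by
  have hl := impl_value_loop (.replicate v true ++ .replicate n false) m l (by simpa using h) s hr
    hc
  have hu : (List.replicate v true ++ List.replicate n false) ++ .replicate
      (m - (List.replicate v true ++ List.replicate n false).length) false = un m v := by
    rw [un, List.append_assoc, List.replicate_append_replicate]
    congr 2
    simp; omega
  rw [hu] at hl
  refine impl_seq_det hl (impl_seq_det (s1 := { s with
        cnt := .sep :: l
        tr := ((un m v).map .key).reverse ++ s.tr
        cnq := ((un m v).map .key).reverse ++ s.cnq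
        cur := ((un m v).map .val).reverse ++ s.cur }) (impl_mv m (by simp [Store.get, hq]) ?_)
    (impl_det ?_) le_rfl) (by omega)
  · intro k; cases k <;> simp [Store.get, hr, hq]
  · intro k; cases k <;> simp [Store.get, Op.ap]

/-- Read a quantifier; the program `p` finds the value of the variable. -/
def quant (p : Prog) : Prog :=
  .seq (det fun h k => if k = .inp then .pop
      else if k = .inq then .push ((h .inp).getD .mark) else .keep)
    (.seq (det fun _ k => if k = .inp then .pop
        else if k = .inq ∨ k = .cur then .push .var else .keep)
      (.seq (xfer .inp isBit fun k => if k = .inq ∨ k = .cur then some id else none)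
        (.seq p (.seq (mv .cur .alt) (app .env)))))

/-- Read the quantifier prefix and find the values of all variables. -/
def prefixP : Prog :=
  .loop (fun h => h .inp = some .all ∨ h .inp = some .ex)
    (.ite (fun h => h .inp = some .all) (quant value) (quant (guess .tr .val)))

/-- The store after a quantifier was read. -/
def Store.afterQ (s : Store) (m k : ℕ) (q : Bool) (r cnt cnq : List Sym) (j : ℕ) : Store :=
  { s with inp := r, inq := (qL q :: .var :: dg k).reverse ++ s.inq, cnt := cnt, cnq := cnq,
           tr := ((un m j).map (if q then .key else .val)).reverse ++ s.tr,
           env := varE m k j ++ .fin :: s.env }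

theorem impl_quant {s : Store} {p : Prog} {P : ℕ → Prop} {m k t : ℕ} {q : Bool}
    {r cnt cnq : List Sym} (hi : s.inp = qL q :: .var :: (dg k ++ r))
    (hr : ∀ x ∈ r.head?, ¬ isBit x) (hc : s.cur = []) (ha : s.alt = []) (hP : ∀ j, P j → j ≤ m)
    (hp : Impl p { s with
        inp := r, inq := (qL q :: .var :: dg k).reverse ++ s.inq,
        cur := (.var :: dg k).reverse } t {s' | ∃ j, P j ∧ s' = { s with
          inp := r, inq := (qL q :: .var :: dg k).reverse ++ s.inq,
          cur := (varE m k j).reverse, cnt := cnt, cnq := cnq,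
          tr := ((un m j).map (if q then .key else .val)).reverse ++ s.tr }}) :
    Impl (quant p) s (t + 12 * (dg k).length + 9 * m + 29)
      {s' | ∃ j, P j ∧ s' = s.afterQ m k q r cnt cnq j} := by
  refine impl_seq_det (s1 := { s with
      inp := .var :: (dg k ++ r), inq := qL q :: s.inq }) (impl_det ?_)
    (impl_seq_det (s1 := { s with
        inp := dg k ++ r, inq := .var :: qL q :: s.inq, cur := [.var] }) (impl_det ?_)
      (impl_seq_det (impl_xfer (dg k) r (by simp [Store.get]) (fun x hx => isBit_of_mem_dg hx)
        hr ?_) ((impl_seq_indexed (R := fun j => {s.afterQ m k q r cnt cnq j}) hp fun j hj =>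
          impl_seq_det (s1 := { s with
            inp := r, inq := (qL q :: .var :: dg k).reverse ++ s.inq,
            alt := varE m k j, cnt := cnt, cnq := cnq,
            tr := ((un m j).map (if q then .key else .val)).reverse ++ s.tr })
          (impl_mv ((dg k).length + m + 1) ?_ ?_) (impl_app (.inl rfl) (by exact hc) ?_)
          (t := 9 * ((dg k).length + m + 1) + 8) ?_).congr ?_) le_rfl) le_rfl) ?_
  · intro k; cases k <;> simp [Store.get, Op.ap, hi, Store.top]
  · intro k; cases k <;> simp [Store.get, Op.ap, hc]
  · intro k'; cases k' <;> simp [Store.get]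
  · simp [Store.get, varE, length_un (hP j hj)]; omega
  · intro k'; cases k' <;> simp [Store.get, hc, ha]
  · intro k'; cases k' <;> simp [Store.get, Store.afterQ, ha]
  · simp [varE, length_un (hP j hj)]; omega
  · ext s'; simp
  · omega

/-- The store after the quantifier prefix was read. -/
def Store.afterQs (s : Store) (m k : ℕ) (qs : List Bool) (r : List Sym) (vs js : List ℕ) : Store :=
  { s with inp := r, inq := (encQ k qs).reverse ++ s.inq,
           cnt := [], cnq := (encCnt m vs).reverse ++ s.cnq,
           tr := (tran m qs js).reverse ++ s.tr,
           env := encL (envE m k js).reverse ++ s.env }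

theorem impl_prefixP {m B : ℕ} {r : List Sym} (hr : Stops r)
    (hr' : r.head? ≠ some .all ∧ r.head? ≠ some .ex) (hm : m ≤ B) :
    ∀ (qs : List Bool) (k : ℕ) (vs : List ℕ) (s : Store), s.rul = .replicate m .mark → s.ruq = [] →
      s.cur = [] → s.alt = [] → s.inp = encQ k qs ++ r → Chunks m s.cnt vs →
      vs.length = qs.count true → (encQ k qs).length ≤ B →
      Impl prefixP s (qs.length * (40 * (B + 1)) + 1)
        {s' | ∃ js, js ∈ vals m qs vs ∧ s' = s.afterQs m k qs r vs js} := by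
  intro qs
  induction qs with
  | nil =>
    intro k vs s h1 h2 h3 h4 hi hc hl hB
    obtain rfl : vs = [] := by simpa using hl
    have hc : s.cnt = [] := hc
    have hi : s.inp = r := hi
    refine ((impl_loop_done ?_).congr ?_).mono (by omega)
    · simpa [Store.top, Store.get, hi] using hr'
    · have : s.afterQs m k [] r [] [] = s := by
        refine Store.get_injective fun k => ?_
        cases k <;> simp [Store.get, Store.afterQs, encQ, tran, envE, encCnt, hi, hc]
      ext s'
      simp [vals, this]
  | cons q qs ih =>
    intro k vs s h1 h2 h3 h4 hi hc hl hB
    have hi' : s.inp = qL q :: .var :: (dg k ++ (encQ (k + 1) qs ++ r)) := by simp [hi, encQ]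
    have hr2 : ∀ x ∈ (encQ (k + 1) qs ++ r).head?, ¬ isBit x := by
      cases qs with
      | nil => exact fun x hx => (hr x hx).1
      | cons q qs => cases q <;> simp [encQ, qL, isBit]
    simp only [encQ, List.length_cons, List.length_append] at hB
    cases q with
    | true =>
      obtain _ | ⟨v, vs⟩ := vs
      · simp at hl
      obtain ⟨n, l, hv, hl1, hl2⟩ := hc
      refine ((impl_loop_indexed (P := fun j => j = v)
        (g := s.afterQ m k true (encQ (k + 1) qs ++ r) l
          (((un m v).map Sym.key ++ [Sym.sep]).reverse ++ s.cnq))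
        (R := fun j => {s' | ∃ js, js ∈ vals m qs vs ∧
          s' = s.afterQs m k (true :: qs) r (v :: vs) (j :: js)}) ?_ (impl_ite_pos ?_
        (impl_quant hi' hr2 h3 h4 (by omega) ((impl_value hv (by exact h1) (by exact h2)
          (by exact hl1)).congr ?_))) ?_).congr
        ?_).mono (t := 6 * m + 6 + 12 * (dg k).length + 9 * m + 29 + 1 +
          (qs.length * (40 * (B + 1)) + 1) + 1) ?_
      · simp [Store.top, Store.get, hi', qL]
      · simp [Store.top, Store.get, hi', qL]
      · ext s'; simp [varE]
      · rintro j rfl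
        refine (ih (k + 1) vs _ (by exact h1) (by exact h2) (by exact h3) (by exact h4) (by rfl)
          (by exact hl2) (by simpa using hl) (by omega)).congr ?_
        ext s'
        simp [Store.afterQs, Store.afterQ, encQ, tran, envE, encCnt, qL]
      · ext s'
        simp only [Set.mem_ofPred_eq, exists_eq_left, vals, List.headD_cons, List.tail_cons]
        constructor
        · rintro ⟨js, h, rfl⟩
          exact ⟨_, ⟨js, h, rfl⟩, rfl⟩
        · rintro ⟨_, ⟨js, h, rfl⟩, rfl⟩
          exact ⟨js, h, rfl⟩
      · rw [List.length_cons, add_one_mul]; omega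
    | false =>
      refine ((impl_loop_indexed (P := fun j => j ≤ m)
        (g := s.afterQ m k false (encQ (k + 1) qs ++ r) s.cnt s.cnq)
        (R := fun j => {s' | ∃ js, js ∈ vals m qs vs ∧
          s' = s.afterQs m k (false :: qs) r vs (j :: js)}) ?_ (impl_ite_neg ?_
        (impl_quant hi' hr2 h3 h4 (fun j h => h) (impl_guess (.inl rfl) .val m (by exact h1)
          (by exact h2) ?_ _ ?_)))
        ?_).congr ?_).mono (t := 6 * m + 3 + 12 * (dg k).length + 9 * m + 29 + 1 +
          (qs.length * (40 * (B + 1)) + 1) + 1) ?_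
      · simp [Store.top, Store.get, hi', qL]
      · simp [Store.top, Store.get, hi', qL]
      · simp only [List.reverse_cons]
        rcases h : (dg k).reverse with _ | ⟨y, l⟩
        · simp
        · have : y ∈ dg k := by rw [← List.mem_reverse, h]; simp
          obtain ⟨b, rfl⟩ := isBit_of_mem_dg this
          simp
      · intro j k'; cases k' <;> simp [Store.get, varE]
      · rintro j hj
        refine (ih (k + 1) vs _ (by exact h1) (by exact h2) (by exact h3) (by exact h4) (by rfl)
          (by exact hc) (by simpa using hl) (by omega)).congr ?_
        ext s'
        simp [Store.afterQs, Store.afterQ, encQ, tran, envE, qL]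
      · ext s'
        simp only [Set.mem_ofPred_eq, vals]
        constructor
        · rintro ⟨j, hj, js, h, rfl⟩
          exact ⟨_, ⟨j, hj, js, h, rfl⟩, rfl⟩
        · rintro ⟨_, ⟨j, hj, js, h, rfl⟩, rfl⟩
          exact ⟨j, hj, js, h, rfl⟩
      · rw [List.length_cons, add_one_mul]; omega

/-! ### A single assignment -/

theorem claims_seq_single {B : ℕ} {p q : Prog} {s s1 : Store} {t1 t2 w1 w2 : ℕ}
    {e : List (List Sym)} {X : Outcomes} (hp : Claims B p s t1 w1 {(e, s1)})
    (hq : Claims B q s1 t2 w2 X) :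
    Claims B (.seq p q) s (t1 + t2 + 1) (w1 + w2) {x | ∃ y ∈ X, x = (y.1 ++ e, y.2)} :=
  (claims_seq (ι := Unit) (P := fun _ => True) (e := fun _ => e) (g := fun _ => s1)
    (hp.congr (by ext; simp)) fun _ _ => hq).congr (by ext; simp)

/-- The lists of claims that show the formula to be true if the universal variables have the
values `vs`. -/
def leafC (m : ℕ) (qs : List Bool) (ψ : Mat) (vs : List ℕ) : Set (List (List Sym)) :=
  {es | ∃ js ∈ vals m qs vs, ∃ e ∈ matC m (fun i => js.getD i 0) ψ true, es = e ++ [tran m qs js]}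

theorem length_of_mem_vals {m : ℕ} {qs : List Bool} {vs js : List ℕ} (h : js ∈ vals m qs vs)
    (hv : ∀ v ∈ vs, v ≤ m) : js.length = qs.length ∧ ∀ j ∈ js, j ≤ m := by
  induction qs generalizing vs js with
  | nil => obtain rfl : js = [] := h; simp
  | cons q qs ih =>
    cases q with
    | true =>
      obtain ⟨js', h, rfl⟩ := h
      have := ih h fun v hv' => hv v (List.mem_of_mem_tail hv')
      refine ⟨by simp [this.1], ?_⟩
      rintro j (_ | ⟨_, hj⟩)
      · cases vs with
        | nil => simp
        | cons v vs => exact hv v (by simp)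
      · exact this.2 j hj
    | false =>
      obtain ⟨j, hj, js', h, rfl⟩ := h
      have := ih h hv
      exact ⟨by simp [this.1], by simpa [hj] using this.2⟩

theorem length_tran (m : ℕ) {qs : List Bool} {js : List ℕ} (hl : js.length = qs.length)
    (h : ∀ j ∈ js, j ≤ m) : (tran m qs js).length = qs.length * m := by
  induction qs generalizing js with
  | nil => simp [tran]
  | cons q qs ih =>
    cases js with
    | nil => simp at hl
    | cons j js =>
      have := ih (js := js) (by simpa using hl) fun j' hj' => h j' (by simp [hj'])
      rw [tran, List.length_append, this, List.length_map, length_un (h j (by simp)),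
        List.length_cons, add_one_mul, add_comm]

theorem length_le_encQ (k : ℕ) (qs : List Bool) : qs.length ≤ (encQ k qs).length := by
  induction qs generalizing k with
  | nil => simp
  | cons q qs ih =>
    have := ih (k + 1)
    simp only [encQ, List.length_cons, List.length_append]
    omega

theorem length_envE {m : ℕ} {js : List ℕ} (k : ℕ) {qs : List Bool} (hl : js.length = qs.length)
    (h : ∀ j ∈ js, j ≤ m) : (encL (envE m k js).reverse).length ≤ (encQ k qs).length * (m + 1) := by
  induction qs generalizing js k with
  | nil =>
    obtain rfl : js = [] := by simpa using hl
    simp [envE]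
  | cons q qs ih =>
    cases js with
    | nil => simp at hl
    | cons j js =>
      have := ih (js := js) (k + 1) (by simpa using hl) fun j' hj' => h j' (by simp [hj'])
      simp only [envE, List.reverse_cons, encL_append, encL_cons, encL_nil, List.length_append,
        List.length_cons, List.length_nil, varE, List.length_map, length_un (h j (by simp)), encQ]
      nlinarith

theorem mem_envE {m k : ℕ} {js : List ℕ} {e : List Sym} :
    e ∈ envE m k js ↔ ∃ i < js.length, e = varE m (k + i) (js.getD i 0) := by
  induction js generalizing k with
  | nil => simp [envE]
  | cons j js ih =>
    rw [envE, List.mem_cons, ih]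
    constructor
    · rintro (rfl | ⟨i, hi, rfl⟩)
      · exact ⟨0, by simp, by simp⟩
      · exact ⟨i + 1, by simpa using hi, by simp [add_assoc, add_comm 1]⟩
    · rintro ⟨_ | i, hi, rfl⟩
      · simp
      · exact .inr ⟨i, by simpa using hi, by simp [add_assoc, add_comm 1]⟩

/-- Evaluate the formula for the values of the universal variables in the stack `cnt`. -/
def leaf : Prog :=
  .seq prefixP (.seq (mv .tr .alt) (.seq claim
    (.seq (det fun _ k => if k = .goal then .push (.val true) else .keep)
      (.seq matrix (.seq (mv .inp .inq) (.seq (mv .inq .inp) (drop .env fun _ => True)))))))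

/-- The stacks between two evaluations of the formula. -/
structure Idle (m : ℕ) (s : Store) : Prop where
  rul : s.rul = .replicate m .mark
  ruq : s.ruq = []
  cur : s.cur = []
  alt : s.alt = []
  scr : s.scr = []
  tr : s.tr = []
  env : s.env = []
  atm : s.atm = []
  atb : s.atb = []
  goal : s.goal = []
  inq : s.inq = []
  cnq : s.cnq = []

theorem fin_notMem_tran (m : ℕ) (qs : List Bool) (js : List ℕ) : Sym.fin ∉ tran m qs js := by
  induction qs generalizing js with
  | nil => simp [tran]
  | cons q qs ih =>
    cases js with
    | nil => simp [tran]
    | cons j js => cases q <;> simp [tran, ih]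

/-- The runs of `leaf` correspond to the lists of claims in `leafC`. -/
theorem claims_leaf {B m : ℕ} {s : Store} {qs : List Bool} {ψ : Mat} {r : List Sym} {vs : List ℕ}
    (hs : Idle m s) (hi : s.inp = encQ 0 qs ++ (encM ψ ++ r)) (hψ : ψ.Below qs.length)
    (hr : Stops r) (hc : Chunks m s.cnt vs) (hv : ∀ v ∈ vs, v ≤ m) (hl : vs.length = qs.count true)
    (hm : m ≤ B) (hB : s.inp.length * (m + 1) ≤ B) :
    Claims B leaf s ((s.inp.length + 1) * (400 * (B + 1))) (s.inp.length * (2 * m + 6) + 1)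
      {x | ∃ es ∈ leafC m qs ψ vs, x = (es, { s with cnt := [], cnq := (encCnt m vs).reverse })} :=
        by
  have hn : s.inp.length = (encQ 0 qs).length + ((encM ψ).length + r.length) := by simp [hi]
  have hq := length_le_encQ 0 qs
  have hL : s.inp.length ≤ B := (Nat.le_mul_of_pos_right _ (by omega)).trans hB
  have hqm : (encQ 0 qs).length * (m + 1) ≤ B := (Nat.mul_le_mul_right _ (by omega)).trans hB
  have hqm' : qs.length * m ≤ B := (Nat.mul_le_mul hq (by omega)).trans hqm
  let T : List ℕ → Store := fun js => s.afterQs m 0 qs (encM ψ ++ r) vs js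
  refine ((claims_seq (P := fun js => js ∈ vals m qs vs) (g := T) (Y := fun js =>
      {x | ∃ e ∈ matC m (fun i => js.getD i 0) ψ true, x = (e ++ [tran m qs js],
        { s with cnt := [], cnq := (encCnt m vs).reverse })})
    (t2 := 3 * B + 1 + (50 * B + 50 + (2 + ((encM ψ).length * (300 * (B + 1)) + 1 +
      (3 * B + 1 + (3 * B + 1 + (3 * B + 1) + 1) + 1) + 1) + 1) + 1) + 1)
    (w2 := qs.length * m + 1 + ((encM ψ).length * (2 * m + 6) + 0))
    (claims_of_impl fun l => impl_prefixP (s := { s with log := l }) (B := B) (stops_encM ψ r) ?_ hm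
      qs 0 vs hs.rul hs.ruq hs.cur hs.alt hi hc hl (by omega)) fun js hjs => ?_).mono ?_ ?_).congr
        ?_
  · cases ψ <;> simp [encM]
  · obtain ⟨hj1, hj2⟩ := length_of_mem_vals hjs hv
    have ht := length_tran m hj1 hj2
    let s1 : Store := { T js with tr := [], alt := tran m qs js }
    let s2 : Store := { T js with tr := [], goal := [.val true] }
    have hready : Ready m qs.length (fun i => js.getD i 0) (envE m 0 js).reverse s2 := by
      refine ⟨hs.rul, hs.ruq, hs.cur, hs.alt, hs.scr, ?_, fun i hi => ?_, fun e he => ?_,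
        fun i hi => ?_⟩
      · simp [s2, T, Store.afterQs, hs.env]
      · have hi' : i < js.length := by omega
        simpa [List.getD, hi'] using hj2 _ (List.getElem_mem hi')
      · rw [List.mem_reverse, mem_envE] at he
        simpa [hj1] using he
      · rw [List.mem_reverse, mem_envE]
        exact ⟨i, by omega, by simp⟩
    refine (claims_seq_det (s1 := s1) (t1 := 3 * (qs.length * m) + 1)
      (fun l => impl_mv (qs.length * m) ?_ ?_)
      (claims_seq_single (s1 := { T js with tr := [] }) (e := [tran m qs js])
        (((claims_claim (s := s1) (by exact hs.cur)
          (by exact hs.scr) (by exact fin_notMem_tran m qs js)).mono le_rfl ?_).congr ?_)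
        (claims_seq_det (s1 := s2) (fun l => impl_det ?_) (claims_seq
          (Y := fun _ => {([], { s with cnt := [], cnq := (encCnt m vs).reverse })})
          (t2 := 3 * B + 1 + (3 * B + 1 + (3 * B + 1) + 1) + 1)
          (claims_matrix hr hm ?_ (encM ψ).length s2 [(ψ, .val true)] hready ?_ ?_ ?_ ?_ ?_ ?_
            (by omega)) fun es _ => claims_det fun l => ?_) le_rfl)) (by omega)).congr ?_
    · simp [Store.get, T, Store.afterQs, ht, hs.tr]
    · intro k; cases k <;> simp [Store.get, s1, T, Store.afterQs, hs.tr, hs.alt]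
    · simp [s1, ht]
    · simp [s1, T, Store.afterQs, hs.alt]
    · intro k; cases k <;> simp [Store.get, Op.ap, s2, T, Store.afterQs, hs.goal]
    · exact (length_envE 0 hj1 hj2).trans hqm
    · exact hs.atm
    · exact hs.atb
    · simpa using hψ
    · simp [s2, T, Store.afterQs, encF]
    · rfl
    · simp [encF]
    · refine (impl_seq_det (s1 := { s2 with
          inp := [], inq := s.inp.reverse, goal := [], log := l }) (t1 := 3 * r.length + 1)
        (impl_mv r.length ?_ ?_) (impl_seq_det (s1 := { s2 with
          goal := [], log := l, inp := s.inp, inq := [] }) (t1 := 3 * s.inp.length + 1)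
          (impl_mv s.inp.length ?_ ?_)
          (impl_xfer (encL (envE m 0 js).reverse) [] ?_ (by simp) (by simp) ?_) le_rfl)
          le_rfl).mono ?_
      · simp [Store.get, Store.afterList]
      · intro k
        cases k <;> simp [Store.get, Store.afterList, s2, T, Store.afterQs, encF, hi, hs.inq]
      · simp [Store.get]
      · intro k; cases k <;> simp [Store.get, s2, T, Store.afterQs]
      · simp [Store.get, s2, T, Store.afterQs, hs.env]
      · intro k; cases k <;> simp [Store.get, s2, T, Store.afterQs, hs.env, hs.tr, hs.goal, hs.inq,
          hs.cnq]
      · have := (length_envE 0 hj1 hj2).trans hqm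
        omega
    · ext x
      simp [listC, tv, and_assoc]
  · have h1 : qs.length * (40 * (B + 1)) ≤ (encQ 0 qs).length * (40 * (B + 1)) :=
      Nat.mul_le_mul_right _ hq
    rw [hn]
    nlinarith [Nat.zero_le (r.length * (B + 1)), Nat.zero_le ((encQ 0 qs).length * (B + 1)),
      Nat.zero_le ((encM ψ).length * (B + 1))]
  · have h1 : qs.length * m ≤ (encQ 0 qs).length * m := Nat.mul_le_mul_right _ hq
    rw [hn]
    nlinarith [Nat.zero_le (r.length * m), Nat.zero_le ((encQ 0 qs).length * m)]
  · ext x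
    simp only [leafC, Set.mem_ofPred_eq]
    constructor
    · rintro ⟨js, hjs, _, ⟨e, he, rfl⟩, rfl⟩
      exact ⟨_, ⟨js, hjs, e, he, rfl⟩, by simp⟩
    · rintro ⟨_, ⟨js, hjs, e, he, rfl⟩, rfl⟩
      exact ⟨js, hjs, _, ⟨e, he, rfl⟩, by simp⟩

/-! ### All assignments -/

/-- The `u` last digits of `k` to the base `m + 1`, the last digit first. -/
def dgs (m : ℕ) : ℕ → ℕ → List ℕ
  | 0, _ => []
  | u + 1, k => k % (m + 1) :: dgs m u (k / (m + 1))

theorem length_dgs (m u k : ℕ) : (dgs m u k).length = u := by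
  induction u generalizing k with
  | zero => rfl
  | succ u ih => simp [dgs, ih]

theorem le_of_mem_dgs {m u k v : ℕ} (h : v ∈ dgs m u k) : v ≤ m := by
  induction u generalizing k with
  | zero => simp [dgs] at h
  | succ u ih =>
    rcases List.mem_cons.1 h with rfl | h
    · exact Nat.lt_succ_iff.1 (Nat.mod_lt _ (by omega))
    · exact ih h

theorem exists_dgs {m : ℕ} (vs : List ℕ) (h : ∀ v ∈ vs, v ≤ m) :
    ∃ k < (m + 1) ^ vs.length, dgs m vs.length k = vs := by
  induction vs with
  | nil => exact ⟨0, by simp, rfl⟩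
  | cons v vs ih =>
    obtain ⟨k, hk, h'⟩ := ih fun v' hv' => h v' (by simp [hv'])
    have hv := h v (by simp)
    refine ⟨v + (m + 1) * k, ?_, ?_⟩
    · rw [List.length_cons, pow_succ']
      calc v + (m + 1) * k < (m + 1) * (k + 1) := by rw [mul_add_one]; omega
        _ ≤ _ := Nat.mul_le_mul_left _ hk
    · rw [List.length_cons, dgs, Nat.add_mul_mod_self_left, Nat.mod_eq_of_lt (by omega),
        Nat.add_mul_div_left _ _ (by omega), Nat.div_eq_of_lt (by omega), Nat.zero_add, h']

theorem chunks_append {m : ℕ} {vs ws : List ℕ} {l : List Sym} (h : ∀ v ∈ vs, v ≤ m)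
    (hl : Chunks m l ws) : Chunks m (encCnt m vs ++ l) (vs ++ ws) := by
  induction vs with
  | nil => simpa [encCnt] using hl
  | cons v vs ih =>
    have hv := h v (by simp)
    refine ⟨m - v, encCnt m vs ++ l, by omega, by simp [encCnt, un], ih fun v' hv' => h v' ?_⟩
    simp [hv']

/-- The digits of the numbers `vs` in the order in which they are left by `value`. -/
def revCnt (m : ℕ) (vs : List ℕ) : List Sym := vs.flatMap fun v => .sep ::
    ((un m v).map .key).reverse

theorem reverse_encCnt (m : ℕ) (vs : List ℕ) : (encCnt m vs).reverse = revCnt m vs.reverse := by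
  induction vs with
  | nil => rfl
  | cons v vs ih =>
    rw [encCnt, List.flatMap_cons, List.reverse_append, ← encCnt, ih]
    simp [revCnt]

theorem length_encCnt {m : ℕ} {vs : List ℕ} (h : ∀ v ∈ vs, v ≤ m) :
    (encCnt m vs).length = vs.length * (m + 1) := by
  induction vs with
  | nil => simp [encCnt]
  | cons v vs ih =>
    have := ih fun v' hv' => h v' (by simp [hv'])
    rw [encCnt, List.flatMap_cons, List.length_append, ← encCnt, this]
    simp [length_un (h v (by simp)), add_one_mul, add_comm]

theorem head_revCnt (m : ℕ) (vs : List ℕ) : ∀ x ∈ (revCnt m vs).head?, x = .sep := by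
  cases vs <;> simp [revCnt]

/-- The loop of `inc`: the last value of `cnq` stands first, with the digits `false` on top.  If
there is such a digit, then the value can be increased; otherwise it is reset to zero, and the loop
goes on with the preceding value. -/
def incLoop : Prog :=
  .loop (fun h => h .cnq = some .sep ∧ h .flag = none)
    (.seq (det fun _ k => if k = .cnq then .pop else if k = .cnt then .push .sep else .keep)
      (.ite (fun h => h .cnq = some (.key false))
        (.seq (drop .cnq (· = .key false)) (det fun _ k =>
          if k = .cnt then .push (.key true) else if k = .flag then .push .mark else .keep))
        (drop .cnq (· = .key true))))

/-- Pass to the next values of the universal variables, and set `flag` if there are any. -/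
def inc : Prog := .seq incLoop (mv .cnq .cnt)

/-- The loop counts to the base `m + 1`. -/
theorem impl_incLoop (m u : ℕ) : ∀ (k : ℕ) (ws : List ℕ) (c : List Sym), k < (m + 1) ^ u →
    Chunks m c ws → ∃ l r, Chunks m (r.reverse ++ l) ((dgs m u (k + 1)).reverse ++ ws) ∧
      r.length ≤ u * (m + 1) ∧ ∀ s : Store, s.cnq = revCnt m (dgs m u k) → s.cnt = c →
      s.flag = [] → Impl incLoop s (u * (3 * m + 12) + 1)
        {{ s with cnq := r, cnt := l, flag := if k + 1 < (m + 1) ^ u then [.mark] else [] }} := by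
  induction u with
  | zero =>
    intro k ws c hk hc
    refine ⟨c, [], by simpa [dgs] using hc, by simp, fun s hq hsc hf =>
      ((impl_loop_done ?_).congr ?_).mono (by omega)⟩
    all_goals have hq : s.cnq = [] := hq
    · simp [Store.top, Store.get, hq]
    · congr 1
      refine Store.get_injective fun k => ?_
      cases k <;> simp [Store.get, hq, hf, hsc]
  | succ u ih =>
    intro k ws c hk hc
    have hk' : k / (m + 1) < (m + 1) ^ u :=
      Nat.div_lt_of_lt_mul (by rwa [← pow_succ'])
    have hdm := Nat.div_add_mod k (m + 1)
    have hj := Nat.mod_lt k (show m + 1 > 0 by omega)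
    set j := k % (m + 1) with hjdef
    set k' := k / (m + 1) with hkdef
    have hq' : revCnt m (dgs m (u + 1) k) = .sep :: (.replicate (m - j) (.key false) ++
        (.replicate j (.key true) ++ revCnt m (dgs m u k'))) := by
      rw [dgs, revCnt, List.flatMap_cons, ← revCnt]
      simp [un, ← hjdef, ← hkdef]
    have hc1 : ∀ s : Store, s.cnq = revCnt m (dgs m (u + 1) k) → s.flag = [] →
        Store.top s .cnq = some .sep ∧ Store.top s .flag = none := by
      intro s hq hf
      simp [Store.top, Store.get, hq, hq', hf]
    by_cases hjm : j < m
    · have h1 : (k + 1) % (m + 1) = j + 1 := by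
        rw [← hdm, add_assoc, Nat.mul_add_mod, Nat.mod_eq_of_lt (by omega)]
      have h2 : (k + 1) / (m + 1) = k' := by
        rw [← hdm, add_assoc, Nat.mul_add_div (by omega), Nat.div_eq_of_lt (by omega), add_zero]
      have h3 : k + 1 < (m + 1) ^ (u + 1) := by
        rw [pow_succ']
        calc k + 1 < (m + 1) * (k' + 1) := by rw [mul_add_one]; omega
          _ ≤ _ := Nat.mul_le_mul_left _ hk'
      refine ⟨.key true :: .sep :: c, .replicate j (.key true) ++ revCnt m (dgs m u k'), ?_, ?_,
        ?_⟩
      · have hch : Chunks m ((List.replicate (j + 1) true ++ List.replicate 0 false).map .key ++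
            .sep :: c) ((j + 1) :: ws) := ⟨0, c, by omega, rfl, hc⟩
        have := chunks_append (vs := (dgs m u k').reverse) (m := m)
          (fun v hv => le_of_mem_dgs (List.mem_reverse.1 hv)) hch
        have e := reverse_encCnt m (dgs m u k').reverse
        rw [List.reverse_reverse] at e
        rw [dgs, h1, h2, ← e]
        simpa [List.replicate_succ'] using this
      · have e := reverse_encCnt m (dgs m u k').reverse
        rw [List.reverse_reverse] at e
        rw [← e, List.length_append, List.length_reverse, length_encCnt
          (fun v hv => le_of_mem_dgs (List.mem_reverse.1 hv)), List.length_reverse, length_dgs,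
          List.length_replicate, add_one_mul]
        omega
      · rintro s hq rfl hf
        refine impl_loop_det (t1 := 3 * m + 9) (t2 := 1) (hc1 s hq hf) (impl_seq_det (s1 := { s with
            cnt := .sep :: s.cnt, cnq := .replicate (m - j) (.key false) ++
              (.replicate j (.key true) ++ revCnt m (dgs m u k')) }) (impl_det ?_)
          (impl_ite_pos ?_ (impl_seq_det (s1 := { s with
            cnt := .sep :: s.cnt, cnq := .replicate j (.key true) ++ revCnt m (dgs m u k') })
            (impl_xfer (.replicate (m - j) (.key false)) _ (by rfl) (by simp) ?_ ?_)
            (impl_det ?_) le_rfl)) ?_) (impl_loop_done ?_) ?_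
        · intro k; cases k <;> simp [Store.get, Op.ap, hq, hq']
        · obtain ⟨d, hd⟩ : ∃ d, m - j = d + 1 := ⟨m - j - 1, by omega⟩
          simp [Store.top, Store.get, hd, List.replicate_succ]
        · cases j with
          | zero => intro x hx; rw [head_revCnt m _ x (by simpa using hx)]; simp
          | succ j => simp [List.replicate_succ]
        · intro k; cases k <;> simp [Store.get]
        · intro k; cases k <;> simp [Store.get, Op.ap, hf, h3]
        · simp; omega
        · simp [Store.top, Store.get, h3]
        · rw [add_one_mul]; omega
    · have hjm' : j = m := by omega
      rw [hjm'] at hdm hq'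
      have h1 : (k + 1) % (m + 1) = 0 := by
        rw [← hdm, add_assoc, Nat.mul_add_mod, Nat.mod_self]
      have h2 : (k + 1) / (m + 1) = k' + 1 := by
        rw [← hdm, add_assoc, Nat.mul_add_div (by omega), Nat.div_self (by omega)]
      have h3 : k + 1 < (m + 1) ^ (u + 1) ↔ k' + 1 < (m + 1) ^ u := by
        rw [pow_succ', ← hdm, add_assoc, ← mul_add_one]
        exact Nat.mul_lt_mul_left (by omega)
      obtain ⟨l, r, hl, hr, hp⟩ := ih k' (0 :: ws) (.sep :: c) hk'
        ⟨0, c, by omega, rfl, hc⟩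
      refine ⟨l, r, ?_, hr.trans (Nat.mul_le_mul_right _ (by omega)), ?_⟩
      · rw [dgs, h1, h2]
        simpa using hl
      · rintro s hq rfl hf
        have hp' := hp { s with cnt := .sep :: s.cnt, cnq := revCnt m (dgs m u k') } rfl rfl hf
        simp only [h3]
        refine impl_loop_det (t1 := 3 * m + 6) (hc1 s hq hf) (impl_seq_det (s1 := { s with
            cnt := .sep :: s.cnt, cnq := .replicate m (.key true) ++ revCnt m (dgs m u k') })
            (impl_det ?_) (impl_ite_neg ?_
            (impl_xfer (.replicate m (.key true)) (revCnt m (dgs m u k')) (by rfl) (by simp) ?_ ?_))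
            ?_) hp' ?_
        · intro k; cases k <;> simp [Store.get, Op.ap, hq, hq']
        · intro h
          rcases Nat.eq_zero_or_pos m with h0 | h0
          · have := head_revCnt m _ _ (by simpa [Store.top, Store.get, h0] using h)
            simp at this
          · obtain ⟨d, hd⟩ : ∃ d, m = d + 1 := ⟨m - 1, by omega⟩
            simp [Store.top, Store.get, hd, List.replicate_succ] at h
        · intro x hx; rw [head_revCnt m _ x hx]; simp
        · intro k; cases k <;> simp [Store.get]
        · simp; omega
        · rw [add_one_mul]; omega

theorem impl_inc {m u k : ℕ} (hk : k < (m + 1) ^ u) :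
    ∃ l, Chunks m l (dgs m u (k + 1)).reverse ∧ ∀ s : Store, s.cnq = revCnt m (dgs m u k) →
      s.cnt = [] → s.flag = [] → Impl inc s (u * (6 * m + 15) + 3)
        {{ s with cnq := [], cnt := l, flag := if k + 1 < (m + 1) ^ u then [.mark] else [] }} := by
  obtain ⟨l, r, hl, hr, hp⟩ := impl_incLoop m u k [] [] hk rfl
  refine ⟨r.reverse ++ l, by simpa using hl, fun s hq hc hf =>
    impl_seq_det (hp s hq hc hf) (impl_mv r.length rfl ?_) ?_⟩
  · intro k; cases k <;> simp [Store.get]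
  · nlinarith

/-- The lists of claims for `d` successive assignments to the universal variables. -/
def leavesC (m u : ℕ) (qs : List Bool) (ψ : Mat) : ℕ → ℕ → Set (List (List Sym))
  | _, 0 => {[]}
  | k, d + 1 => {es | ∃ e1 ∈ leafC m qs ψ (dgs m u k).reverse, ∃ e2 ∈ leavesC m u qs ψ (k + 1) d,
      es = e2 ++ e1}

/-- Evaluate the formula for all values of the universal variables. -/
def leaves : Prog :=
  .loop (nonempty .flag)
    (.seq (det fun _ k => if k = .flag then .pop else .keep) (.seq leaf inc))

theorem claims_round {B m u k : ℕ} {qs : List Bool} {ψ : Mat} {r : List Sym} {s : Store}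
    (hi : s.inp = encQ 0 qs ++ (encM ψ ++ r)) (hψ : ψ.Below qs.length)
    (hr : Stops r) (hu : u = qs.count true) (hm : m ≤ B) (hB : s.inp.length * (m + 1) ≤ B)
    (hk : k < (m + 1) ^ u) (hs : Idle m s) (hc : Chunks m s.cnt (dgs m u k).reverse)
    (hf : s.flag = [.mark]) :
    ∃ l, Chunks m l (dgs m u (k + 1)).reverse ∧
      Claims B (.seq (det fun _ k => if k = .flag then .pop else .keep) (.seq leaf inc)) s
        ((s.inp.length + 1) * (440 * (B + 1))) (s.inp.length * (2 * m + 6) + 1)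
        {x | ∃ es ∈ leafC m qs ψ (dgs m u k).reverse, x = (es, { s with
          cnt := l, flag := if k + 1 < (m + 1) ^ u then [.mark] else [] })} := by
  obtain ⟨l, hl, hp⟩ := impl_inc hk
  have hu' : u * (m + 1) ≤ B := by
    refine (Nat.mul_le_mul_right _ ?_).trans hB
    have h1 := length_le_encQ 0 qs
    have h2 : u ≤ qs.length := hu ▸ List.count_le_length
    simp only [hi, List.length_append]
    omega
  have hv : ∀ v ∈ (dgs m u k).reverse, v ≤ m := fun v hv => le_of_mem_dgs (List.mem_reverse.1 hv)
  refine ⟨l, hl, ((claims_seq_det (s1 := { s with flag := [] }) (fun l => impl_det ?_)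
    (claims_seq (Y := fun _ => {([], { s with
        cnt := l, flag := if k + 1 < (m + 1) ^ u then [.mark] else [] })})
      (claims_leaf (s := { s with flag := [] })
        ⟨hs.1, hs.2, hs.3, hs.4, hs.5, hs.6, hs.7, hs.8, hs.9, hs.10, hs.11, hs.12⟩ hi hψ hr hc hv
        (by simp [length_dgs, hu]) hm hB)
      fun es _ => claims_det fun lg => (hp { s with
        flag := [], cnt := [], cnq := (encCnt m (dgs m u k).reverse).reverse, log := lg }
        (by simp [reverse_encCnt]) rfl rfl).congr ?_) le_rfl).mono ?_ (by simp)).congr ?_⟩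
  · intro k; cases k <;> simp [Store.get, Op.ap, hf]
  · simp [hs.cnq]
  · simp only
    nlinarith [Nat.zero_le (s.inp.length * B)]
  · ext x
    simp

theorem claims_leaves {B m u : ℕ} {qs : List Bool} {ψ : Mat} {r inp : List Sym}
    (hi : inp = encQ 0 qs ++ (encM ψ ++ r)) (hψ : ψ.Below qs.length)
    (hr : Stops r) (hu : u = qs.count true) (hm : m ≤ B) (hB : inp.length * (m + 1) ≤ B) :
    ∀ (d k : ℕ) (s : Store), k + d + 1 = (m + 1) ^ u → s.inp = inp → Idle m s →
      Chunks m s.cnt (dgs m u k).reverse → s.flag = [.mark] →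
      ∃ sf, Claims B leaves s ((d + 1) * ((inp.length + 1) * (450 * (B + 1))) + 1)
        ((d + 1) * (inp.length * (2 * m + 6) + 1))
        {x | ∃ es ∈ leavesC m u qs ψ k (d + 1), x = (es, sf)} := by
  intro d
  induction d with
  | zero =>
    rintro k s hk rfl h1 h2 h3
    obtain ⟨l, hl, hp⟩ := claims_round hi hψ hr hu hm hB (by omega) h1 h2 h3
    refine ⟨{ s with cnt := l, flag := [] }, ((claims_loop (fun l => ?_) hp
      (Y := fun _ => {([], { s with cnt := l, flag := [] })})
      fun es _ => (claims_loop_done fun l => ?_).congr ?_).mono ?_ ?_).congr ?_⟩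
    · simp [nonempty, Store.top, Store.get, h3]
    · simp [nonempty, Store.top, Store.get, ← hk]
    · simp [← hk]
    · nlinarith [Nat.zero_le (s.inp.length * B)]
    · omega
    · ext x
      simp [leavesC]
  | succ d ih =>
    rintro k s hk rfl h1 h2 h3
    obtain ⟨l, hl, hp⟩ := claims_round hi hψ hr hu hm hB (by omega) h1 h2 h3
    obtain ⟨sf, hsf⟩ := ih (k + 1) { s with
      cnt := l, flag := if k + 1 < (m + 1) ^ u then [.mark] else [] } (by omega) rfl
      ⟨h1.1, h1.2, h1.3, h1.4, h1.5, h1.6, h1.7, h1.8, h1.9, h1.10, h1.11, h1.12⟩ hl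
      (if_pos (by omega))
    refine ⟨sf, ((claims_loop (fun l => ?_) hp fun es _ => hsf).mono ?_ ?_).congr ?_⟩
    · simp [nonempty, Store.top, Store.get, h3]
    · nlinarith [Nat.zero_le (s.inp.length * B)]
    · nlinarith
    · ext x
      simp only [Set.mem_ofPred_eq, leavesC]
      constructor
      · rintro ⟨e1, h1, _, ⟨_, ⟨e2, h2, e3, h3, rfl⟩, rfl⟩, rfl⟩
        exact ⟨_, ⟨e1, h1, _, ⟨e2, h2, e3, h3, rfl⟩, rfl⟩, rfl⟩
      · rintro ⟨_, ⟨e1, h1, _, ⟨e2, h2, e3, h3, rfl⟩, rfl⟩, rfl⟩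
        exact ⟨e1, h1, _, ⟨_, ⟨e2, h2, e3, h3, rfl⟩, rfl⟩, rfl⟩

/-! ### The whole program -/

/-- The quantifier prefix `qs` as it is written with implication, falsity and universal quantifiers
only; the letters for falsity that belong to existential quantifiers stand after the matrix. -/
def encI : ℕ → List Bool → List Sym
  | _, [] => []
  | k, true :: qs => .all :: .var :: (dg k ++ encI (k + 1) qs)
  | k, false :: qs => .imp :: .all :: .var :: (dg k ++ .imp :: encI (k + 1) qs)

/-- The number of blocks of universal quantifiers, not counting one at the beginning if the
preceding quantifier is universal. -/
def nblk : Bool → List Bool → ℕ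
  | _, [] => 0
  | l, true :: qs => nblk true qs + if l then 0 else 1
  | _, false :: qs => nblk false qs

theorem tower_succ' (k m : ℕ) : tower (k + 1) m = tower k (2 ^ m) := by
  induction k with
  | zero => rfl
  | succ k ih => rw [tower, ih, tower]

theorem le_tower (k m : ℕ) : m ≤ tower k m := by
  induction k with
  | zero => exact le_rfl
  | succ k ih => exact ih.trans Nat.lt_two_pow_self.le

/-- Copy the name of the bound variable. -/
def copyVar : Prog :=
  .seq (det fun _ k => if k = .inp then .pop else if k = .inq then .push .var else .keep)
    (xfer .inp isBit fun k => if k = .inq then some id else none)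

/-- Rewrite the quantifier prefix, and compute the bound for the size of the domain.  The stack
`lastU` is empty unless the last quantifier was universal, and `flag` is emptied at the end of the
prefix.  A prefix letter `imp` belongs to an existential quantifier if and only if `all` follows. -/
def rewrite : Prog :=
  .loop (nonempty .flag)
    (.ite (fun h => h .inp = some .all)
      (.seq (.ite (nonempty .lastU) skip (.seq exp
          (det fun _ k => if k = .lastU then .push .mark else .keep)))
        (.seq (det fun _ k => if k = .inp then .pop else if k = .inq then .push .all
            else if k = .cnt then .push .sep else .keep) copyVar))
      (.ite (fun h => h .inp = some .imp)
        (.seq (det fun _ k => if k = .inp then .pop else .keep)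
          (.ite (fun h => h .inp = some .all)
            (.seq (det fun _ k => if k = .inp ∨ k = .lastU then .pop
                else if k = .inq then .push .ex else .keep)
              (.seq copyVar (det fun _ k => if k = .inp then .pop else .keep)))
            (det fun _ k => if k = .flag then .pop else if k = .inq then .push .imp else .keep)))
        (det fun _ k => if k = .flag then .pop else .keep)))

theorem impl_copyVar {s : Store} {k : ℕ} {r : List Sym} (hi : s.inp = .var :: (dg k ++ r))
    (hr : ∀ x ∈ r.head?, ¬ isBit x) :
    Impl copyVar s (3 * (dg k).length + 4)
      {{ s with inp := r, inq := (.var :: dg k).reverse ++ s.inq }} := by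
  refine impl_seq_det (s1 := { s with inp := dg k ++ r, inq := .var :: s.inq }) (impl_det ?_)
    (impl_xfer (dg k) r (by rfl) (fun x hx => isBit_of_mem_dg hx) hr ?_) (by omega)
  · intro k; cases k <;> simp [Store.get, Op.ap, hi]
  · intro k; cases k <;> simp [Store.get]

theorem head_encM (φ : Mat) (r : List Sym) : (encM φ ++ r).head? ≠ some .all := by
  cases φ <;> simp [encM]

theorem impl_rewrite (ψ : Mat) (r : List Sym) :
    ∀ (qs : List Bool) (k R : ℕ) (l : Bool) (s : Store), s.flag = [.mark] → s.siz = [] →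
      s.ruq = [] → s.scr = [] → s.rul = .replicate R .mark →
      s.lastU = (if l then [.mark] else []) → s.inp = encI k qs ++ (encM ψ ++ r) →
      ∃ x y lu, x.reverse ++ y = s.inq.reverse ++ (encQ k qs ++ (encM ψ ++ r)) ∧
        lu.length ≤ 1 ∧
        Impl rewrite s (qs.length * (30 * tower (nblk l qs) R + 22) + 3 * (encI k qs).length + 10)
          {{ s with
            inp := y, inq := x, lastU := lu, flag := []
            rul := .replicate (tower (nblk l qs) R) .mark
            cnt := .replicate (qs.count true) .sep ++ s.cnt }} := by
  intro qs
  induction qs with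
  | nil =>
    intro k R l s hf h1 h2 h3 h4 hl hi
    have hi : s.inp = encM ψ ++ r := hi
    have hll : s.lastU.length ≤ 1 := by rw [hl]; split_ifs <;> simp
    have hc : nonempty .flag s.top := by simp [nonempty, Store.top, Store.get, hf]
    have hna : ¬ s.top .inp = some .all := by
      simpa [Store.top, Store.get, hi] using head_encM ψ r
    by_cases hψ : ∃ φ1 φ2, ψ = .imp φ1 φ2
    · obtain ⟨φ1, φ2, rfl⟩ := hψ
      refine ⟨.imp :: s.inq, encM φ1 ++ (encM φ2 ++ r), s.lastU, by simp [encM, encQ], hll, ?_⟩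
      refine impl_loop_det (s1 := { s with
          inp := encM φ1 ++ (encM φ2 ++ r), inq := .imp :: s.inq, flag := [] }) hc
        (impl_ite_neg hna (impl_ite_pos ?_ (impl_seq_det (s1 := { s with
          inp := encM φ1 ++ (encM φ2 ++ r) }) (impl_det ?_) (impl_ite_neg ?_ (impl_det ?_))
            le_rfl)))
        ((impl_loop_done ?_).congr ?_) (by omega)
      · simp [Store.top, Store.get, hi, encM]
      · intro k; cases k <;> simp [Store.get, Op.ap, hi, encM]
      · simpa [Store.top, Store.get, hi] using head_encM φ1 (encM φ2 ++ r)
      · intro k; cases k <;> simp [Store.get, Op.ap, hf]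
      · simp [nonempty, Store.top, Store.get]
      · simp [nblk, tower, h4]
    · refine ⟨s.inq, s.inp, s.lastU, by simp [hi, encQ], hll, ?_⟩
      refine impl_loop_det (s1 := { s with flag := [] }) hc
        (impl_ite_neg hna (impl_ite_neg ?_ (impl_det ?_)))
        ((impl_loop_done ?_).congr ?_) (by omega)
      · cases ψ with
        | imp φ1 φ2 => exact (hψ ⟨_, _, rfl⟩).elim
        | _ => simp [Store.top, Store.get, hi, encM]
      · intro k; cases k <;> simp [Store.get, Op.ap, hf]
      · simp [nonempty, Store.top, Store.get]
      · simp [nblk, tower, h4]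
  | cons q qs ih =>
    intro k R l s hf h1 h2 h3 h4 hl hi
    have hc : nonempty .flag s.top := by simp [nonempty, Store.top, Store.get, hf]
    have hr : ∀ x ∈ (encI (k + 1) qs ++ (encM ψ ++ r)).head?, ¬ isBit x := by
      rcases qs with _ | ⟨_ | _, qs⟩
      · exact fun x hx => (stops_encM ψ r x hx).1
      · simp [encI, isBit]
      · simp [encI, isBit]
    cases q with
    | true =>
      set R' := if l then R else 2 ^ R with hR'
      have hS : tower (nblk l (true :: qs)) R = tower (nblk true qs) R' := by
        cases l
        · simp [nblk, hR', tower_succ']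
        · simp [nblk, hR']
      have hR'S : R' ≤ tower (nblk true qs) R' := le_tower _ _
      obtain ⟨x, y, lu, hxy, hlu, hp⟩ := ih (k + 1) R' true { s with
        inp := encI (k + 1) qs ++ (encM ψ ++ r), inq := (.all :: .var :: dg k).reverse ++ s.inq,
        cnt := .sep :: s.cnt, lastU := [.mark], rul := .replicate R' .mark } hf h1 h2 h3 rfl
        (by simp) rfl
      refine ⟨x, y, lu, by simpa [encQ, qL] using hxy, hlu, ?_⟩
      refine impl_loop_det hc (impl_ite_pos ?_ (impl_seq_det (s1 := { s with
          lastU := [.mark], rul := .replicate R' .mark }) (t1 := 30 * R' + 4) ?_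
        (impl_seq_det (s1 := { s with
          lastU := [.mark], rul := .replicate R' .mark, cnt := .sep :: s.cnt,
          inp := .var :: (dg k ++ (encI (k + 1) qs ++ (encM ψ ++ r))), inq := .all :: s.inq })
          (impl_det ?_) ((impl_copyVar (by rfl) hr).congr ?_) le_rfl) le_rfl)) (hp.congr ?_) ?_
      · simp [Store.top, Store.get, hi, encI]
      · cases l with
        | true =>
          refine ((impl_ite_pos ?_ (impl_skip s)).congr ?_).mono (by omega)
          · simp [nonempty, Store.top, Store.get, hl]
          · congr 1
            refine Store.get_injective fun k => ?_
            cases k <;> simp [Store.get, hl, h4, hR']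
        | false =>
          refine (impl_ite_neg ?_ (impl_seq_det (impl_exp R h1 h4 h2 h3) (impl_det ?_) le_rfl)).mono
            ?_
          · simp [nonempty, Store.top, Store.get, hl]
          · intro k; cases k <;> simp [Store.get, Op.ap, hl, hR']
          · simp [hR']
      · intro k; cases k <;> simp [Store.get, Op.ap, hi, encI]
      · simp
      · rw [hS]
        congr 1
        refine Store.get_injective fun k => ?_
        cases k <;> simp [Store.get, List.replicate_succ']
      · rw [hS, List.length_cons, add_one_mul]
        simp only [encI, List.length_cons, List.length_append]
        omega
    | false =>
      obtain ⟨x, y, lu, hxy, hlu, hp⟩ := ih (k + 1) R false { s with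
        inp := encI (k + 1) qs ++ (encM ψ ++ r), inq := (.ex :: .var :: dg k).reverse ++ s.inq,
        lastU := [] } hf h1 h2 h3 h4 rfl rfl
      refine ⟨x, y, lu, by simpa [encQ, qL] using hxy, hlu, ?_⟩
      refine impl_loop_det hc (impl_ite_neg ?_ (impl_ite_pos ?_ (impl_seq_det (s1 := { s with
          inp := .all :: .var :: (dg k ++ .imp :: (encI (k + 1) qs ++ (encM ψ ++ r))) })
        (impl_det ?_) (impl_ite_pos ?_ (impl_seq_det (s1 := { s with
          inp := .var :: (dg k ++ .imp :: (encI (k + 1) qs ++ (encM ψ ++ r))),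
          inq := .ex :: s.inq, lastU := [] }) (impl_det ?_)
          (impl_seq_det (impl_copyVar (by rfl) ?_) (impl_det ?_) le_rfl) le_rfl))
        le_rfl))) (hp.congr ?_) ?_
      · simp [Store.top, Store.get, hi, encI]
      · simp [Store.top, Store.get, hi, encI]
      · intro k; cases k <;> simp [Store.get, Op.ap, hi, encI]
      · simp [Store.top, Store.get]
      · intro k; cases k <;> simp [Store.get, Op.ap, hl]
        split_ifs <;> simp
      · simp [isBit]
      · intro k; cases k <;> simp [Store.get, Op.ap]
      · simp [nblk]
      · rw [show nblk l (false :: qs) = nblk false qs from rfl, List.length_cons, add_one_mul]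
        simp only [encI, List.length_cons, List.length_append]
        omega

/-- The nondeterministic decision procedure for satisfiability.  From `8 * L` marks, where `L` is
    the
length of the input, `rewrite` computes the bound for the largest domain element `m`; this `m` is
guessed, and the formula is evaluated for all values of the universal variables.  (The factor `8`
comes from three doublings; the small model theorem needs the factor `2`.) -/
def decider : Prog :=
  .seq (xfer .inp (fun _ => True) fun k =>
      if k = .inq then some id else if k = .rul then some fun _ => .mark else none)
    (.seq (mv .inq .inp) (.seq dbl (.seq dbl (.seq dbl
      (.seq (det fun _ k => if k = .flag then .push .mark else .keep)
        (.seq rewrite (.seq (mv .inp .inq) (.seq (mv .inq .inp)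
          (.seq (drop .lastU fun _ => True) (.seq guessSize
            (.seq (det fun _ k => if k = .flag then .push .mark else .keep) leaves)))))))))))

theorem two_mul_length_le_encI (k : ℕ) (qs : List Bool) :
    2 * qs.length ≤ (encI k qs).length := by
  induction qs generalizing k with
  | nil => simp
  | cons q qs ih =>
    have := ih (k + 1)
    cases q <;> simp only [encI, List.length_cons, List.length_append] <;> omega

theorem length_encQ_le (k : ℕ) (qs : List Bool) : (encQ k qs).length ≤ (encI k qs).length := by
  induction qs generalizing k with
  | nil => simp [encQ]
  | cons q qs ih =>
    have := ih (k + 1)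
    cases q <;> simp only [encI, encQ, List.length_cons, List.length_append] <;> omega

theorem dgs_zero (m u : ℕ) : dgs m u 0 = .replicate u 0 := by
  induction u with
  | zero => rfl
  | succ u ih => simp [dgs, ih, List.replicate_succ]

theorem chunks_replicate (m u : ℕ) : Chunks m (.replicate u .sep) (.replicate u 0) := by
  induction u with
  | zero => rfl
  | succ u ih => exact ⟨0, _, by omega, by simp [List.replicate_succ], ih⟩

/-- A bound for the size of the log for formulas of length `L` with `u` universal variables and
domains of size at most `S + 1`. -/
def logBound (L S u : ℕ) : ℕ := (S + 1) ^ u * (L * (2 * S + 6) + 1) + S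

theorem impl_leaves {qs : List Bool} {ψ : Mat} {r : List Sym} {S L m u : ℕ} {s : Store}
    (hi : s.inp = encQ 0 qs ++ (encM ψ ++ r)) (hψ : ψ.Below qs.length) (hr : Stops r)
    (hu : u = qs.count true) (hL : s.inp.length ≤ L) (hm : m ≤ S) (hs : Idle m s)
    (hc : Chunks m s.cnt (.replicate u 0)) (hf : s.flag = [.mark]) (hl : s.log = []) :
    ∃ R, Impl leaves s ((S + 1) ^ u * ((L + 1) * (450 * (logBound L S u + 1))) + 1) R ∧
      (R.Nonempty ↔ ∃ es ∈ leavesC m u qs ψ 0 ((m + 1) ^ u), ClashFree es) := by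
  have hpos : 1 ≤ (m + 1) ^ u := Nat.one_le_pow _ _ (by omega)
  have hpos' : 1 ≤ (S + 1) ^ u := Nat.one_le_pow _ _ (by omega)
  have hmS : (m + 1) ^ u ≤ (S + 1) ^ u := Nat.pow_le_pow_left (by omega) u
  obtain ⟨d, hd⟩ : ∃ d, (m + 1) ^ u = d + 1 := ⟨(m + 1) ^ u - 1, by omega⟩
  have h1 : s.inp.length * (2 * m + 6) ≤ L * (2 * S + 6) := Nat.mul_le_mul hL (by omega)
  have h2 : (d + 1) * (s.inp.length * (2 * m + 6) + 1) ≤ (S + 1) ^ u * (L * (2 * S + 6) + 1) :=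
    Nat.mul_le_mul (hd ▸ hmS) (by omega)
  have h3 : s.inp.length * (m + 1) ≤ logBound L S u := by
    calc s.inp.length * (m + 1) ≤ L * (2 * S + 6) := Nat.mul_le_mul hL (by omega)
      _ ≤ 1 * (L * (2 * S + 6) + 1) := by omega
      _ ≤ (S + 1) ^ u * (L * (2 * S + 6) + 1) := Nat.mul_le_mul_right _ hpos'
      _ ≤ _ := Nat.le_add_right _ _
  obtain ⟨sf, hsf⟩ := claims_leaves (B := logBound L S u) hi hψ hr hu
    (hm.trans (Nat.le_add_left _ _)) h3 d 0 s (by omega) rfl hs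
    (by rwa [dgs_zero, List.reverse_replicate]) hf
  have hp := hsf.2 [] clashFree_nil (by
    rw [encL_nil, List.length_nil, Nat.zero_add]
    exact h2.trans (Nat.le_add_right _ _))
  have hs' : ({ s with log := encL [] } : Store) = s := by
    refine Store.get_injective fun k => ?_
    cases k <;> simp [Store.get, hl]
  rw [hs'] at hp
  refine ⟨_, hp.mono ?_, ?_⟩
  · have h4 : (s.inp.length + 1) * (450 * (logBound L S u + 1)) ≤
        (L + 1) * (450 * (logBound L S u + 1)) := Nat.mul_le_mul_right _ (by omega)
    exact Nat.add_le_add_right (Nat.mul_le_mul (hd ▸ hmS) h4) 1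
  · rw [hd]
    constructor
    · rintro ⟨s', _, ⟨⟨es, hes, rfl⟩, h⟩, -⟩
      exact ⟨es, hes, by simpa using h⟩
    · rintro ⟨es, hes, h⟩
      exact ⟨_, _, ⟨⟨es, hes, rfl⟩, by simpa using h⟩, rfl⟩

/-- The runs of `decider` succeed if the claims for some domain `{0, …, m}` do not clash. -/
theorem impl_decider {qs : List Bool} {ψ : Mat} {r : List Sym} {S L u : ℕ} {inp : List Sym}
    (hi : inp = encI 0 qs ++ (encM ψ ++ r)) (hψ : ψ.Below qs.length) (hr : Stops r)
    (hu : u = qs.count true) (hL : inp.length = L) (hS : S = tower (nblk false qs) (8 * L)) :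
    ∃ R, Impl decider { inp := inp }
        ((S + 1) ^ u * ((L + 1) * (450 * (logBound L S u + 1))) + (L + 1) * (30 * S + 150) + 6 * S)
          R ∧
      (R.Nonempty ↔ ∃ m ≤ S, ∃ es ∈ leavesC m u qs ψ 0 ((m + 1) ^ u), ClashFree es) := by
  have hq : qs.length ≤ L := by
    have := two_mul_length_le_encI 0 qs
    rw [← hL, hi, List.length_append]; omega
  have hq' : (encI 0 qs).length ≤ L := by rw [← hL, hi, List.length_append]; omega
  have hL' : (encQ 0 qs ++ (encM ψ ++ r)).length ≤ L := by
    have := length_encQ_le 0 qs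
    rw [← hL, hi]
    simp only [List.length_append]; omega
  set inp' := encQ 0 qs ++ (encM ψ ++ r) with hinp'
  -- the store before the size of the domain is guessed
  let s0 (m : ℕ) : Store := {
    inp := inp', rul := .replicate m .mark, cnt := .replicate u .sep }
  have hlv : ∀ m, ∃ R, m ≤ S → Impl leaves { s0 m with flag := [.mark] }
      ((S + 1) ^ u * ((L + 1) * (450 * (logBound L S u + 1))) + 1) R ∧
      (R.Nonempty ↔ ∃ es ∈ leavesC m u qs ψ 0 ((m + 1) ^ u), ClashFree es) := by
    intro m
    by_cases hm : m ≤ S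
    · obtain ⟨R, hR⟩ := impl_leaves (s := { s0 m with flag := [.mark] }) hinp' hψ hr hu hL' hm
        ⟨rfl, rfl, rfl, rfl, rfl, rfl, rfl, rfl, rfl, rfl, rfl, rfl⟩ (chunks_replicate m u) rfl rfl
      exact ⟨R, fun _ => hR⟩
    · exact ⟨∅, fun h => (hm h).elim⟩
  choose R hR using hlv
  obtain ⟨x, y, lu, hxy, hlu, hrw⟩ := impl_rewrite ψ r qs 0 (8 * L) false {
    inp := inp, rul := .replicate (8 * L) .mark, flag := [.mark] } rfl rfl rfl rfl rfl rfl hi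
  rw [← hS, ← hu] at hrw
  have hxl : x.length + y.length ≤ L := by
    have := congrArg List.length hxy
    simp only [List.length_append, List.length_reverse] at this
    rw [hinp'] at hL'
    simp only [List.length_append] at hL'
    simpa [this] using hL'
  refine ⟨{s' | ∃ m, m ≤ S ∧ s' ∈ R m}, impl_seq_det (s1 := {
      inq := inp.reverse, rul := .replicate L .mark }) (t1 := 3 * L + 1)
    ((impl_xfer inp [] (by simp [Store.get]) (by simp) (by simp) ?_).mono (by omega))
    (impl_seq_det (s1 := { inp := inp, rul := .replicate L .mark }) (t1 := 3 * L + 1)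
      (impl_mv L (by simp [Store.get, hL]) ?_)
      (impl_seq_det (impl_dbl L rfl rfl rfl) (impl_seq_det (impl_dbl (2 * L) rfl rfl rfl)
        (impl_seq_det (impl_dbl (2 * (2 * L)) rfl rfl rfl) (impl_seq_det (s1 := {
            inp := inp, rul := .replicate (8 * L) .mark, flag := [.mark] }) (impl_det ?_)
          (impl_seq_det hrw (impl_seq_det (s1 := { s0 S with
              inp := [], inq := y.reverse ++ x, lastU := lu }) (t1 := 3 * L + 1)
              ((impl_mv y.length (by simp [Store.get]) ?_).mono (by omega))
            (impl_seq_det (s1 := { s0 S with lastU := lu }) (t1 := 3 * L + 1)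
              ((impl_mv (x.length + y.length) ?_ ?_).mono (by omega))
              (impl_seq_det (s1 := s0 S) (t1 := 4) ((impl_xfer lu [] (by simp [Store.get]) (by simp)
                  (by simp) ?_).mono (by omega))
                (impl_seq_indexed (impl_guessSize S rfl rfl) fun m hm =>
                  impl_seq_det (s1 := { s0 m with flag := [.mark] }) (impl_det ?_) (hR m hm).1
                    le_rfl)
                le_rfl) le_rfl) le_rfl) le_rfl) le_rfl) le_rfl) le_rfl) le_rfl) le_rfl) ?_, ?_⟩
  · intro k; cases k <;> simp [Store.get, List.map_const', hL]
  · intro k; cases k <;> simp [Store.get]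
  · intro k; cases k <;> simp [Store.get, Op.ap]
    omega
  · intro k; cases k <;> simp [Store.get, s0]
  · simp [Store.get, add_comm]
  · intro k; cases k <;> simp [Store.get, s0]
    simpa using hxy.symm
  · intro k; cases k <;> simp [Store.get, s0]
  · intro k; cases k <;> simp [Store.get, s0, Op.ap]
  · have h1 : qs.length * (30 * S + 22) ≤ L * (30 * S + 22) := Nat.mul_le_mul_right _ hq
    nlinarith
  · constructor
    · rintro ⟨s', m, hm, h⟩
      exact ⟨m, hm, ((hR m hm).2.1 ⟨s', h⟩)⟩
    · rintro ⟨m, hm, h⟩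
      obtain ⟨s', h'⟩ := (hR m hm).2.2 h
      exact ⟨s', m, hm, h'⟩

/-! ### Claims as interpretations -/

/-- The entry `e` agrees with the function `F` if each of its `val` bits is the value of `F` at what
comes before. -/
def Cons (F : List Sym → Prop) (e : List Sym) : Prop :=
  ∀ p b r, e = p ++ .val b :: r → (F p ↔ b = true)

theorem Cons.not_clash {F : List Sym → Prop} {e e' : List Sym} (h : Cons F e) (h' : Cons F e') :
    ¬ Clash e e' := by
  rintro ⟨p, a, b, r, r', hab, h1, h2⟩
  exact hab (Bool.eq_iff_iff.2 ((h p a r h1).symm.trans (h' p b r' h2)))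

theorem Clash.symm {e e' : List Sym} (h : Clash e e') : Clash e' e := by
  obtain ⟨p, a, b, r, r', hab, h1, h2⟩ := h
  exact ⟨p, b, a, r', r, hab.symm, h2, h1⟩

/-- A set of entries that do not clash is the graph of a partial function on bit strings. -/
theorem exists_cons {X : Set (List Sym)} (h : ∀ e ∈ X, ∀ e' ∈ X, ¬ Clash e e') :
    ∃ F, ∀ e ∈ X, Cons F e := by
  refine ⟨fun p => ∃ e ∈ X, ∃ r, e = p ++ .val true :: r, ?_⟩
  rintro e he p b r rfl
  constructor
  · rintro ⟨e', he', r', rfl⟩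
    by_contra hb
    exact h _ he _ he' ⟨p, b, true, r, r', hb, rfl, rfl⟩
  · rintro rfl
    exact ⟨_, he, r, rfl⟩

theorem clashFree_iff {es : List (List Sym)} :
    ClashFree es ↔ (∀ e ∈ es, Sym.fin ∉ e) ∧ ∃ F, ∀ e ∈ es, Cons F e := by
  refine and_congr_right fun _ => ⟨fun h => exists_cons (X := {e | e ∈ es}) fun e he e' he' => ?_,
    ?_⟩
  · have : Std.Symm fun e e' : List Sym => ¬ Clash e' e := ⟨fun _ _ h1 h2 => h1 h2.symm⟩
    refine List.Pairwise.forall_of_forall (R := fun e e' => ¬ Clash e' e) (fun e _ => ?_) h he' he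
    rintro ⟨p, a, b, r, r', hab, h1, h2⟩
    rw [h1] at h2
    simp at h2
    exact hab h2.1
  · rintro ⟨F, hF⟩
    exact List.pairwise_of_forall_mem_list fun e he e' he' => (hF e' he').not_clash (hF e he)

/-- The value of a term. -/
def evT {α : Type} (cI : ℕ → α) (a : ℕ → α) : Tm → α
  | .var i => a i
  | .con c => cI c

/-- The truth of a formula. -/
def evM {α : Type} (cI : ℕ → α) (rI : ℕ → List α → Prop) (a : ℕ → α) : Mat → Prop
  | .fls => False
  | .eq t u => evT cI a t = evT cI a u
  | .rel P ts => rI P (ts.map (evT cI a))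
  | .imp φ ψ => evM cI rI a φ → evM cI rI a ψ

/-- The truth of a property of lists under a quantifier prefix, with quantifiers over the set
`D`. -/
def qsat {α : Type} (D : Set α) : List Bool → (List α → Prop) → Prop
  | [], Φ => Φ []
  | true :: qs, Φ => ∀ x ∈ D, qsat D qs fun l => Φ (x :: l)
  | false :: qs, Φ => ∃ x ∈ D, qsat D qs fun l => Φ (x :: l)

theorem clash_conE {m c c' j j' : ℕ} (hj : j ≤ m) (hj' : j' ≤ m) :
    Clash (conE m c j) (conE m c' j') ↔ c = c' ∧ j ≠ j' := by
  have := clash_keyed (p := .con :: dg c) (q := .con :: dg c') (v := un m j) (v' := un m j')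
    (by simp [val_notMem_dg]) (by simp [val_notMem_dg]) (by simp [length_un, hj, hj'])
  rw [conE, conE, ← List.cons_append, ← List.cons_append, this]
  simp only [List.cons.injEq, true_and, dg_injective.eq_iff]
  exact and_congr_right fun _ => not_congr ⟨un_injective, fun h => h ▸ rfl⟩

/-- The part of `predE` before the truth value. -/
def predK (m P : ℕ) (js : List ℕ) : List Sym :=
  .pred :: (dg P ++ js.flatMap fun j => .sep :: (un m j).map .key)

theorem predE_eq (m P : ℕ) (js : List ℕ) (g : Bool) : predE m P js g = predK m P js ++ [.val g] :=
    by
  simp [predE, predK]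

theorem predK_injective {m P P' : ℕ} {js js' : List ℕ} (hj : ∀ j ∈ js, j ≤ m)
    (hj' : ∀ j ∈ js', j ≤ m) (h : predK m P js = predK m P' js') : P = P' ∧ js = js' := by
  classical
  have htake : ∀ (P : ℕ) (js : List ℕ),
      (dg P ++ js.flatMap fun j => Sym.sep :: (un m j).map .key).takeWhile
        (fun x => decide (isBit x)) = dg P := by
    intro P js
    rw [List.takeWhile_append_of_pos fun x hx => by simpa using isBit_of_mem_dg hx]
    cases js <;> simp [isBit]
  simp only [predK, List.cons.injEq, true_and] at h
  have h1 : dg P = dg P' := by rw [← htake P js, h, htake]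
  refine ⟨dg_injective h1, ?_⟩
  rw [h1, List.append_cancel_left_eq] at h
  clear h1 htake
  induction js generalizing js' with
  | nil => cases js' <;> simp_all
  | cons j js ih =>
    cases js' with
    | nil => simp at h
    | cons j' js' =>
      simp only [List.flatMap_cons, List.cons_append, List.cons.injEq, true_and] at h
      have h0 := hj j (by simp)
      have h0' := hj' j' (by simp)
      obtain ⟨h1, h2⟩ := List.append_inj h (by simp [length_un h0, length_un h0'])
      rw [ih (fun i hi => hj i (by simp [hi])) (fun i hi => hj' i (by simp [hi])) h2,
        un_injective (List.map_injective_iff.2 (fun x y h => by simpa using h) h1)]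

theorem val_notMem_predK (m P : ℕ) (js : List ℕ) (b : Bool) : Sym.val b ∉ predK m P js := by
  simp [predK, val_notMem_dg]

/-! From claims to an interpretation. -/

section Sound

variable {m : ℕ} {F : List Sym → Prop}

open scoped Classical in
/-- The interpretation of the constant symbols that agrees with the claims. -/
noncomputable def conI (m : ℕ) (F : List Sym → Prop) (c : ℕ) : ℕ :=
  if h : ∃ j ≤ m, Cons F (conE m c j) then h.choose else 0

theorem conI_le (c : ℕ) : conI m F c ≤ m := by
  unfold conI
  split_ifs with h
  · exact h.choose_spec.1
  · exact Nat.zero_le _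

theorem conI_eq {c j : ℕ} (hj : j ≤ m) (h : Cons F (conE m c j)) : conI m F c = j := by
  have hex : ∃ j ≤ m, Cons F (conE m c j) := ⟨j, hj, h⟩
  unfold conI
  rw [dif_pos hex]
  by_contra hne
  exact hex.choose_spec.2.not_clash h ((clash_conE hex.choose_spec.1 hj).2 ⟨rfl, hne⟩)

theorem eq_evT {a : ℕ → ℕ} {t : Tm} {y : ℕ × List (List Sym)} (hy : y ∈ termC m a t)
    (h : ∀ e ∈ y.2, Cons F e) : y.1 = evT (conI m F) a t := by
  cases t with
  | var i => obtain rfl : y = (a i, []) := hy; rfl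
  | con c =>
    obtain ⟨h1, h2⟩ := hy
    exact (conI_eq h1 (h _ (by simp [h2]))).symm

theorem eq_map_evT {a : ℕ → ℕ} {ts : List Tm} {y : List ℕ × List (List Sym)}
    (hy : y ∈ termsC m a ts) (h : ∀ e ∈ y.2, Cons F e) : y.1 = ts.map (evT (conI m F) a) := by
  induction ts generalizing y with
  | nil => obtain rfl : y = ([], []) := hy; rfl
  | cons t ts ih =>
    obtain ⟨y, hy, z, hz, rfl⟩ := hy
    simp only [List.mem_append] at h
    rw [List.map_cons, ← eq_evT hy fun e he => h e (.inr he), ← ih hz fun e he => h e (.inl he)]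

theorem evM_of_mem_matC {a : ℕ → ℕ} {φ : Mat} {g : Bool} {es : List (List Sym)}
    (hes : es ∈ matC m a φ g) (h : ∀ e ∈ es, Cons F e) :
    evM (conI m F) (fun P js => F (predK m P js)) a φ ↔ g = true := by
  induction φ generalizing g es with
  | fls => simp [evM, hes.1]
  | eq t u =>
    obtain ⟨y, hy, z, hz, hg, rfl⟩ := hes
    simp only [List.mem_append] at h
    rw [evM, ← eq_evT hy fun e he => h e (.inr he), ← eq_evT hz fun e he => h e (.inl he), hg]
  | rel P ts =>
    obtain ⟨y, hy, rfl⟩ := hes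
    rw [evM, ← eq_map_evT hy fun e he => h e (by simp [he])]
    exact h _ (List.mem_cons_self ..) _ g [] (predE_eq ..)
  | imp φ ψ ih1 ih2 =>
    obtain ⟨x, y, hg, es1, h1, es2, h2, rfl⟩ := hes
    simp only [List.mem_append] at h
    rw [evM, ih1 h1 fun e he => h e (.inr he), ih2 h2 fun e he => h e (.inl he), ← hg]
    cases x <;> cases y <;> simp

/-- The universal variables can have any values, and as all transcripts agree with `F`, the value of
an existential variable depends on the preceding values only. -/
theorem qsat_of_transcripts {qs : List Bool} {p : List Sym} {Φ : List ℕ → Prop}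
    (h : ∀ vs : List ℕ, vs.length = qs.count true → (∀ v ∈ vs, v ≤ m) →
      ∃ js ∈ vals m qs vs, Cons F (p ++ tran m qs js) ∧ Φ js) : qsat {j | j ≤ m} qs Φ := by
  induction qs generalizing p Φ with
  | nil =>
    obtain ⟨js, hjs, -, hΦ⟩ := h [] rfl (by simp)
    obtain rfl : js = [] := hjs
    exact hΦ
  | cons q qs ih =>
    cases q with
    | true =>
      intro x hx
      refine ih (p := p ++ (un m x).map .key) fun vs hl hv => ?_
      obtain ⟨_, ⟨js, hjs, rfl⟩, h1, h2⟩ := h (x :: vs) (by simp [hl])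
        (by simpa using ⟨hx, hv⟩)
      exact ⟨js, hjs, by simpa [tran] using h1, h2⟩
    | false =>
      have hvl : ∀ v ∈ List.replicate (qs.count true) 0, v ≤ m := by simp
      obtain ⟨_, ⟨j, hj, js, hjs, rfl⟩, h1, -⟩ := h (.replicate (qs.count true) 0) (by simp) hvl
      refine ⟨j, hj, ih (p := p ++ (un m j).map .val) fun vs hl hv => ?_⟩
      obtain ⟨_, ⟨j', hj', js', hjs', rfl⟩, h1', h2'⟩ := h vs (by simp [hl]) hv
      have hjj : j' = j := by
        by_contra hne
        refine h1'.not_clash h1 (clash_append_left.2 ?_)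
        have := (clash_keyed (p := []) (q := []) (v := un m j') (v' := un m j) (by simp) (by simp)
          (by simp [length_un, hj, hj'])).2 ⟨rfl, fun h => hne (un_injective h)⟩
        obtain ⟨z, a, b, r, r', hab, e1, e2⟩ := this
        simp only [List.nil_append] at e1 e2
        refine ⟨z, a, b, r ++ tran m qs js', r' ++ tran m qs js, hab, ?_, ?_⟩
        · simp [tran, e1]
        · simp [tran, e2]
      subst hjj
      exact ⟨js', hjs', by simpa [tran] using h1', h2'⟩

end Sound

/-! From an interpretation to claims. -/

theorem clash_key_append {p p' : List Bool} {e e' : List Sym} (hl : p.length = p'.length)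
    (h : Clash (p.map .key ++ e) (p'.map .key ++ e')) : p = p' ∧ Clash e e' := by
  induction p generalizing p' with
  | nil => cases p' <;> simp_all
  | cons b p ih =>
    cases p' with
    | nil => simp at hl
    | cons b' p' =>
      by_cases hb : b = b'
      · subst hb
        have := ih (p' := p') (by simpa using hl) ((clash_append_left (p := [.key b])).1 h)
        simpa using this
      · obtain ⟨a, b, h1, -⟩ := (clash_iff_of_head (by simp [hb])).1 h
        simp at h1

/-- The plays that follow a winning strategy for the existential quantifiers. -/
theorem exists_transcripts {m : ℕ} {qs : List Bool} {Φ : List ℕ → Prop}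
    (h : qsat {j | j ≤ m} qs Φ) : ∃ T : Set (List ℕ),
      (∀ js ∈ T, ∀ js' ∈ T, ¬ Clash (tran m qs js) (tran m qs js')) ∧
      ∀ vs : List ℕ, vs.length = qs.count true → (∀ v ∈ vs, v ≤ m) →
        ∃ js ∈ vals m qs vs, js ∈ T ∧ Φ js := by
  induction qs generalizing Φ with
  | nil =>
    refine ⟨{[]}, ?_, fun vs _ _ => ⟨[], rfl, rfl, h⟩⟩
    rintro js hjs js' hjs' ⟨p, a, b, r, r', -, h1, -⟩
    simp [tran] at h1
  | cons q qs ih =>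
    cases q with
    | true =>
      have h' : ∀ x, ∃ T : Set (List ℕ), x ≤ m →
          (∀ js ∈ T, ∀ js' ∈ T, ¬ Clash (tran m qs js) (tran m qs js')) ∧
          ∀ vs : List ℕ, vs.length = qs.count true → (∀ v ∈ vs, v ≤ m) →
            ∃ js ∈ vals m qs vs, js ∈ T ∧ Φ (x :: js) := by
        intro x
        by_cases hx : x ≤ m
        · obtain ⟨T, hT⟩ := ih (h x hx)
          exact ⟨T, fun _ => hT⟩
        · exact ⟨∅, fun hx' => (hx hx').elim⟩
      choose T hT using h'
      refine ⟨{js | ∃ x ≤ m, ∃ js' ∈ T x, js = x :: js'}, ?_, ?_⟩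
      · rintro _ ⟨x, hx, js, hjs, rfl⟩ _ ⟨x', hx', js', hjs', rfl⟩ hcl
        obtain ⟨h1, h2⟩ := clash_key_append (p := un m x) (p' := un m x')
          (by simp [length_un, hx, hx']) (by simpa [tran] using hcl)
        obtain rfl := un_injective h1
        exact (hT x hx).1 js hjs js' hjs' h2
      · intro vs hl hv
        obtain _ | ⟨v, vs⟩ := vs
        · simp at hl
        have hvm := hv v (by simp)
        obtain ⟨js, h1, h2, h3⟩ := (hT v hvm).2 vs (by simpa using hl)
          fun v' hv' => hv v' (by simp [hv'])
        exact ⟨v :: js, ⟨js, h1, rfl⟩, ⟨v, hvm, js, h2, rfl⟩, h3⟩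
    | false =>
      obtain ⟨x, hx, h⟩ := h
      obtain ⟨T, h1, h2⟩ := ih h
      refine ⟨{js | ∃ js' ∈ T, js = x :: js'}, ?_, ?_⟩
      · rintro _ ⟨js, hjs, rfl⟩ _ ⟨js', hjs', rfl⟩ hcl
        exact h1 js hjs js' hjs' (clash_append_left.1 hcl)
      · intro vs hl hv
        obtain ⟨js, h3, h4, h5⟩ := h2 vs (by simpa using hl) hv
        exact ⟨x :: js, ⟨x, hx, js, h3, rfl⟩, ⟨js, h4, rfl⟩, h5⟩

section Complete

variable {m : ℕ} (cI : ℕ → ℕ) (rI : ℕ → List ℕ → Prop)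

open scoped Classical in
/-- All claims about the constant symbols and predicate symbols that are true in an
interpretation. -/
noncomputable def facts (m : ℕ) : Set (List Sym) :=
  {e | (∃ c, e = conE m c (cI c)) ∨
    ∃ P js, (∀ j ∈ js, j ≤ m) ∧ e = predE m P js (decide (rI P js))}

variable {cI rI}

theorem not_clash_facts (hc : ∀ c, cI c ≤ m) {e e' : List Sym} (he : e ∈ facts cI rI m)
    (he' : e' ∈ facts cI rI m) : ¬ Clash e e' := by
  classical
  intro h
  rcases he with ⟨c, rfl⟩ | ⟨P, js, hjs, rfl⟩ <;> rcases he' with ⟨c', rfl⟩ | ⟨P', js', hjs', rfl⟩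
  · obtain ⟨rfl, h⟩ := (clash_conE (hc c) (hc c')).1 h
    exact h rfl
  · obtain ⟨a, b, h1, -⟩ := (clash_iff_of_head (by simp [conE, predE])).1 h
    simp [conE] at h1
  · obtain ⟨a, b, h1, -⟩ := (clash_iff_of_head (by simp [conE, predE])).1 h
    simp [predE] at h1
  · rw [predE_eq, predE_eq] at h
    obtain ⟨h1, h2⟩ := (clash_keyed (v := [decide (rI P js)]) (v' := [decide (rI P' js')])
      (val_notMem_predK m P js)
      (val_notMem_predK m P' js') rfl).1 h
    obtain ⟨rfl, rfl⟩ := predK_injective hjs hjs' h1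
    exact h2 rfl

theorem exists_termC (hc : ∀ c, cI c ≤ m) (a : ℕ → ℕ) (t : Tm) :
    ∃ y ∈ termC m a t, y.1 = evT cI a t ∧ ∀ e ∈ y.2, e ∈ facts cI rI m := by
  cases t with
  | var i => exact ⟨_, rfl, rfl, by simp⟩
  | con c =>
    refine ⟨(cI c, [conE m c (cI c)]), ⟨hc c, rfl⟩, rfl, ?_⟩
    intro e he
    exact .inl ⟨c, by simpa using he⟩

theorem exists_termsC (hc : ∀ c, cI c ≤ m) (a : ℕ → ℕ) (ts : List Tm) :
    ∃ y ∈ termsC m a ts, y.1 = ts.map (evT cI a) ∧ ∀ e ∈ y.2, e ∈ facts cI rI m := by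
  induction ts with
  | nil => exact ⟨_, rfl, rfl, by simp⟩
  | cons t ts ih =>
    obtain ⟨z, hz, h1, h2⟩ := ih
    obtain ⟨y, hy, h3, h4⟩ := exists_termC hc a t
    refine ⟨_, ⟨y, hy, z, hz, rfl⟩, by simp [h1, h3], ?_⟩
    intro e he
    rcases List.mem_append.1 he with h | h
    · exact h2 e h
    · exact h4 e h

theorem exists_matC (hc : ∀ c, cI c ≤ m) {a : ℕ → ℕ} (ha : ∀ i, a i ≤ m) (φ : Mat) (g : Bool)
    (hg : evM cI rI a φ ↔ g = true) : ∃ es ∈ matC m a φ g, ∀ e ∈ es, e ∈ facts cI rI m := by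
  classical
  induction φ generalizing g with
  | fls => exact ⟨[], ⟨by simpa [evM] using hg, rfl⟩, by simp⟩
  | eq t u =>
    obtain ⟨y, hy, h1, h2⟩ := exists_termC (rI := rI) hc a t
    obtain ⟨z, hz, h3, h4⟩ := exists_termC (rI := rI) hc a u
    refine ⟨_, ⟨y, hy, z, hz, ?_, rfl⟩, ?_⟩
    · rw [h1, h3, ← hg, evM]
    · intro e he
      rcases List.mem_append.1 he with h | h
      · exact h4 e h
      · exact h2 e h
  | rel P ts =>
    obtain ⟨y, hy, h1, h2⟩ := exists_termsC (rI := rI) hc a ts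
    refine ⟨_, ⟨y, hy, rfl⟩, ?_⟩
    intro e he
    rcases List.mem_cons.1 he with rfl | h
    · refine .inr ⟨P, y.1, ?_, ?_⟩
      · rw [h1]
        intro j hj
        obtain ⟨t, -, rfl⟩ := List.mem_map.1 hj
        cases t with
        | var i => exact ha i
        | con c => exact hc c
      · congr 1
        rw [Bool.eq_iff_iff, ← hg, evM, h1]
        simp
    · exact h2 e h
  | imp φ ψ ih1 ih2 =>
    obtain ⟨es1, h1, h2⟩ := ih1 (decide (evM cI rI a φ)) (by simp)
    obtain ⟨es2, h3, h4⟩ := ih2 (decide (evM cI rI a ψ)) (by simp)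
    refine ⟨_, ⟨_, _, ?_, es1, h1, es2, h3, rfl⟩, ?_⟩
    · rw [Bool.eq_iff_iff, ← hg, evM]
      by_cases h5 : evM cI rI a φ <;> simp [h5]
    · intro e he
      rcases List.mem_append.1 he with h | h
      · exact h4 e h
      · exact h2 e h

end Complete

theorem exists_mem_leavesC {m u : ℕ} {qs : List Bool} {ψ : Mat} {X : Set (List Sym)} (k d : ℕ)
    (h : ∀ i, k ≤ i → i < k + d → ∃ e ∈ leafC m qs ψ (dgs m u i).reverse, ∀ x ∈ e, x ∈ X) :
    ∃ es ∈ leavesC m u qs ψ k d, ∀ x ∈ es, x ∈ X := by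
  induction d generalizing k with
  | zero => exact ⟨[], rfl, by simp⟩
  | succ d ih =>
    obtain ⟨e1, h1, h2⟩ := h k le_rfl (by omega)
    obtain ⟨e2, h3, h4⟩ := ih (k + 1) fun i hi hi' => h i (by omega) (by omega)
    refine ⟨_, ⟨e1, h1, e2, h3, rfl⟩, fun x hx => ?_⟩
    rcases List.mem_append.1 hx with h | h
    · exact h4 x h
    · exact h2 x h

theorem exists_leafC_of_mem {m u : ℕ} {qs : List Bool} {ψ : Mat} {k d : ℕ}
    {es : List (List Sym)} (hes : es ∈ leavesC m u qs ψ k d) {i : ℕ} (hi : k ≤ i)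
    (hi' : i < k + d) : ∃ e ∈ leafC m qs ψ (dgs m u i).reverse, ∀ x ∈ e, x ∈ es := by
  induction d generalizing k es with
  | zero => omega
  | succ d ih =>
    obtain ⟨e1, h1, e2, h2, rfl⟩ := hes
    by_cases hik : i = k
    · subst hik
      exact ⟨e1, h1, fun x hx => List.mem_append_right _ hx⟩
    · obtain ⟨e, h3, h4⟩ := ih h2 (by omega) (by omega)
      exact ⟨e, h3, fun x hx => List.mem_append_left _ (h4 x hx)⟩

/-- Some runs of the decision procedure for the domain `{0, …, m}` succeed if and only if there is
a model with this domain. -/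
theorem exists_leavesC_iff {m u : ℕ} {qs : List Bool} {ψ : Mat} (hu : u = qs.count true) :
    (∃ es ∈ leavesC m u qs ψ 0 ((m + 1) ^ u), ClashFree es) ↔
      ∃ (cI : ℕ → ℕ) (rI : ℕ → List ℕ → Prop), (∀ c, cI c ≤ m) ∧
        qsat {j | j ≤ m} qs fun js => evM cI rI (fun i => js.getD i 0) ψ := by
  constructor
  · rintro ⟨es, hes, hcf⟩
    obtain ⟨-, F, hF⟩ := clashFree_iff.1 hcf
    refine ⟨conI m F, fun P js => F (predK m P js), conI_le,
      qsat_of_transcripts (F := F) (p := []) fun vs hl hv => ?_⟩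
    obtain ⟨k, hk, hkv⟩ := exists_dgs vs.reverse fun v hv' => hv v (by simpa using hv')
    rw [List.length_reverse, hl, ← hu] at hk hkv
    obtain ⟨_, ⟨js, hjs, e, he, rfl⟩, h⟩ := exists_leafC_of_mem hes (Nat.zero_le k) (by omega)
    rw [hkv, List.reverse_reverse] at hjs
    exact ⟨js, hjs, hF _ (h _ (by simp)),
      (evM_of_mem_matC he fun x hx => hF x (h x (by simp [hx]))).2 rfl⟩
  · rintro ⟨cI, rI, hc, hq⟩
    obtain ⟨T, hT, hT'⟩ := exists_transcripts hq
    let X : Set (List Sym) := facts cI rI m ∪ {e | ∃ js ∈ T, e = tran m qs js}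
    have hX : ∀ e ∈ X, ∀ e' ∈ X, ¬ Clash e e' := by
      have hmix : ∀ e ∈ facts cI rI m, ∀ js, ¬ Clash e (tran m qs js) := by
        rintro e he js ⟨p, a, b, r, r', -, h1, h2⟩
        have htr : ∀ x ∈ (tran m qs js).head?, x ≠ .con ∧ x ≠ .pred := by
          intro x hx
          have hmem : ∀ (qs : List Bool) (js : List ℕ), ∀ x ∈ tran m qs js,
              x ≠ Sym.con ∧ x ≠ Sym.pred := by
            intro qs
            induction qs with
            | nil => simp [tran]
            | cons q qs ih =>
              intro js x hx
              cases js with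
              | nil => simp [tran] at hx
              | cons j js =>
                rcases List.mem_append.1 hx with h | h
                · obtain ⟨b, -, rfl⟩ := List.mem_map.1 h
                  cases q <;> simp
                · exact ih js x h
          exact hmem qs js x (List.mem_of_mem_head? hx)
        have hhead : e.head? = some .con ∨ e.head? = some .pred := by
          rcases he with ⟨c, rfl⟩ | ⟨P, js, -, rfl⟩
          · exact .inl rfl
          · exact .inr rfl
        rw [h1] at hhead
        rw [h2] at htr
        cases p with
        | nil => simp at hhead
        | cons z p =>
          have := htr z (by simp)
          simp at hhead
          tauto
      rintro e (he | ⟨js, hjs, rfl⟩) e' (he' | ⟨js', hjs', rfl⟩)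
      · exact not_clash_facts hc he he'
      · exact hmix e he js'
      · exact fun h => hmix e' he' js h.symm
      · exact hT js hjs js' hjs'
    obtain ⟨es, hes, hesX⟩ := exists_mem_leavesC (m := m) (u := u) (qs := qs) (ψ := ψ) (X := X) 0
      ((m + 1) ^ u) fun i _ _ => by
        have hv : ∀ v ∈ (dgs m u i).reverse, v ≤ m := fun v hv =>
          le_of_mem_dgs (List.mem_reverse.1 hv)
        obtain ⟨js, h1, h2, h3⟩ := hT' (dgs m u i).reverse (by simp [length_dgs, hu]) hv
        have hjs := (length_of_mem_vals h1 hv).2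
        obtain ⟨e, h4, h5⟩ := exists_matC (rI := rI) hc (a := fun i => js.getD i 0) (fun i => by
          by_cases hi : i < js.length
          · simpa [List.getD, hi] using hjs _ (List.getElem_mem hi)
          · simp [List.getD, hi]) ψ true (by simpa using h3)
        refine ⟨_, ⟨js, h1, e, h4, rfl⟩, fun x hx => ?_⟩
        rcases List.mem_append.1 hx with h | h
        · exact .inl (h5 x h)
        · exact .inr ⟨js, h2, by simpa using h⟩
    refine ⟨es, hes, clashFree_iff.2 ⟨fun e he => ?_, ?_⟩⟩
    · rcases hesX e he with (⟨c, rfl⟩ | ⟨P, js, -, rfl⟩) | ⟨js, -, rfl⟩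
      · exact fin_notMem_conE
      · exact fin_notMem_predE
      · exact fin_notMem_tran m qs js
    · obtain ⟨F, hF⟩ := exists_cons hX
      exact ⟨F, fun e he => hF e (hesX e he)⟩

/-! ### Small models -/

theorem tower_strictMono (k : ℕ) : StrictMono (tower k) := by
  induction k with
  | zero => exact strictMono_id
  | succ k ih => exact fun x y h => Nat.pow_lt_pow_right (by norm_num) (ih h)

theorem tower_add_le (k x q : ℕ) : tower k x + q ≤ tower k (x + q) := by
  induction q with
  | zero => exact le_rfl
  | succ q ih => exact (Nat.succ_le_succ ih).trans (tower_strictMono k (Nat.lt_succ_self _))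

theorem two_mul_tower_le (k x : ℕ) : 2 * tower (k + 1) x ≤ tower (k + 1) (x + 1) := by
  rw [tower, ← pow_succ']
  exact Nat.pow_le_pow_right (by norm_num) (tower_strictMono k (Nat.lt_succ_self _))

/-- The types of the choices for the existential variables, with respect to `M` atoms and `k`
further blocks of quantifiers. -/
def Ty (M : ℕ) : ℕ → Type
  | 0 => Set (Fin M)
  | k + 1 => Set (Ty M k)

instance finite_ty (M k : ℕ) : Finite (Ty M k) := by
  induction k with
  | zero => exact inferInstanceAs (Finite (Set (Fin M)))
  | succ k ih => exact inferInstanceAs (Finite (Set (Ty M k)))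

theorem card_ty (M k : ℕ) : Nat.card (Ty M k) = tower (k + 1) M := by
  have hset : ∀ (β : Type) [Finite β], Nat.card (Set β) = 2 ^ Nat.card β := by
    intro β _
    have := Fintype.ofFinite β
    classical
    rw [Nat.card_eq_fintype_card, Nat.card_eq_fintype_card, Fintype.card_set]
  induction k with
  | zero => exact (hset (Fin M)).trans (by simp [tower])
  | succ k ih => exact (hset (Ty M k)).trans (by rw [ih]; rfl)

section Game

variable {α : Type} {M : ℕ}

/-- The type of a choice for the existential variables up to some point, given by the function
`τ` that yields the truth values of the atoms with existential variables as soon as all existential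
variables are chosen. -/
def typ : (bl : List (ℕ × ℕ)) → (List α → Set (Fin M)) → Ty M bl.length
  | [], τ => τ []
  | b :: bl, τ => {t | ∃ ys : List α, ys.length = b.2 ∧ t = typ bl fun l => τ (ys ++ l)}

/-- The property `R` under quantifiers over the set `D`: a pair `(p, q)` stands for `p` universal
quantifiers followed by `q` existential quantifiers.  The values of universal and existential
variables are listed separately. -/
def play (D : Set α) : List (ℕ × ℕ) → (List α → List α → Prop) → Prop
  | [], R => R [] []
  | b :: bl, R => ∀ xs : List α, xs.length = b.1 → (∀ x ∈ xs, x ∈ D) →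
      ∃ ys : List α, ys.length = b.2 ∧ (∀ y ∈ ys, y ∈ D) ∧
        play D bl fun X Y => R (xs ++ X) (ys ++ Y)

/-- Choices of the same type can be continued in the same way. -/
theorem play_of_typ_eq (bl : List (ℕ × ℕ)) (τ τ' : List α → Set (Fin M))
    (R R' : List α → List α → Prop)
    (h : ∀ X Y Y', τ Y = τ' Y' → R X Y → R' X Y') (ht : typ bl τ = typ bl τ')
    (hp : play Set.univ bl R) : play Set.univ bl R' := by
  induction bl generalizing τ τ' R R' with
  | nil => exact h [] [] [] ht hp
  | cons b bl ih =>
    intro xs hxs _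
    obtain ⟨ys, hys, -, hp'⟩ := hp xs hxs (by simp)
    have hmem : typ bl (fun l => τ (ys ++ l)) ∈
        ({t | ∃ ys : List α, ys.length = b.2 ∧ t = typ bl fun l => τ' (ys ++ l)} :
          Set (Ty M bl.length)) := by
      exact (Set.ext_iff.1 ht _).1 ⟨ys, hys, rfl⟩
    obtain ⟨ys', hys', he⟩ := hmem
    exact ⟨ys', hys', by simp, ih (fun l => τ (ys ++ l)) (fun l => τ' (ys' ++ l))
      (fun X Y => R (xs ++ X) (ys ++ Y)) _ (fun X Y Y' hY => h _ _ _ hY) he hp'⟩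

/-- The number of elements needed to represent all types. -/
def repr (M : ℕ) : List (ℕ × ℕ) → ℕ
  | [] => 0
  | b :: bl => tower (bl.length + 1) M * (b.2 + repr M bl)

/-- Quantifiers can be restricted to sets that contain a representative of each type.  The
representatives do not depend on the values of the universal variables. -/
theorem exists_representatives (bl : List (ℕ × ℕ)) (τ : List α → Set (Fin M)) :
    ∃ D0 : Finset α, D0.card ≤ repr M bl ∧ ∀ R : List α → List α → Prop,
      (∀ X Y Y', τ Y = τ Y' → R X Y → R X Y') → play Set.univ bl R →
      ∀ D : Set α, ↑D0 ⊆ D → play D bl R := by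
  classical
  induction bl generalizing τ with
  | nil => exact ⟨∅, by simp, fun R _ h D _ => h⟩
  | cons b bl ih =>
    -- a representative for each type
    have hrep : ∀ t : Ty M bl.length, ∃ ys : List α, ys.length ≤ b.2 ∧
        ((∃ ys' : List α, ys'.length = b.2 ∧ t = typ bl fun l => τ (ys' ++ l)) →
          ys.length = b.2 ∧ t = typ bl fun l => τ (ys ++ l)) := by
      intro t
      by_cases h : ∃ ys' : List α, ys'.length = b.2 ∧ t = typ bl fun l => τ (ys' ++ l)
      · obtain ⟨ys, h1, h2⟩ := h
        exact ⟨ys, h1.le, fun _ => ⟨h1, h2⟩⟩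
      · exact ⟨[], by simp, fun h' => (h h').elim⟩
    choose ρ hρ1 hρ2 using hrep
    choose D0 hD1 hD2 using fun t => ih fun l => τ (ρ t ++ l)
    have := Fintype.ofFinite (Ty M bl.length)
    refine ⟨Finset.univ.biUnion fun t => (ρ t).toFinset ∪ D0 t, ?_, ?_⟩
    · refine Finset.card_biUnion_le_card_mul _ _ (b.2 + repr M bl) (fun t _ => ?_) |>.trans ?_
      · exact (Finset.card_union_le _ _).trans
          (Nat.add_le_add ((List.toFinset_card_le _).trans (hρ1 t)) (hD1 t))
      · rw [Finset.card_univ, ← Nat.card_eq_fintype_card, card_ty, repr]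
    · intro R hR hp D hD xs hxs _
      obtain ⟨ys, hys, -, hp'⟩ := hp xs hxs (by simp)
      obtain ⟨h1, h2⟩ := hρ2 (typ bl fun l => τ (ys ++ l)) ⟨ys, hys, rfl⟩
      set t := typ bl fun l => τ (ys ++ l)
      have hsub : ↑((ρ t).toFinset ∪ D0 t) ⊆ D := fun x hx =>
        hD (Finset.mem_coe.2 (Finset.mem_biUnion.2 ⟨t, Finset.mem_univ t, hx⟩))
      refine ⟨ρ t, h1, fun y hy => hsub (by simp [hy]), hD2 t
        (fun X Y => R (xs ++ X) (ρ t ++ Y)) (fun X Y Y' hY => hR _ _ _ hY) ?_ D fun x hx => hsub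
          (by simp at hx ⊢; exact .inr hx)⟩
      exact play_of_typ_eq bl (fun l => τ (ys ++ l)) (fun l => τ (ρ t ++ l))
        (fun X Y => R (xs ++ X) (ys ++ Y)) _ (fun X Y Y' hY => hR _ _ _ hY) h2 hp'

theorem repr_le (M : ℕ) (b : ℕ × ℕ) (bl : List (ℕ × ℕ)) :
    repr M (b :: bl) ≤ tower (bl.length + 1) (M + ((b :: bl).map Prod.snd).sum + bl.length) := by
  induction bl generalizing b with
  | nil =>
    simp only [repr, List.length_nil, tower, List.map_cons, List.map_nil, List.sum_cons,
      List.sum_nil, add_zero, pow_add]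
    exact Nat.mul_le_mul_left _ Nat.lt_two_pow_self.le
  | cons b' bl ih =>
    have h := ih b'
    set A := M + ((b' :: bl).map Prod.snd).sum + bl.length with hA
    have e : M + ((b :: b' :: bl).map Prod.snd).sum + (b' :: bl).length = A + 1 + b.2 := by
      simp [hA]; omega
    have h1 : tower (bl.length + 1) M ≤ tower (bl.length + 1) A :=
      (tower_strictMono _).monotone (by omega)
    have h2 := two_mul_tower_le bl.length A
    have h3 := tower_add_le (bl.length + 1) (A + 1) b.2
    rw [e, repr, List.length_cons, tower, tower]
    calc 2 ^ tower (bl.length + 1) M * (b.2 + repr M (b' :: bl))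
        ≤ 2 ^ tower (bl.length + 1) M * 2 ^ (b.2 + tower (bl.length + 1) A) :=
          Nat.mul_le_mul_left _ ((Nat.add_le_add_left h _).trans Nat.lt_two_pow_self.le)
      _ = 2 ^ (tower (bl.length + 1) M + (b.2 + tower (bl.length + 1) A)) := (pow_add ..).symm
      _ ≤ _ := Nat.pow_le_pow_right (by norm_num) (by omega)

/-! Quantifier prefixes as lists of blocks. -/

/-- The quantifiers of a list of blocks. -/
def quants (bl : List (ℕ × ℕ)) : List Bool :=
  bl.flatMap fun b => .replicate b.1 true ++ .replicate b.2 false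

theorem exists_blocks (qs : List Bool) : ∃ z bl, qs = .replicate z false ++ quants bl ∧
    (∀ b ∈ bl, 1 ≤ b.1) ∧ bl.length = nblk false qs := by
  induction qs with
  | nil => exact ⟨0, [], by simp [quants], by simp, rfl⟩
  | cons q qs ih =>
    obtain ⟨z, bl, rfl, hb, hl⟩ := ih
    cases q with
    | false => exact ⟨z + 1, bl, by simp [List.replicate_succ], hb, hl⟩
    | true =>
      cases z with
      | succ z =>
        refine ⟨0, (1, z + 1) :: bl, by simp [quants, List.replicate_succ], by simpa using hb, ?_⟩
        simpa [nblk, List.replicate_succ] using hl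
      | zero =>
        obtain _ | ⟨⟨p, q⟩, bl⟩ := bl
        · exact ⟨0, [(1, 0)], by simp [quants], by simp, by simp [nblk, quants]⟩
        · have hp : 1 ≤ p := hb (p, q) (by simp)
          obtain ⟨p, rfl⟩ : ∃ p', p = p' + 1 := ⟨p - 1, by omega⟩
          refine ⟨0, (p + 2, q) :: bl, by simp [quants, List.replicate_succ], ?_, ?_⟩
          · intro b hb'
            rcases List.mem_cons.1 hb' with rfl | h
            · simp
            · exact hb b (by simp [h])
          · simpa [nblk, quants, List.replicate_succ] using hl

/-- The values of all variables in the order of the quantifiers. -/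
def merge (d : α) : List Bool → List α → List α → List α
  | [], _, _ => []
  | true :: qs, xs, ys => xs.headD d :: merge d qs xs.tail ys
  | false :: qs, xs, ys => ys.headD d :: merge d qs xs ys.tail

theorem getD_merge_of_univ (d : α) {qs : List Bool} {v : ℕ} (h : qs[v]? ≠ some false)
    (xs ys ys' : List α) : (merge d qs xs ys).getD v d = (merge d qs xs ys').getD v d := by
  induction qs generalizing v xs ys ys' with
  | nil => rfl
  | cons q qs ih =>
    cases v with
    | zero => cases q <;> simp_all [merge]
    | succ v => cases q <;> simpa [merge] using ih (by simpa using h) _ _ _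

theorem getD_merge_of_ex (d : α) {qs : List Bool} {v : ℕ} (h : qs[v]? ≠ some true)
    (xs xs' ys : List α) : (merge d qs xs ys).getD v d = (merge d qs xs' ys).getD v d := by
  induction qs generalizing v xs xs' ys with
  | nil => rfl
  | cons q qs ih =>
    cases v with
    | zero => cases q <;> simp_all [merge]
    | succ v => cases q <;> simpa [merge] using ih (by simpa using h) _ _ _

theorem qsat_append (D : Set α) (qs qs' : List Bool) (Φ : List α → Prop) :
    qsat D (qs ++ qs') Φ ↔ qsat D qs fun l => qsat D qs' fun l' => Φ (l ++ l') := by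
  induction qs generalizing Φ with
  | nil => rfl
  | cons q qs ih => cases q <;> simp [qsat, ih]

theorem qsat_replicate_true (D : Set α) (p : ℕ) (Φ : List α → Prop) :
    qsat D (.replicate p true) Φ ↔ ∀ xs : List α, xs.length = p → (∀ x ∈ xs, x ∈ D) → Φ xs := by
  induction p generalizing Φ with
  | zero =>
    constructor
    · intro h xs hl _
      rwa [List.length_eq_zero_iff.1 hl]
    · exact fun h => h [] rfl (by simp)
  | succ p ih =>
    rw [List.replicate_succ]
    simp only [qsat, ih]
    constructor
    · rintro h (_ | ⟨x, xs⟩) hl hx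
      · simp at hl
      · exact h x (hx x (by simp)) xs (by simpa using hl) fun y hy => hx y (by simp [hy])
    · intro h x hx xs hl hxs
      exact h (x :: xs) (by simp [hl]) (by simpa using ⟨hx, hxs⟩)

theorem qsat_replicate_false (D : Set α) (q : ℕ) (Φ : List α → Prop) :
    qsat D (.replicate q false) Φ ↔ ∃ ys : List α, ys.length = q ∧ (∀ y ∈ ys, y ∈ D) ∧ Φ ys := by
  induction q generalizing Φ with
  | zero =>
    constructor
    · exact fun h => ⟨[], rfl, by simp, h⟩
    · rintro ⟨ys, hl, -, h⟩
      rwa [List.length_eq_zero_iff.1 hl] at h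
  | succ q ih =>
    rw [List.replicate_succ]
    simp only [qsat, ih]
    constructor
    · rintro ⟨y, hy, ys, hl, hys, h⟩
      exact ⟨y :: ys, by simp [hl], by simpa using ⟨hy, hys⟩, h⟩
    · rintro ⟨_ | ⟨y, ys⟩, hl, hys, h⟩
      · simp at hl
      · exact ⟨y, hys y (by simp), ys, by simpa using hl, fun y' hy' => hys y' (by simp [hy']), h⟩

theorem qsat_congr {D : Set α} {qs : List Bool} {Φ Φ' : List α → Prop}
    (h : ∀ l : List α, l.length = qs.length → (∀ x ∈ l, x ∈ D) → (Φ l ↔ Φ' l)) :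
    qsat D qs Φ ↔ qsat D qs Φ' := by
  induction qs generalizing Φ Φ' with
  | nil => exact h [] rfl (by simp)
  | cons q qs ih =>
    have : ∀ x ∈ D, (qsat D qs fun l => Φ (x :: l)) ↔ qsat D qs fun l => Φ' (x :: l) :=
      fun x hx => ih fun l hl hl' => h (x :: l) (by simp [hl]) (by simpa using ⟨hx, hl'⟩)
    cases q
    · exact exists_congr fun x => and_congr_right fun hx => this x hx
    · exact forall₂_congr this

theorem merge_append (d : α) (b : ℕ × ℕ) (qs : List Bool) (xs ys X Y : List α)
    (hx : xs.length = b.1) (hy : ys.length = b.2) :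
    merge d ((.replicate b.1 true ++ .replicate b.2 false) ++ qs) (xs ++ X) (ys ++ Y) =
      xs ++ (ys ++ merge d qs X Y) := by
  obtain ⟨p, q⟩ := b
  simp only at hx hy ⊢
  subst hx hy
  induction xs with
  | nil =>
    induction ys with
    | nil => simp
    | cons y ys ih =>
      simp only [List.length_cons, List.replicate_succ, List.length_nil, List.replicate_zero,
        List.nil_append, List.cons_append, merge, List.headD_cons, List.tail_cons] at ih ⊢
      rw [ih]
  | cons x xs ih =>
    simp only [List.length_cons, List.replicate_succ, List.cons_append, merge, List.headD_cons,
      List.tail_cons] at ih ⊢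
    rw [ih]

theorem qsat_quants (d : α) (D : Set α) (bl : List (ℕ × ℕ)) (Φ : List α → Prop) :
    qsat D (quants bl) Φ ↔ play D bl fun X Y => Φ (merge d (quants bl) X Y) := by
  induction bl generalizing Φ with
  | nil => rfl
  | cons b bl ih =>
    rw [quants, List.flatMap_cons, ← quants, qsat_append, qsat_append, qsat_replicate_true]
    simp only [qsat_replicate_false, ih, play]
    refine forall₃_congr fun xs hxs hxD => exists_congr fun ys => and_congr_right fun hys =>
      and_congr_right fun hyD => ?_
    have hm : ∀ X Y, merge d (List.replicate b.1 true ++ (List.replicate b.2 false ++ quants bl))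
        (xs ++ X) (ys ++ Y) = xs ++ (ys ++ merge d (quants bl) X Y) := fun X Y => by
      rw [← List.append_assoc, merge_append d b _ _ _ _ _ hxs hys]
    simp only [hm, List.append_assoc]

end Game

/-! Interpretations of formulas. -/

section Interp

variable {α : Type}

/-- The atoms of a formula. -/
def atoms : Mat → List Mat
  | .fls => []
  | .eq t u => [.eq t u]
  | .rel P ts => [.rel P ts]
  | .imp φ ψ => atoms φ ++ atoms ψ

/-- The constant symbols of a term. -/
def Tm.consts : Tm → List ℕ
  | .var _ => []
  | .con c => [c]

/-- The constant symbols of a formula. -/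
def consts : Mat → List ℕ
  | .fls => []
  | .eq t u => t.consts ++ u.consts
  | .rel _ ts => ts.flatMap Tm.consts
  | .imp φ ψ => consts φ ++ consts ψ

/-- No variable from `X` occurs in the term. -/
def Tm.Avoids (X : Set ℕ) : Tm → Prop
  | .var i => i ∉ X
  | .con _ => True

/-- No variable from `X` occurs in the formula. -/
def Mat.Avoids (X : Set ℕ) : Mat → Prop
  | .fls => True
  | .eq t u => t.Avoids X ∧ u.Avoids X
  | .rel _ ts => ∀ t ∈ ts, t.Avoids X
  | .imp φ ψ => φ.Avoids X ∧ ψ.Avoids X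

theorem length_atoms_le (φ : Mat) : (atoms φ).length ≤ (encM φ).length := by
  induction φ with
  | imp φ ψ h1 h2 => simp only [atoms, encM, List.length_cons, List.length_append]; omega
  | _ => simp [atoms, encM]

theorem length_consts_le (φ : Mat) : (consts φ).length ≤ (encM φ).length := by
  have ht : ∀ t : Tm, t.consts.length ≤ (encT t).length := by
    intro t; cases t <;> simp [Tm.consts, encT]
  induction φ with
  | fls => simp [consts]
  | eq t u =>
    have h1 := ht t
    have h2 := ht u
    simp only [consts, encM, List.length_cons, List.length_append]; omega
  | rel P ts =>
    have : (ts.flatMap Tm.consts).length ≤ (ts.flatMap encT).length := by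
      induction ts with
      | nil => simp
      | cons t ts ih =>
        have := ht t
        simp only [List.flatMap_cons, List.length_append]; omega
    simp only [consts, encM, List.length_cons, List.length_append]; omega
  | imp φ ψ h1 h2 => simp only [consts, encM, List.length_cons, List.length_append]; omega

theorem evM_congr_atoms {cI : ℕ → α} {rI : ℕ → List α → Prop} {a a' : ℕ → α} {φ : Mat}
    (h : ∀ A ∈ atoms φ, evM cI rI a A ↔ evM cI rI a' A) : evM cI rI a φ ↔ evM cI rI a' φ := by
  induction φ with
  | fls => rfl
  | eq t u => exact h _ (by simp [atoms])
  | rel P ts => exact h _ (by simp [atoms])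
  | imp φ ψ h1 h2 =>
    rw [evM, evM, h1 fun A hA => h A (by simp [atoms, hA]), h2 fun A hA => h A
      (by simp [atoms, hA])]

theorem evM_congr_avoids {cI : ℕ → α} {rI : ℕ → List α → Prop} {a a' : ℕ → α} {X : Set ℕ} {φ : Mat}
    (hφ : φ.Avoids X) (h : ∀ i ∉ X, a i = a' i) : evM cI rI a φ ↔ evM cI rI a' φ := by
  have ht : ∀ t : Tm, t.Avoids X → evT cI a t = evT cI a' t := by
    rintro (i | c) hi
    · exact h i hi
    · rfl
  induction φ with
  | fls => rfl
  | eq t u => rw [evM, evM, ht t hφ.1, ht u hφ.2]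
  | rel P ts => rw [evM, evM, List.map_congr_left fun t h => ht t (hφ t h)]
  | imp φ ψ h1 h2 => exact imp_congr (h1 hφ.1) (h2 hφ.2)

theorem evM_congr_consts {cI cI' : ℕ → α} {rI : ℕ → List α → Prop} {a : ℕ → α} {φ : Mat}
    (h : ∀ c ∈ consts φ, cI c = cI' c) : evM cI rI a φ ↔ evM cI' rI a φ := by
  have ht : ∀ t : Tm, (∀ c ∈ t.consts, cI c = cI' c) → evT cI a t = evT cI' a t := by
    rintro (i | c) hi
    · rfl
    · exact hi c (by simp [Tm.consts])
  induction φ with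
  | fls => rfl
  | eq t u =>
    rw [evM, evM, ht t fun c hc => h c (by simp [consts, hc]),
      ht u fun c hc => h c (by simp [consts, hc])]
  | rel P ts =>
    rw [evM, evM, List.map_congr_left fun t h' => ht t fun c hc =>
      h c (List.mem_flatMap.2 ⟨t, h', hc⟩)]
  | imp φ ψ h1 h2 =>
    exact imp_congr (h1 fun c hc => h c (by simp [consts, hc]))
      (h2 fun c hc => h c (by simp [consts, hc]))

/-- A sentence has a small model if each atom contains only universal variables or only existential
variables, apart from the existential variables at the beginning of the quantifier prefix. -/
theorem exists_small_model {cI : ℕ → α} {rI : ℕ → List α → Prop} {ψ : Mat} {z : ℕ}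
    {bl : List (ℕ × ℕ)} (d : α)
    (hsep : ∀ A ∈ atoms ψ, A.Avoids {v | z ≤ v ∧ (quants bl)[v - z]? = some true} ∨
      A.Avoids {v | z ≤ v ∧ (quants bl)[v - z]? = some false})
    (h : qsat Set.univ (.replicate z false ++ quants bl) fun l =>
      evM cI rI (fun i => l.getD i d) ψ) :
    ∃ D : Finset α, d ∈ D ∧ (∀ c ∈ consts ψ, cI c ∈ D) ∧
      D.card ≤ 1 + z + (consts ψ).length + repr (atoms ψ).length bl ∧
      qsat ↑D (.replicate z false ++ quants bl) fun l => evM cI rI (fun i => l.getD i d) ψ := by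
  classical
  rw [qsat_append, qsat_replicate_false] at h
  obtain ⟨zs, hz, -, h⟩ := h
  rw [qsat_quants d] at h
  -- the values of all variables, given those of the universal and of the existential ones
  set a : List α → List α → ℕ → α := fun X Y i => (zs ++ merge d (quants bl) X Y).getD i d with ha
  have hax : ∀ X Y Y', ∀ i ∉ {v | z ≤ v ∧ (quants bl)[v - z]? = some false},
      a X Y i = a X Y' i := by
    intro X Y Y' i hi
    simp only [Set.mem_ofPred_eq, not_and] at hi
    by_cases hiz : i < z
    · simp only [ha]
      rw [List.getD_append _ _ _ _ (by omega), List.getD_append _ _ _ _ (by omega)]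
    · simp only [ha]
      rw [List.getD_append_right _ _ _ _ (by omega), List.getD_append_right _ _ _ _ (by omega), hz]
      exact getD_merge_of_univ d (hi (by omega)) _ _ _
  have hay : ∀ X X' Y, ∀ i ∉ {v | z ≤ v ∧ (quants bl)[v - z]? = some true},
      a X Y i = a X' Y i := by
    intro X X' Y i hi
    simp only [Set.mem_ofPred_eq, not_and] at hi
    by_cases hiz : i < z
    · simp only [ha]
      rw [List.getD_append _ _ _ _ (by omega), List.getD_append _ _ _ _ (by omega)]
    · simp only [ha]
      rw [List.getD_append_right _ _ _ _ (by omega), List.getD_append_right _ _ _ _ (by omega), hz]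
      exact getD_merge_of_ex d (hi (by omega)) _ _ _
  -- the truth values of the atoms that do not depend on the universal variables
  let τ : List α → Set (Fin (atoms ψ).length) := fun Y => {i | evM cI rI (a [] Y) (atoms ψ)[i]}
  obtain ⟨D0, hD1, hD2⟩ := exists_representatives bl τ
  have hR : ∀ X Y Y', τ Y = τ Y' → evM cI rI (a X Y) ψ → evM cI rI (a X Y') ψ := by
    intro X Y Y' hY
    refine (evM_congr_atoms fun A hA => ?_).1
    rcases hsep A hA with hav | hav
    · rw [evM_congr_avoids hav (hay X [] Y), evM_congr_avoids hav (hay X [] Y')]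
      obtain ⟨i, hi, rfl⟩ := List.getElem_of_mem hA
      exact Set.ext_iff.1 hY ⟨i, hi⟩
    · exact evM_congr_avoids hav (hax X Y Y')
  refine ⟨{d} ∪ zs.toFinset ∪ ((consts ψ).map cI).toFinset ∪ D0, by simp, fun c hc => ?_, ?_, ?_⟩
  · simp only [Finset.mem_union, List.mem_toFinset, List.mem_map]
    exact .inl (.inr ⟨c, hc, rfl⟩)
  · have h1 := Finset.card_union_le ({d} ∪ zs.toFinset ∪ ((consts ψ).map cI).toFinset) D0
    have h2 := Finset.card_union_le ({d} ∪ zs.toFinset) ((consts ψ).map cI).toFinset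
    have h3 := Finset.card_union_le {d} zs.toFinset
    have h4 := List.toFinset_card_le zs
    have h5 := List.toFinset_card_le ((consts ψ).map cI)
    rw [List.length_map] at h5
    rw [Finset.card_singleton] at h3
    omega
  · rw [qsat_append, qsat_replicate_false]
    refine ⟨zs, hz, fun y hy => by simp [hy], ?_⟩
    rw [qsat_quants d]
    exact hD2 _ hR h _ fun x hx => by simp at hx ⊢; tauto

end Interp

open FirstOrder FirstOrder.Language

/-! ### First-order sentences -/

/-- The term as an element of `Tm`. -/
def toTm {n : ℕ} : sig.Term (Empty ⊕ Fin n) → Tm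
  | .var (Sum.inr i) => .var i
  | .func (l := 0) c _ => .con c

/-- The quantifier-free formula as an element of `Mat`; the value on other formulas is arbitrary. -/
def toMat : {n : ℕ} → sig.BoundedFormula Empty n → Mat
  | _, .falsum => .fls
  | _, .equal t u => .eq (toTm t) (toTm u)
  | _, .rel (l := l) P ts => .rel P (List.ofFn fun i : Fin l => toTm (ts i))
  | _, .imp φ ψ => .imp (toMat φ) (toMat ψ)
  | _, .all _ => .fls

theorem map_sym_digits (k : ℕ) : (digits k).map sym = dg k := by
  simp [digits, dg, sym, Function.comp_def]

theorem map_sym_encodeTerm {n : ℕ} (t : sig.Term (Empty ⊕ Fin n)) :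
    (encodeTerm t).map sym = encT (toTm t) := by
  rcases t with (⟨⟨⟩⟩ | i) | ⟨c, ts⟩
  · simp [encodeTerm, encT, toTm, map_sym_digits, sym]
  · rename_i l
    cases l with
    | zero => simp [encodeTerm, encT, toTm, map_sym_digits, sym]
    | succ l => exact c.elim

theorem map_sym_encode {n : ℕ} {φ : sig.BoundedFormula Empty n} (h : φ.IsQF) :
    (encode φ).map sym = encM (toMat φ) := by
  induction h with
  | falsum => rfl
  | of_isAtomic h =>
    cases h with
    | equal t u =>
      simp [Term.bdEqual, encode, encM, toMat, map_sym_encodeTerm, sym]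
    | rel P ts =>
      simp [Relations.boundedFormula, encode, encM, toMat, map_sym_encodeTerm, sym, map_sym_digits,
        List.map_flatten, List.map_ofFn, List.flatMap, Function.comp_def]
  | imp h1 h2 ih1 ih2 => simp [encode, encM, toMat, ih1, ih2, sym]

theorem below_toTm {n : ℕ} (t : sig.Term (Empty ⊕ Fin n)) : (toTm t).Below n := by
  rcases t with (⟨⟨⟩⟩ | i) | ⟨c, ts⟩
  · exact i.2
  · rename_i l
    cases l with
    | zero => trivial
    | succ l => exact c.elim

theorem below_toMat : {n : ℕ} → (φ : sig.BoundedFormula Empty n) → (toMat φ).Below n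
  | _, .falsum => trivial
  | _, .equal t u => ⟨below_toTm t, below_toTm u⟩
  | _, .rel _ ts => by
    intro t ht
    obtain ⟨i, rfl⟩ := List.mem_ofFn.1 ht
    exact below_toTm _
  | _, .imp φ ψ => ⟨below_toMat φ, below_toMat ψ⟩
  | _, .all _ => trivial

open scoped Classical in
/-- The quantifier prefix of `quantify U φ`, for a formula `φ` with `N` variables; `true` stands for
a universal quantifier. -/
noncomputable def prefixOf (U : Set ℕ) (N : ℕ) : List Bool :=
  (List.range N).map fun v => decide (v ∈ U)

theorem length_prefixOf (U : Set ℕ) (N : ℕ) : (prefixOf U N).length = N := by simp [prefixOf]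

open scoped Classical in
theorem prefixOf_succ (U : Set ℕ) (N : ℕ) :
    prefixOf U (N + 1) = prefixOf U N ++ [decide (N ∈ U)] := by
  simp [prefixOf, List.range_succ]

theorem encI_append (k : ℕ) (qs qs' : List Bool) :
    encI k (qs ++ qs') = encI k qs ++ encI (k + qs.length) qs' := by
  induction qs generalizing k with
  | nil => rfl
  | cons q qs ih =>
    have : k + 1 + qs.length = k + (qs.length + 1) := by omega
    cases q <;> simp [encI, ih, this]

theorem map_sym_encode_quantify (U : Set ℕ) {N : ℕ} (φ : sig.BoundedFormula Empty N) :
    (encode (quantify U φ)).map sym = encI 0 (prefixOf U N) ++ ((encode φ).map sym ++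
      .replicate (2 * (prefixOf U N).count false) .fls) := by
  induction N with
  | zero => simp [quantify, prefixOf, encI]
  | succ N ih =>
    rw [quantify, ih, prefixOf_succ, encI_append, length_prefixOf, List.count_append, zero_add]
    by_cases h : N ∈ U
    · simp [h, encI, encode, sym, map_sym_digits]
    · simp [h, encI, encode, sym, map_sym_digits, BoundedFormula.ex, BoundedFormula.not,
        mul_add, List.replicate_succ]

theorem stops_replicate_fls (n : ℕ) : Stops (.replicate n .fls) := by
  cases n <;> simp [Stops, isBit, List.replicate_succ]

/-! Models of a sentence and interpretations. -/

section Models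

variable {α : Type}

theorem realize_quantify [sig.Structure α] (d : α) (U : Set ℕ) {N : ℕ}
    (φ : sig.BoundedFormula Empty N) : Sentence.Realize α (quantify U φ) ↔
      qsat Set.univ (prefixOf U N) fun l =>
        φ.Realize (default : Empty → α) fun i : Fin N => l.getD i d := by
  induction N with
  | zero =>
    simp only [quantify, prefixOf, List.range_zero, List.map_nil, qsat, Sentence.Realize,
      Formula.Realize]
    exact iff_of_eq (congrArg _ (Subsingleton.elim _ _))
  | succ N ih =>
    rw [quantify, ih, prefixOf_succ, qsat_append]
    refine qsat_congr fun l hl _ => ?_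
    rw [length_prefixOf] at hl
    have key : ∀ x : α, (Fin.snoc (fun i : Fin N => l.getD i d) x : Fin (N + 1) → α) =
        fun i : Fin (N + 1) => (l ++ [x]).getD i d := by
      intro x
      ext i
      refine Fin.lastCases ?_ (fun i => ?_) i
      · simp [← hl]
      · have : (i : ℕ) < l.length := hl ▸ i.2
        rw [Fin.snoc_castSucc, List.getD_append _ _ _ _ (by simpa using this)]
        rfl
    by_cases h : N ∈ U
    · rw [if_pos h]
      simp only [decide_true, qsat, BoundedFormula.realize_all, key, Set.mem_univ,
        forall_const, h]
    · rw [if_neg h]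
      simp only [decide_false, qsat, BoundedFormula.realize_ex, key, Set.mem_univ,
        true_and, h]

/-- The interpretation of the predicate symbols in a structure; the number of arguments tells the
predicate symbols of different arities apart. -/
def relI (α : Type) [sig.Structure α] (P : ℕ) (l : List α) : Prop :=
  ∃ (n : ℕ) (f : Fin n → α), l = List.ofFn f ∧ Structure.RelMap (L := sig) (n := n) P f

/-- The interpretation of the constant symbols in a structure. -/
def conOf (α : Type) [sig.Structure α] (c : ℕ) : α :=
  Structure.funMap (L := sig) (n := 0) c Fin.elim0

theorem evT_toTm [sig.Structure α] (a : ℕ → α) {n : ℕ} (t : sig.Term (Empty ⊕ Fin n)) :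
    evT (conOf α) a (toTm t) = t.realize (Sum.elim default fun i : Fin n => a i) := by
  rcases t with (⟨⟨⟩⟩ | i) | ⟨c, ts⟩
  · rfl
  · rename_i l
    cases l with
    | zero =>
      simp only [toTm, evT, conOf, Term.realize]
      exact congrArg _ (Subsingleton.elim _ _)
    | succ l => exact c.elim

theorem relI_ofFn [sig.Structure α] (P : ℕ) {n : ℕ} (f : Fin n → α) :
    relI α P (List.ofFn f) ↔ Structure.RelMap (L := sig) (n := n) P f := by
  constructor
  · rintro ⟨n', f', h, h'⟩
    obtain rfl : n = n' := by simpa using congrArg List.length h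
    rwa [List.ofFn_injective h]
  · exact fun h => ⟨n, f, rfl, h⟩

theorem evM_toMat [sig.Structure α] (a : ℕ → α) {n : ℕ} {φ : sig.BoundedFormula Empty n}
    (h : φ.IsQF) : evM (conOf α) (relI α) a (toMat φ) ↔
      φ.Realize (default : Empty → α) fun i : Fin n => a i := by
  induction h with
  | falsum => rfl
  | of_isAtomic h =>
    cases h with
    | equal t u => simp [Term.bdEqual, toMat, evM, evT_toTm, BoundedFormula.Realize]
    | rel P ts =>
      simp only [Relations.boundedFormula, toMat, evM, List.map_ofFn, BoundedFormula.Realize]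
      rw [relI_ofFn]
      simp [Function.comp_def, evT_toTm]
  | imp h1 h2 ih1 ih2 => simp [toMat, evM, ih1, ih2]

/-- The structure with given interpretations of the symbols. -/
@[reducible] def structureOf (cI : ℕ → α) (rI : ℕ → List α → Prop) : sig.Structure α where
  funMap {n} := match n with
    | 0 => fun c _ => cI c
    | _ + 1 => fun f _ => f.elim
  RelMap {_} P f := rI P (List.ofFn f)

theorem isSatisfiable_iff (U : Set ℕ) {N : ℕ} {ψ : sig.BoundedFormula Empty N} (h : ψ.IsQF) :
    Theory.IsSatisfiable ({quantify U ψ} : sig.Theory) ↔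
      ∃ (α : Type) (cI : ℕ → α) (rI : ℕ → List α → Prop) (d : α),
        qsat Set.univ (prefixOf U N) fun l => evM cI rI (fun i => l.getD i d) (toMat ψ) := by
  constructor
  · rintro ⟨M⟩
    have d : M := Classical.arbitrary M
    refine ⟨M, conOf M, relI M, d, ?_⟩
    have hM : Sentence.Realize M (quantify U ψ) := Theory.realize_sentence_of_mem
      ({quantify U ψ} : sig.Theory) rfl
    rw [realize_quantify d] at hM
    simpa only [evM_toMat _ h] using hM
  · rintro ⟨α, cI, rI, d, hq⟩
    let _ := structureOf cI rI
    have hc : conOf α = cI := rfl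
    have hr : relI α = rI := by
      funext P l
      refine propext ⟨?_, fun h => ?_⟩
      · rintro ⟨n, f, rfl, h⟩
        exact h
      · exact ⟨l.length, l.get, by simp, by
          change rI P (List.ofFn l.get)
          rwa [List.ofFn_get]⟩
    have hα : Sentence.Realize α (quantify U ψ) := by
      rw [realize_quantify d]
      rw [← hc, ← hr] at hq
      simpa only [evM_toMat _ h] using hq
    have : Nonempty α := ⟨d⟩
    have : α ⊨ ({quantify U ψ} : sig.Theory) := by
      rw [Theory.model_iff]
      rintro _ rfl
      exact hα
    exact ⟨Theory.ModelType.of _ α⟩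

end Models

/-! ### Models on initial segments of the natural numbers -/

section Transport

variable {α β : Type}

theorem qsat_image (f : α → β) (D : Set α) (qs : List Bool) (Φ : List β → Prop) :
    qsat (f '' D) qs Φ ↔ qsat D qs fun l => Φ (l.map f) := by
  induction qs generalizing Φ with
  | nil => rfl
  | cons q qs ih => cases q <;> simp [qsat, ih]

theorem evT_map (f : α → β) (cI : ℕ → α) (a : ℕ → α) (t : Tm) :
    evT (fun c => f (cI c)) (fun i => f (a i)) t = f (evT cI a t) := by
  cases t <;> rfl

theorem evM_map {f : α → β} {D : Set α} (hf : D.InjOn f) {cI a : ℕ → α} (hc : ∀ c, cI c ∈ D)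
    (ha : ∀ i, a i ∈ D) (rI : ℕ → List β → Prop) (φ : Mat) :
    evM (fun c => f (cI c)) rI (fun i => f (a i)) φ ↔
      evM cI (fun P l => rI P (l.map f)) a φ := by
  have ht : ∀ t, evT cI a t ∈ D := by
    rintro (i | c)
    · exact ha i
    · exact hc c
  induction φ with
  | fls => rfl
  | eq t u => simp only [evM, evT_map, hf.eq_iff (ht t) (ht u)]
  | rel P ts =>
    have : evT (fun c => f (cI c)) (fun i => f (a i)) = fun t => f (evT cI a t) :=
      funext (evT_map f cI a)
    simp only [evM, List.map_map, this, Function.comp_def]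
  | imp φ ψ h1 h2 => simp only [evM, h1, h2]

theorem getD_mem {D : Set α} {d : α} (hd : d ∈ D) {l : List α} (hl : ∀ x ∈ l, x ∈ D) (i : ℕ) :
    l.getD i d ∈ D := by
  by_cases hi : i < l.length
  · simpa [List.getD, hi] using hl _ (List.getElem_mem hi)
  · simpa [List.getD, hi] using hd

theorem qsat_evM_map {f : α → β} {D : Set α} (hf : D.InjOn f) {cI : ℕ → α} (hc : ∀ c, cI c ∈ D)
    {d : α} (hd : d ∈ D) (rI : ℕ → List β → Prop) (qs : List Bool) (ψ : Mat) :
    (qsat (f '' D) qs fun l => evM (fun c => f (cI c)) rI (fun i => l.getD i (f d)) ψ) ↔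
      qsat D qs fun l => evM cI (fun P l => rI P (l.map f)) (fun i => l.getD i d) ψ := by
  rw [qsat_image]
  refine qsat_congr fun l _ hl => ?_
  simp only [List.getD_map]
  exact evM_map hf hc (getD_mem hd hl) rI ψ

/-- A model with `m + 1` elements can be moved to the domain `{0, …, m}`. -/
theorem exists_nat_model {cI : ℕ → α} {rI : ℕ → List α → Prop} {d : α} {D : Finset α} {m : ℕ}
    {qs : List Bool} {ψ : Mat} (hd : d ∈ D) (hD : D.card = m + 1) (hc : ∀ c ∈ consts ψ, cI c ∈ D)
    (h : qsat ↑D qs fun l => evM cI rI (fun i => l.getD i d) ψ) :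
    ∃ (cI' : ℕ → ℕ) (rI' : ℕ → List ℕ → Prop), (∀ c, cI' c ≤ m) ∧
      qsat {j | j ≤ m} qs fun js => evM cI' rI' (fun i => js.getD i 0) ψ := by
  classical
  let e0 : D ≃ Fin (m + 1) := D.equivFin.trans (finCongr hD)
  -- The default value `d` becomes `0`.
  let e : D ≃ Fin (m + 1) := e0.trans (Equiv.swap (e0 ⟨d, hd⟩) 0)
  let g : ℕ → α := fun j => if h : j < m + 1 then (e.symm ⟨j, h⟩ : α) else d
  have hg0 : g 0 = d := by
    have : e.symm 0 = ⟨d, hd⟩ := by simp [e]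
    change (if h : 0 < m + 1 then (e.symm ⟨0, h⟩ : α) else d) = d
    rw [dif_pos (Nat.succ_pos m)]
    exact congrArg Subtype.val this
  have hgj : ∀ j (h : j ≤ m), g j = e.symm ⟨j, Nat.lt_succ_of_le h⟩ := fun j h =>
    dif_pos (Nat.lt_succ_of_le h)
  have hgD : ∀ x ∈ D, ∃ j ≤ m, g j = x := fun x hx =>
    ⟨e ⟨x, hx⟩, Nat.lt_succ_iff.1 (e ⟨x, hx⟩).2, by
      rw [hgj _ (Nat.lt_succ_iff.1 (e ⟨x, hx⟩).2)]
      simp⟩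
  have hg : Set.InjOn g {j | j ≤ m} := by
    intro i hi j hj hij
    rw [hgj i hi, hgj j hj] at hij
    simpa using e.symm.injective (Subtype.ext hij)
  have him : g '' {j | j ≤ m} = ↑D := by
    ext x
    constructor
    · rintro ⟨j, hj, rfl⟩
      rw [hgj j hj]
      exact (e.symm _).2
    · exact fun hx => hgD x hx
  have hcI : ∀ c, ∃ j ≤ m, c ∈ consts ψ → g j = cI c := by
    intro c
    by_cases h : c ∈ consts ψ
    · obtain ⟨j, hj, h'⟩ := hgD _ (hc c h)
      exact ⟨j, hj, fun _ => h'⟩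
    · exact ⟨0, Nat.zero_le _, fun h' => absurd h' h⟩
  choose cI' hc1 hc2 using hcI
  refine ⟨cI', fun P l => rI P (l.map g), hc1, ?_⟩
  rw [← qsat_evM_map hg hc1 (Nat.zero_le m) rI, him, hg0]
  refine (qsat_congr fun l _ _ => ?_).1 h
  exact evM_congr_consts fun c hc => (hc2 c hc).symm

theorem exists_type_model {cI : ℕ → ℕ} {rI : ℕ → List ℕ → Prop} {m : ℕ} {qs : List Bool} {ψ : Mat}
    (hc : ∀ c, cI c ≤ m)
    (h : qsat {j | j ≤ m} qs fun js => evM cI rI (fun i => js.getD i 0) ψ) :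
    ∃ (α : Type) (cI : ℕ → α) (rI : ℕ → List α → Prop) (d : α),
      qsat Set.univ qs fun l => evM cI rI (fun i => l.getD i d) ψ := by
  refine ⟨Fin (m + 1), fun c => ⟨cI c, Nat.lt_succ_of_le (hc c)⟩,
    fun P l => rI P (l.map Fin.val), 0, ?_⟩
  rw [← qsat_evM_map (Fin.val_injective.injOn) (fun _ => Set.mem_univ _) (Set.mem_univ 0) rI]
  have : Fin.val '' (Set.univ : Set (Fin (m + 1))) = {j | j ≤ m} := by
    ext j
    simp
  rw [this]
  exact h

end Transport

/-! ### The quantifier prefix of a separated sentence -/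

/-- The blocks of a quantifier prefix are not finer than those given by block numbers: the list `bs`
consists of the block numbers, which are odd for universal variables. -/
theorem nblk_le {n : ℕ} {bs : List ℕ} (hs : bs.Pairwise (· ≤ ·)) (hn : ∀ x ∈ bs, x ≤ 2 * n)
    {l : Bool} {c : ℕ} (hc : ∀ x ∈ bs, c ≤ x) (hcn : c ≤ 2 * n) (hl : l = true → Odd c) :
    2 * nblk l (bs.map fun x => decide (Odd x)) + c + (if l then 2 else 0) ≤ 2 * n + 1 := by
  induction bs generalizing l c with
  | nil =>
    cases l
    · simpa [nblk] using by omega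
    · obtain ⟨k, rfl⟩ := hl rfl
      simp [nblk]
      omega
  | cons x bs ih =>
    obtain ⟨h1, h2⟩ := List.pairwise_cons.1 hs
    have hcx := hc x (by simp)
    have hxn := hn x (by simp)
    have ih := fun l => @ih h2 (fun y hy => hn y (by simp [hy])) l x h1 hxn
    by_cases hx : Odd x
    · have := ih true fun _ => hx
      cases l <;> simp [nblk, hx] at this ⊢ <;> omega
    · have := ih false (by simp)
      obtain ⟨k, hk⟩ := Nat.not_odd_iff_even.1 hx
      cases l
      · simp [nblk, hx] at this ⊢
        omega
      · obtain ⟨j, rfl⟩ := hl rfl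
        simp [nblk, hx] at this ⊢
        omega

theorem nblk_prefixOf_le {n N : ℕ} {b : ℕ → ℕ} (hb : Monotone b) (hn : ∀ v < N, b v ≤ 2 * n) :
    nblk false (prefixOf {v | Odd (b v)} N) ≤ n := by
  have h := nblk_le (n := n) (bs := (List.range N).map b) (l := false) (c := 0)
    (List.pairwise_map.2 (List.pairwise_lt_range.imp fun h => hb h.le))
    (by simpa using hn) (by simp) (by simp) (by simp)
  have e : ((List.range N).map b).map (fun x => decide (Odd x)) = prefixOf {v | Odd (b v)} N := by
    simp [prefixOf, Function.comp_def]
  rw [e] at h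
  simp at h
  omega

theorem avoids_toTm {n : ℕ} {X : Set ℕ} {t : sig.Term (Empty ⊕ Fin n)}
    (h : ∀ v ∈ termVars t, v ∉ X) : (toTm t).Avoids X := by
  rcases t with (⟨⟨⟩⟩ | i) | ⟨c, ts⟩
  · exact h i (by simp [termVars])
  · rename_i l
    cases l with
    | zero => trivial
    | succ l => exact c.elim

/-- Each atom of `toMat φ` comes from an atom of `φ`. -/
theorem exists_mem_atomVars : {n : ℕ} → (φ : sig.BoundedFormula Empty n) → ∀ A ∈ atoms (toMat φ),
    ∃ V ∈ atomVars φ, ∀ X : Set ℕ, (∀ v ∈ V, v ∉ X) → A.Avoids X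
  | _, .falsum => by simp [toMat, atoms]
  | _, .equal t u => by
    intro A hA
    obtain rfl : A = _ := by simpa [toMat, atoms] using hA
    exact ⟨_, rfl, fun X h => ⟨avoids_toTm fun v hv => h v (.inl hv),
      avoids_toTm fun v hv => h v (.inr hv)⟩⟩
  | _, .rel P ts => by
    intro A hA
    obtain rfl : A = _ := by simpa [toMat, atoms] using hA
    refine ⟨_, rfl, fun X h t ht => ?_⟩
    obtain ⟨i, rfl⟩ := List.mem_ofFn.1 ht
    exact avoids_toTm fun v hv => h v (Set.mem_iUnion.2 ⟨i, hv⟩)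
  | _, .imp φ ψ => by
    intro A hA
    rcases List.mem_append.1 hA with h | h
    · obtain ⟨V, hV, hX⟩ := exists_mem_atomVars φ A h
      exact ⟨V, .inl hV, hX⟩
    · obtain ⟨V, hV, hX⟩ := exists_mem_atomVars ψ A h
      exact ⟨V, .inr hV, hX⟩
  | _, .all _ => by simp [toMat, atoms]

theorem getElem?_prefixOf {U : Set ℕ} {N v : ℕ} {q : Bool} (h : (prefixOf U N)[v]? = some q) :
    v < N ∧ (q = true ↔ v ∈ U) := by
  classical
  obtain ⟨hv, rfl⟩ := List.getElem?_eq_some_iff.1 h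
  rw [length_prefixOf] at hv
  exact ⟨hv, by simp [prefixOf]⟩

theorem avoids_of_separatedIn {N z : ℕ} {b : ℕ → ℕ} {ψ : sig.BoundedFormula Empty N}
    {bl : List (ℕ × ℕ)} (hb : Monotone b)
    (hsep : SeparatedIn {v | v < N ∧ Odd (b v)} {v | v < N ∧ Even (b v) ∧ b v ≠ 0} ψ)
    (hq : prefixOf {v | Odd (b v)} N = .replicate z false ++ quants bl) (hbl : ∀ b ∈ bl, 1 ≤ b.1)
    (A : Mat) (hA : A ∈ atoms (toMat ψ)) :
    A.Avoids {v | z ≤ v ∧ (quants bl)[v - z]? = some true} ∨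
      A.Avoids {v | z ≤ v ∧ (quants bl)[v - z]? = some false} := by
  have hget : ∀ v q, z ≤ v → (quants bl)[v - z]? = some q →
      v < N ∧ (q = true ↔ Odd (b v)) := by
    intro v q hv h
    refine getElem?_prefixOf (U := {v | Odd (b v)}) (v := v) ?_
    rw [hq, List.getElem?_append_right (by simpa using hv)]
    simpa using h
  obtain ⟨V, hV, hX⟩ := exists_mem_atomVars ψ A hA
  refine (hsep.2 V hV).imp (fun h => hX _ fun v hv hv' => ?_) fun h => hX _ fun v hv hv' => ?_
  · obtain ⟨h1, h2⟩ := hget v _ hv'.1 hv'.2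
    exact Set.eq_empty_iff_forall_notMem.1 h v ⟨hv, h1, h2.1 rfl⟩
  · obtain ⟨h1, h2⟩ := hget v _ hv'.1 hv'.2
    have he : ¬ Odd (b v) := fun h => by simpa using h2.2 h
    refine Set.eq_empty_iff_forall_notMem.1 h v ⟨hv, h1, Nat.not_odd_iff_even.1 he, ?_⟩
    -- The variable `z` is universal, hence its block number is positive.
    obtain _ | ⟨⟨p, q⟩, bl⟩ := bl
    · simp [quants] at hv'
    · have hp : 1 ≤ p := hbl (p, q) (by simp)
      obtain ⟨p, rfl⟩ : ∃ p', p = p' + 1 := ⟨p - 1, by omega⟩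
      have hz := (hget z true le_rfl (by simp [quants, List.replicate_succ])).2.1 rfl
      have := hb hv'.1
      have := hz.pos
      omega

theorem repr_bound {M C z L : ℕ} {bl : List (ℕ × ℕ)} (hb : ∀ b ∈ bl, 1 ≤ b.1)
    (hM : M + z + (quants bl).length ≤ L) (hC : C + z ≤ L) :
    z + C + repr M bl ≤ tower bl.length (8 * L) := by
  cases bl with
  | nil => simp only [repr, List.length_nil, tower]; omega
  | cons b bl =>
    have hq : ∀ bl : List (ℕ × ℕ), (∀ b ∈ bl, 1 ≤ b.1) →
        (bl.map Prod.snd).sum + bl.length ≤ (quants bl).length := by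
      intro bl hb
      induction bl with
      | nil => simp
      | cons b bl ih =>
        have h1 := ih fun x hx => hb x (by simp [hx])
        have h2 := hb b (by simp)
        simp only [quants, List.flatMap_cons, List.length_append, List.length_replicate,
          List.map_cons, List.sum_cons, List.length_cons] at h1 ⊢
        omega
    have h1 := repr_le M b bl
    have h2 := hq _ hb
    rw [List.length_cons] at h2 ⊢
    have h3 := (tower_strictMono (bl.length + 1)).monotone
      (show M + ((b :: bl).map Prod.snd).sum + bl.length ≤ L by omega)
    have h4 := tower_add_le (bl.length + 1) L L
    have h5 := (tower_strictMono (bl.length + 1)).monotone (show L + L ≤ 8 * L by omega)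
    omega

/-- The small model theorem for the Separated Fragment. -/
theorem isSatisfiable_iff_exists_le {N L : ℕ} {b : ℕ → ℕ} {ψ : sig.BoundedFormula Empty N}
    (hψ : ψ.IsQF) (hb : Monotone b)
    (hsep : SeparatedIn {v | v < N ∧ Odd (b v)} {v | v < N ∧ Even (b v) ∧ b v ≠ 0} ψ)
    (hL : (encI 0 (prefixOf {v | Odd (b v)} N)).length + (encM (toMat ψ)).length ≤ L) :
    FirstOrder.Language.Theory.IsSatisfiable ({quantify {v | Odd (b v)} ψ} : sig.Theory) ↔
      ∃ m ≤ tower (nblk false (prefixOf {v | Odd (b v)} N)) (8 * L),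
        ∃ (cI : ℕ → ℕ) (rI : ℕ → List ℕ → Prop), (∀ c, cI c ≤ m) ∧
          qsat {j | j ≤ m} (prefixOf {v | Odd (b v)} N)
            fun js => evM cI rI (fun i => js.getD i 0) (toMat ψ) := by
  rw [isSatisfiable_iff _ hψ]
  constructor
  · rintro ⟨α, cI, rI, d, h⟩
    obtain ⟨z, bl, hq, hbl, hn⟩ := exists_blocks (prefixOf {v | Odd (b v)} N)
    rw [← hn]
    have h0 := two_mul_length_le_encI 0 (prefixOf {v | Odd (b v)} N)
    rw [hq] at h0 h hL ⊢
    obtain ⟨D, hd, hc, hD, h⟩ := exists_small_model d (avoids_of_separatedIn hb hsep hq hbl) h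
    have h1 := length_atoms_le (toMat ψ)
    have h2 := length_consts_le (toMat ψ)
    rw [List.length_append, List.length_replicate] at h0
    have hS := repr_bound (M := (atoms (toMat ψ)).length) (C := (consts (toMat ψ)).length) (z := z)
      (L := L) hbl (by omega) (by omega)
    have hpos : 0 < D.card := Finset.card_pos.2 ⟨d, hd⟩
    exact ⟨D.card - 1, by omega, exists_nat_model hd (by omega) hc h⟩
  · rintro ⟨m, -, cI, rI, hc, h⟩
    exact exists_type_model hc h

/-! ### The running time -/

theorem tower_le_tower {k n : ℕ} (h : k ≤ n) (x : ℕ) : tower k x ≤ tower n x :=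
  monotone_nat_of_le_succ (f := fun k => tower k x) (fun _ => Nat.lt_two_pow_self.le) h

theorem mul_tower_le (k a : ℕ) {x : ℕ} (hx : 1 ≤ x) : a * tower k x ≤ tower k (a * x) := by
  induction k generalizing a with
  | zero => exact le_rfl
  | succ k ih =>
    refine le_trans ?_ (Nat.pow_le_pow_right (by norm_num) (ih a))
    have ht : 1 ≤ tower k x := hx.trans (le_tower k x)
    rw [tower]
    generalize tower k x = t at ht
    obtain _ | a := a
    · simp
    · calc (a + 1) * 2 ^ t ≤ 2 ^ a * 2 ^ t := Nat.mul_le_mul_right _ Nat.lt_two_pow_self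
        _ = 2 ^ (a + t) := (pow_add ..).symm
        _ ≤ _ := Nat.pow_le_pow_right (by norm_num) (by nlinarith)

/-- The running time of `decider`, simplified. -/
theorem time_le (L S u : ℕ) : (S + 1) ^ u * ((L + 1) * (450 * (logBound L S u + 1))) +
    (L + 1) * (30 * S + 150) + 6 * S ≤ 2850 * (L + 1) ^ 2 * (S + 1) ^ (2 * u + 1) := by
  have hW : 1 ≤ (S + 1) ^ u := Nat.one_le_pow _ _ (by omega)
  have e : (S + 1) ^ (2 * u + 1) = (S + 1) ^ u * (S + 1) ^ u * (S + 1) := by ring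
  rw [e, logBound]
  generalize (S + 1) ^ u = W at hW
  have h1 : W * (L * (2 * S + 6) + 1) + S + 1 ≤ W * ((L + 1) * (2 * S + 6)) := by nlinarith
  calc W * ((L + 1) * (450 * (W * (L * (2 * S + 6) + 1) + S + 1))) + (L + 1) * (30 * S + 150) + 6 *
    S
      ≤ W * ((L + 1) * (450 * (W * ((L + 1) * (2 * S + 6))))) + (L + 1) * (36 * S + 150) := by
        have := Nat.mul_le_mul_left W (Nat.mul_le_mul_left (L + 1) (Nat.mul_le_mul_left 450 h1))
        nlinarith
    _ ≤ W * W * (L + 1) ^ 2 * (450 * (2 * S + 6)) + W * W * (L + 1) ^ 2 * (36 * S + 150) := by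
        have h2 : L + 1 ≤ W * W * (L + 1) ^ 2 := by
          have : 1 ≤ W * W := Nat.mul_pos hW hW
          nlinarith
        have := Nat.mul_le_mul_right (36 * S + 150) h2
        nlinarith
    _ ≤ _ := by
        have : 450 * (2 * S + 6) + (36 * S + 150) ≤ 2850 * (S + 1) := by omega
        have := Nat.mul_le_mul_left (W * W * (L + 1) ^ 2) this
        nlinarith

theorem time_le_tower {k L u : ℕ} (hu : u ≤ L) (h0 : k = 0 → u = 0) :
    2850 * (L + 1) ^ 2 * (tower k (8 * L) + 1) ^ (2 * u + 1) ≤ tower k (22800 * (L + 1) ^ 3) := by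
  cases k with
  | zero =>
    rw [h0 rfl]
    simp only [tower]
    calc 2850 * (L + 1) ^ 2 * (8 * L + 1) ^ (2 * 0 + 1)
        ≤ 2850 * (L + 1) ^ 2 * (8 * (L + 1)) := by
          rw [mul_zero, zero_add, pow_one]
          exact Nat.mul_le_mul_left _ (by omega)
      _ = 22800 * (L + 1) ^ 3 := by ring
  | succ k =>
    simp only [tower]
    set A := tower k (8 * L)
    have h1 : 2850 ≤ 2 ^ 12 := by norm_num
    have h2 : (L + 1) ^ 2 ≤ 2 ^ (2 * L) := by
      rw [mul_comm, pow_mul]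
      exact Nat.pow_le_pow_left Nat.lt_two_pow_self 2
    have h3 : (2 ^ A + 1) ^ (2 * u + 1) ≤ 2 ^ ((A + 1) * (2 * L + 1)) := by
      rw [pow_mul]
      refine (Nat.pow_le_pow_left (m := 2 ^ (A + 1)) ?_ _).trans
        (Nat.pow_le_pow_right (by positivity) (by omega))
      have := Nat.one_le_two_pow (n := A)
      rw [pow_succ]
      omega
    calc 2850 * (L + 1) ^ 2 * (2 ^ A + 1) ^ (2 * u + 1)
        ≤ 2 ^ 12 * 2 ^ (2 * L) * 2 ^ ((A + 1) * (2 * L + 1)) :=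
          Nat.mul_le_mul (Nat.mul_le_mul h1 h2) h3
      _ = 2 ^ (12 + 2 * L + (A + 1) * (2 * L + 1)) := by rw [← pow_add, ← pow_add]
      _ ≤ 2 ^ tower k (22800 * (L + 1) ^ 3) := by
        refine Nat.pow_le_pow_right (by norm_num) ?_
        calc 12 + 2 * L + (A + 1) * (2 * L + 1) ≤ (4 * L + 13) * (A + 1) := by nlinarith
          _ ≤ (4 * L + 13) * tower k (8 * L + 1) := Nat.mul_le_mul_left _ (tower_add_le k (8 * L) 1)
          _ ≤ tower k ((4 * L + 13) * (8 * L + 1)) := mul_tower_le k _ (by omega)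
          _ ≤ _ := (tower_strictMono k).monotone (by
            have : (4 * L + 13) * (8 * L + 1) ≤ 22800 * (L + 1) ^ 2 := by nlinarith
            refine this.trans (Nat.mul_le_mul_left _ (Nat.pow_le_pow_right (by omega) (by omega))))

theorem count_true_eq_zero {qs : List Bool} (h : nblk false qs = 0) : qs.count true = 0 := by
  induction qs with
  | nil => rfl
  | cons q qs ih => cases q <;> simp [nblk] at h ⊢; simpa using ih h

end SF

theorem mainTheorem3 :
    ∃ (M : NTM Letter) (p : Polynomial ℕ), ∀ (n : ℕ) (φ : sig.Sentence), IsSF n φ →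
      M.HaltsWithin (encode φ) (tower n (p.eval (len φ))) ∧
      (M.Accepts (encode φ) ↔ FirstOrder.Language.Theory.IsSatisfiable ({φ} : sig.Theory)) := by
  refine ⟨SF.machine SF.decider, .C 22800 * (.X + 1) ^ 3, ?_⟩
  rintro n _ ⟨N, b, ψ, hb, hn, hψ, hsep, rfl⟩
  set qs := SF.prefixOf {v | Odd (b v)} N with hqs
  have henc : (encode (quantify {v | Odd (b v)} ψ)).map SF.sym = SF.encI 0 qs ++
      (SF.encM (SF.toMat ψ) ++ .replicate (2 * qs.count false) .fls) := by
    rw [SF.map_sym_encode_quantify, SF.map_sym_encode hψ]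
  have hlen := congrArg List.length henc
  rw [List.length_map] at hlen
  set L := (encode (quantify {v | Odd (b v)} ψ)).length with hL
  have hsum : (SF.encI 0 qs).length + (SF.encM (SF.toMat ψ)).length ≤ L := by
    rw [hlen, List.length_append, List.length_append]
    omega
  obtain ⟨R, hR, hR'⟩ := SF.impl_decider henc
    (by rw [hqs, SF.length_prefixOf]; exact SF.below_toMat ψ) (SF.stops_replicate_fls _) rfl
    (List.length_map _) rfl
  obtain ⟨h1, h2⟩ := SF.machine_correct hR
  have hu : qs.count true ≤ L := by
    have := SF.two_mul_length_le_encI 0 qs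
    have := qs.count_le_length (a := true)
    omega
  constructor
  · intro t c htc
    refine (h1 t c htc).trans ((SF.time_le _ _ _).trans
      ((SF.time_le_tower hu SF.count_true_eq_zero).trans ?_))
    refine (SF.tower_le_tower (SF.nblk_prefixOf_le hb hn) _).trans (le_of_eq ?_)
    simp [len, hL]
  · rw [h2, hR', SF.isSatisfiable_iff_exists_le hψ hb hsep hsum]
    exact exists_congr fun m => and_congr_right fun _ => SF.exists_leavesC_iff rfl
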